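/- Let $M$ be a closed manifold of dimension $2n+1$ with a Sasakian structure $(\xi,\eta,\Phi,g)$, i.e. $\eta(\xi)=1$, $\Phi^2=-1+\xi\otimes\eta$, $g(\Phi X,\Phi Y)=g(X,Y)-\eta(X)\eta(Y)$, $g(\Phi X,Y)=d\eta(X,Y)$, where $d\eta(X,Y)=X\eta(Y)-Y\eta(X)-\eta([X,Y])$, and the almost complex structure $I(Y)=\Phi Y-\eta(Y)\,r\partial_r$, $I(r\partial_r)=\xi$ on the cone $M\times\mathbb{R}^+$ is integrable. Let $d\mu$ be the Riemannian volume element of $g$. Let $\mathcal D=\ker\eta$, $J=\Phi|_{\mathcal D}$, let $\mathfrak{cr}$ be the Lie algebra of infinitesimal CR automorphisms of $(\mathcal D,J)$, and let $\mathfrak{cr}^+$ be the cone of those $X\in\mathfrak{cr}$ with $\eta(X)>0$ everywhere (the Reeb fields of the Sasakian structures with underlying CR structure $(\mathcal D,J)$; the Sasaki cone is its quotient by CR automorphisms). For $X\in\mathfrak{cr}^+$ identify $TM/\langle X\rangle$ with $\mathcal D$, denote by $\bar J$ the complex structure that $J$ induces on it, and put $d^c\varphi=-d\varphi\circ\bar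 J$ for an $X$-basic function $\varphi$ (a smooth function with $X\varphi=0$). 1. Let $(\xi_t,\eta_t,\Phi_t,g_t)$, $|t|<\varepsilon$, be a path of Sasakian structures that starts at $(\xi,\eta,\Phi,g)$ when $t=0$, with $\xi_t\in\mathfrak{cr}^+$ and $\eta_t=\frac{1}{\eta(\xi_t)}\eta+\frac12 d^c\varphi_t$, where $\varphi_t$ is $\xi_t$-basic, and $\xi_t,\varphi_t$ are smooth in $(t,x)$. Let $\dot\xi,\dot\varphi$ be the derivatives at $t=0$, and let $\Delta_B=d_B^*d_B$ be the basic Laplacian of $(\xi,\eta,\Phi,g)$. Then the volume elements of $g_t$ satisfy, uniformly on $M$, $$d\mu_t=\Big(1-t\big((n+1)\eta(\dot\xi)+\tfrac12\Delta_B\dot\varphi\big)+O(t^2)\Big)\,d\mu ,$$ with smooth positive densities $d\mu_t/d\mu$ for all $|t|<\varepsilon$; the volumes $\mu_{g_t}(M)$ are finite, and $$\frac{d}{dt}\Big|_{t=0}\mu_{g_t}(M)=-(n+1)\int_M\eta(\dot\xi)\,d\mu .$$ The derivative vanishes if and only if $\eta(\dot\xi)$ is $L^2$-orthogonal to the constants,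 equivalently $\int_M g(\xi,\dot\xi)\,d\mu=0$. 2. For $X\in\mathfrak{cr}^+$ let $\mu(X)$ be the volume of $M$ in the metric $g'=d\eta'\circ(1\otimes\Phi')+\eta'\otimes\eta'$, where $\eta'=\eta/\eta(X)$, $\Phi'X=0$ and $\Phi'|_{\mathcal D}=J$. Then every Sasakian structure with Reeb field $X$ that induces $\bar J$ on $TM/\langle X\rangle$ and has contact form $\frac{1}{\eta(X)}\eta+\frac12d^c\varphi$, with $\varphi$ an $X$-basic function, has volume $\mu(X)$. 3. A field $X\in\mathfrak{cr}$ is the velocity at $t=0$ of a smooth path $\xi_t$ in $\mathfrak{cr}^+$ with $\xi_0=\xi$ and $\mu(\xi_t)=\mu(\xi)$ for all small $t$ if and only if $\eta(X)$ is $L^2$-orthogonal to the constants. 4. For $X,Y\in\mathfrak{cr}$ the Hessian of $\mu$ at $\xi$ is $$D^2\mu(X,Y)=\frac{\partial^2}{\partial s\,\partial t}\Big|_{s=t=0}\mu(\xi+sX+tY)=(n+1)(n+2)\int_M\eta(X)\,\eta(Y)\,d\mu ,$$ and $\mu$ is a convex function on the convex cone $\mathfrak{cr}^+$. -/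

import Mathlib

open Set Filter Topology MeasureTheory
open scoped Manifold ContDiff

noncomputable section

namespace Sasaki

/-- The model space of manifolds of dimension `2 * n + 1`. -/
abbrev E (n : ℕ) : Type := EuclideanSpace ℝ (Fin (2 * n + 1))

/-- The model with corners (no boundary) of manifolds of dimension `2 * n + 1`. -/
abbrev I (n : ℕ) : ModelWithCorners ℝ (E n) (E n) := 𝓘(ℝ, E n)

section Basics

variable {n : ℕ} {M : Type*} [TopologicalSpace M] [ChartedSpace (E n) M]
  [IsManifold (I n) ∞ M]

/-- The differential of a real function, as a function on tangent vectors. -/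
def diff (f : M → ℝ) (x : M) (v : TangentSpace (I n) x) : ℝ :=
  mfderiv (I n) 𝓘(ℝ, ℝ) f x v

/-- The vector field `X` is smooth. -/
def SmoothField (X : Π x : M, TangentSpace (I n) x) : Prop :=
  ContMDiff (I n) (I n).tangent ∞ (fun x => (⟨x, X x⟩ : TangentBundle (I n) M))

/-- The component along the constant vector `w` of a 1-form `α`, read in the preferred chart
at `x`: the function `y ↦ α (∂_w)` on the chart's target. -/
def coordForm (α : Π x : M, TangentSpace (I n) x →L[ℝ] ℝ) (x : M) (w y : E n) : ℝ :=
  α ((extChartAt (I n) x).symm y)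
    (mfderiv 𝓘(ℝ, E n) (I n) (extChartAt (I n) x).symm y w)

/-- The exterior derivative of a 1-form, with the convention
`dα(X, Y) = X (α Y) - Y (α X) - α [X, Y]`, computed in the preferred chart at `x`
as `∂_v (α ∂_w) - ∂_w (α ∂_v)`. -/
def extDeriv₁ (α : Π x : M, TangentSpace (I n) x →L[ℝ] ℝ) (x : M)
    (v w : TangentSpace (I n) x) : ℝ :=
  let v' : E n := mfderiv (I n) 𝓘(ℝ, E n) (extChartAt (I n) x) x v
  let w' : E n := mfderiv (I n) 𝓘(ℝ, E n) (extChartAt (I n) x) x w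
  fderiv ℝ (coordForm α x w') (extChartAt (I n) x x) v' -
    fderiv ℝ (coordForm α x v') (extChartAt (I n) x x) w'

/-- The Gram matrix `g (∂ᵢ, ∂ⱼ)` of a field of bilinear forms in the preferred chart at `x`,
as a function on the chart's target. -/
def gram (g : Π x : M, TangentSpace (I n) x → TangentSpace (I n) x → ℝ) (x : M) (y : E n) :
    Matrix (Fin (2 * n + 1)) (Fin (2 * n + 1)) ℝ :=
  Matrix.of fun i j =>
    g ((extChartAt (I n) x).symm y)
      (mfderiv 𝓘(ℝ, E n) (I n) (extChartAt (I n) x).symm y (EuclideanSpace.basisFun _ ℝ i))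
      (mfderiv 𝓘(ℝ, E n) (I n) (extChartAt (I n) x).symm y (EuclideanSpace.basisFun _ ℝ j))

/-- The measure `√(det gᵢⱼ) dy` of the preferred chart at `x`, transported to `M`. It is
supported in the domain of that chart. -/
def chartMeasure [MeasurableSpace M]
    (g : Π x : M, TangentSpace (I n) x → TangentSpace (I n) x → ℝ) (x : M) : Measure M :=
  Measure.map (extChartAt (I n) x).symm
    ((volume.restrict (extChartAt (I n) x).target).withDensity
      (fun y => ENNReal.ofReal (Real.sqrt (gram g x y).det)))

/-- The Riemannian measure `dμ_g`: the measures `√(det gᵢⱼ) dy` of the charts agree on overlaps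
and their supremum is the measure that restricts to each of them on the domain of its chart. -/
def riemannianMeasure [MeasurableSpace M]
    (g : Π x : M, TangentSpace (I n) x → TangentSpace (I n) x → ℝ) : Measure M :=
  ⨆ x : M, chartMeasure g x

/-- The almost complex structure of the cone `C(M) = M × ℝ⁺`, in the logarithmic radial
coordinate `s = log r` (so that `C(M)` is `M × ℝ` and `r ∂_r = ∂_s`):
`I (Y) = Φ Y - η(Y) r∂_r` for `Y` tangent to `M`, and `I (r∂_r) = ξ`. -/
def coneI (ξ : Π x : M, TangentSpace (I n) x) (η : Π x : M, TangentSpace (I n) x →L[ℝ] ℝ)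
    (Φ : Π x : M, TangentSpace (I n) x →L[ℝ] TangentSpace (I n) x)
    (p : M × ℝ) (V : TangentSpace ((I n).prod 𝓘(ℝ, ℝ)) p) :
    TangentSpace ((I n).prod 𝓘(ℝ, ℝ)) p :=
  let Y : TangentSpace (I n) p.1 := V.1
  let a : ℝ := V.2
  (Φ p.1 Y + a • ξ p.1, -(η p.1 Y))

/-- The vector field `V` on the cone is smooth. -/
def SmoothConeField (V : Π p : M × ℝ, TangentSpace ((I n).prod 𝓘(ℝ, ℝ)) p) : Prop :=
  ContMDiff ((I n).prod 𝓘(ℝ, ℝ)) ((I n).prod 𝓘(ℝ, ℝ)).tangent ∞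
    (fun p => (⟨p, V p⟩ : TangentBundle ((I n).prod 𝓘(ℝ, ℝ)) (M × ℝ)))

/-- `(ξ, η, Φ)` is normal: the almost complex structure of the cone is integrable, that is,
its Nijenhuis tensor `[IV, IW] - I[IV, W] - I[V, IW] - [V, W]` vanishes. -/
def IsNormal (ξ : Π x : M, TangentSpace (I n) x) (η : Π x : M, TangentSpace (I n) x →L[ℝ] ℝ)
    (Φ : Π x : M, TangentSpace (I n) x →L[ℝ] TangentSpace (I n) x) : Prop :=
  ∀ V W : Π p : M × ℝ, TangentSpace ((I n).prod 𝓘(ℝ, ℝ)) p,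
    SmoothConeField V → SmoothConeField W → ∀ p : M × ℝ,
      VectorField.mlieBracket ((I n).prod 𝓘(ℝ, ℝ))
          (fun q => coneI ξ η Φ q (V q)) (fun q => coneI ξ η Φ q (W q)) p
        - coneI ξ η Φ p (VectorField.mlieBracket ((I n).prod 𝓘(ℝ, ℝ))
          (fun q => coneI ξ η Φ q (V q)) W p)
        - coneI ξ η Φ p (VectorField.mlieBracket ((I n).prod 𝓘(ℝ, ℝ))
          V (fun q => coneI ξ η Φ q (W q)) p)
        - VectorField.mlieBracket ((I n).prod 𝓘(ℝ, ℝ)) V W p = 0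

end Basics

/-- A Sasakian structure `(ξ, η, Φ, g)` on a manifold of dimension `2 * n + 1`: a contact metric
structure that is normal. -/
structure SasakianStructure (n : ℕ) (M : Type*) [TopologicalSpace M] [ChartedSpace (E n) M]
    [IsManifold (I n) ∞ M] where
  /-- the Reeb vector field -/
  ξ : Π x : M, TangentSpace (I n) x
  /-- the contact form -/
  η : Π x : M, TangentSpace (I n) x →L[ℝ] ℝ
  /-- the tensor of type (1,1) -/
  Φ : Π x : M, TangentSpace (I n) x →L[ℝ] TangentSpace (I n) x
  /-- the Riemannian metric -/
  g : Bundle.ContMDiffRiemannianMetric (I n) ∞ (E n) (fun x : M => TangentSpace (I n) x)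
  smooth_ξ : SmoothField ξ
  smooth_η : ContMDiff (I n) ((I n).prod 𝓘(ℝ, E n →L[ℝ] ℝ)) ∞
    (fun x => Bundle.TotalSpace.mk' (E n →L[ℝ] ℝ)
      (E := fun x : M => TangentSpace (I n) x →L[ℝ] (Bundle.Trivial M ℝ x)) x (η x))
  smooth_Φ : ContMDiff (I n) ((I n).prod 𝓘(ℝ, E n →L[ℝ] E n)) ∞
    (fun x => Bundle.TotalSpace.mk' (E n →L[ℝ] E n)
      (E := fun x : M => TangentSpace (I n) x →L[ℝ] TangentSpace (I n) x) x (Φ x))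
  η_ξ : ∀ x, η x (ξ x) = 1
  Φ_sq : ∀ x v, Φ x (Φ x v) = -v + η x v • ξ x
  g_compat : ∀ x v w, g.inner x (Φ x v) (Φ x w) = g.inner x v w - η x v * η x w
  contact : ∀ x v w, g.inner x (Φ x v) w = extDeriv₁ η x v w
  normal : IsNormal ξ η Φ

namespace SasakianStructure

variable {n : ℕ} {M : Type*} [TopologicalSpace M] [ChartedSpace (E n) M]
  [IsManifold (I n) ∞ M]

/-- The Riemannian measure `dμ_g` of the metric of a Sasakian structure. -/
def μ [MeasurableSpace M] (S : SasakianStructure n M) : Measure M :=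
  riemannianMeasure (fun x v w => S.g.inner x v w)

/-- The Lie algebra `𝔠𝔯(D, J)` of the underlying CR structure `D = ker η`, `J = Φ|_D`:
smooth vector fields `X` whose flow preserves `D` and `J`, that is, `[X, Y]` is a section
of `D` and `[X, J Y] = J [X, Y]` for every section `Y` of `D`. -/
def cr (S : SasakianStructure n M) : Set (Π x : M, TangentSpace (I n) x) :=
  {X | SmoothField X ∧
    ∀ Y : Π x : M, TangentSpace (I n) x, SmoothField Y → (∀ x, S.η x (Y x) = 0) → ∀ x,
      S.η x (VectorField.mlieBracket (I n) X Y x) = 0 ∧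
      VectorField.mlieBracket (I n) X (fun y => S.Φ y (Y y)) x =
        S.Φ x (VectorField.mlieBracket (I n) X Y x)}

/-- The cone `𝔠𝔯⁺(D, J)` of positive elements of `𝔠𝔯(D, J)`: the Reeb fields of the Sasakian
structures with underlying CR structure `(D, J)`. -/
def crPos (S : SasakianStructure n M) : Set (Π x : M, TangentSpace (I n) x) :=
  {X | X ∈ S.cr ∧ ∀ x, 0 < S.η x (X x)}

/-- The contact form `η / η(X)` with the same kernel `D` and Reeb field `X`. -/
def coneη (S : SasakianStructure n M) (X : Π x : M, TangentSpace (I n) x) (x : M) :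
    TangentSpace (I n) x →L[ℝ] ℝ :=
  (S.η x (X x))⁻¹ • S.η x

/-- The (1,1) tensor that vanishes on `X` and is `J` on `D`. It induces on `TM / ⟨X⟩ ≅ D` the
complex structure `J̄`. -/
def coneΦ (S : SasakianStructure n M) (X : Π x : M, TangentSpace (I n) x) (x : M)
    (v : TangentSpace (I n) x) : TangentSpace (I n) x :=
  S.Φ x (v - S.coneη X x v • X x)

/-- The metric `g' = dη' ∘ (1 ⊗ Φ') + η' ⊗ η'` of the Sasakian structure `(X, η', Φ', g')` with
Reeb field `X` and underlying CR structure `(D, J)`. -/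
def coneMetric (S : SasakianStructure n M) (X : Π x : M, TangentSpace (I n) x) (x : M)
    (v w : TangentSpace (I n) x) : ℝ :=
  extDeriv₁ (S.coneη X) x v (S.coneΦ X x w) + S.coneη X x v * S.coneη X x w

/-- The volume functional on the Sasaki cone of the CR structure of `S`: the volume of `M` in
the metric that belongs to the Reeb field `X` and the CR structure `(D, J)`. -/
def coneVolume [MeasurableSpace M] (S : SasakianStructure n M)
    (X : Π x : M, TangentSpace (I n) x) : ℝ :=
  (riemannianMeasure (S.coneMetric X)).real univ

/-- The smooth function `φ` is basic for the foliation of `X`. -/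
def IsBasic (X : Π x : M, TangentSpace (I n) x) (φ : M → ℝ) : Prop :=
  ContMDiff (I n) 𝓘(ℝ, ℝ) ∞ φ ∧ ∀ x, diff φ x (X x) = 0

/-- `dᶜ φ = -dφ ∘ J̄` (that is, `i (∂̄ - ∂) φ`) for an `X`-basic function `φ`, where `J̄` is
the transverse complex structure on `TM / ⟨X⟩ ≅ D`. -/
def dc (S : SasakianStructure n M) (X : Π x : M, TangentSpace (I n) x) (φ : M → ℝ) (x : M)
    (v : TangentSpace (I n) x) : ℝ :=
  -diff φ x (S.coneΦ X x v)

/-- The contact form of `S'` is `η / η(ξ') + (1/2) dᶜ φ` with `φ` a `ξ'`-basic function, where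
`η` is the contact form of `S` and `ξ'` is the Reeb field of `S'`, and `ξ'` lies in the Sasaki
cone of the CR structure of `S`. -/
def IsDeformation (S S' : SasakianStructure n M) (φ : M → ℝ) : Prop :=
  S'.ξ ∈ S.crPos ∧ IsBasic S'.ξ φ ∧
    ∀ x v, S'.η x v = S.η x v / S.η x (S'.ξ x) + (1 / 2) * S.dc S'.ξ φ x v

/-- `S'` induces on `TM / ⟨ξ'⟩ ≅ D` the complex structure `J̄` that comes from the CR structure
of `S`, where `ξ'` is the Reeb field of `S'`. -/
def SameTransverse (S S' : SasakianStructure n M) : Prop :=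
  ∀ x v, ∃ c : ℝ, S'.Φ x v = S.coneΦ S'.ξ x v + c • S'.ξ x

/-- `h` is the basic Laplacian `Δ_B f = d_B^* d_B f` of the basic function `f`: it is basic, and
its `L²` product with every basic function `u` is the `L²` product of `df` and `du`.
Here `⟨df, du⟩ = du (∇f)` with `∇f` the gradient of `f`. -/
def IsBasicLaplacian [MeasurableSpace M] (S : SasakianStructure n M) (f h : M → ℝ) : Prop :=
  IsBasic S.ξ h ∧
    ∃ G : Π x : M, TangentSpace (I n) x,
      (∀ x v, S.g.inner x (G x) v = diff f x v) ∧
      ∀ u : M → ℝ, IsBasic S.ξ u → ∫ x, h x * u x ∂S.μ = ∫ x, diff u x (G x) ∂S.μ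

/-- A smooth one-parameter family of vector fields, for `|t| < ε`. -/
def SmoothFamily (ε : ℝ) (ζ : ℝ → Π x : M, TangentSpace (I n) x) : Prop :=
  ContMDiffOn (𝓘(ℝ, ℝ).prod (I n)) (I n).tangent ∞
    (fun p : ℝ × M => (⟨p.2, ζ p.1 p.2⟩ : TangentBundle (I n) M)) (Ioo (-ε) ε ×ˢ univ)

/-- The field `ζ'` is the derivative at `t = 0` of the family `ζ` of vector fields. -/
def HasVelocity (ζ : ℝ → Π x : M, TangentSpace (I n) x)
    (ζ' : Π x : M, TangentSpace (I n) x) : Prop :=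
  ∀ x, HasDerivAt (fun t => ζ t x) (ζ' x) 0

end SasakianStructure

end Sasaki

end

noncomputable section

namespace Sasaki

/-! The volume element of a Sasakian metric depends on the contact form alone. Write B = dη + η ⊗ η
and L = Φ + η ⊗ ξ. The metric g = dη(·, Φ·) + η ⊗ η is B(·, L·), and L⁴ = 1, so det g = |det B|
(`abs_bdet_of_almost_contact`, `bdet_gB`). Thus √|det(dα + α ⊗ α)| plays the part of α ∧ (dα)ⁿ, and
only bilinear forms are needed.

First variation. If α moves with velocity γ, Jacobi's formula gives the density the logarithmic
derivative ½ tr(B⁻¹B') with B' = dγ + γ ⊗ α + α ⊗ γ. Along the given path γ = fη + ½ dᶜφ̇ with f =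
-η(ξ̇). The first term contributes (n+1)f (`trace_first_variation`). For the second the main tool is
a divergence principle: if ι_Z dα = γ and α(Z) is constant, then B' is the Lie derivative of B along
Z by Cartan's formula, so ½ tr(B⁻¹B') is the divergence of Z (`lie_formB`, `divE_density`) and
integrates to zero on a closed manifold (`integral_divergence`). For γ = dᶜφ̇ the field Z is the
gradient of φ̇ and the divergence is -Δ_B φ̇. That this function is basic is not automatic:
normality makes the Reeb field commute with Z, and two integrations by parts show that ξ(Δ_B φ̇) has
L² norm zero (`isBasic_basicLaplacian`).

Independence of the representative. The form η/η(X) and the contact form of another structure with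
the same Reeb field and transverse complex structure are joined by a segment of contact forms: the
differentials of both ends are positive on the transverse complex structure
(`bdet_contactB_segment_ne_zero`). The velocity β of the segment kills X, hence its dual field is
annihilated by each contact form of the segment, and the divergence principle makes the volume
constant (`volume_eq_of_segment`).

The functional on the cone. A determinant computation (`bdet_cone`) turns it into the integral of
η(X)^(-(n+1)) against the fixed measure of the base structure (`coneVolume_eq`). What remains
concerns this integral, whose integrand is a convex function of the positive quantity η(X), linear
in X. Convexity is pointwise, the Hessian comes from differentiating twice under the integral, and a
direction with η(X) of mean zero is realized by the path c(t)(ξ + tX), where c^(n+1) normalizes the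
volume and c'(0) = 0. -/

theorem one_add_one_le_infty : (1 : WithTop ℕ∞) + 1 ≤ ∞ := by
  rw [one_add_one_eq_two]; exact ENat.LEInfty.out

/-- Evaluation on a basis identifies `F →L[ℝ] G` with a finite power of `G`; this is where finite
dimension of `F` enters. -/
theorem contDiffAt_clm_apply_iff {D F G : Type*} [NormedAddCommGroup D] [NormedSpace ℝ D]
    [NormedAddCommGroup F] [NormedSpace ℝ F] [FiniteDimensional ℝ F]
    [NormedAddCommGroup G] [NormedSpace ℝ G] {k : WithTop ℕ∞} {f : D → F →L[ℝ] G} {x : D} :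
    ContDiffAt ℝ k f x ↔ ∀ y, ContDiffAt ℝ k (fun x => f x y) x := by
  refine ⟨fun h y => h.clm_apply contDiffAt_const, fun h => ?_⟩
  let d := Module.finrank ℝ F
  have hd : d = Module.finrank ℝ (Fin d → ℝ) := (Module.finrank_fin_fun ℝ).symm
  let e₁ := ContinuousLinearEquiv.ofFinrankEq hd
  let e₂ := (e₁.arrowCongr (1 : G ≃L[ℝ] G)).trans (ContinuousLinearEquiv.piRing (Fin d))
  rw [← Function.id_comp f, ← e₂.symm_comp_self, Function.comp_assoc]
  exact e₂.symm.contDiff.contDiffAt.comp x (contDiffAt_pi.mpr fun i => h _)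

/-! ### Vector fields, forms, brackets and exterior derivatives in the preferred charts. -/

section Charts

variable {n : ℕ} {M : Type*} [TopologicalSpace M] [ChartedSpace (E n) M]

/-- The coordinate frame of the preferred chart at `x₀`: the derivative of the inverse chart. -/
def frame (x₀ : M) (z : E n) : E n →L[ℝ] E n :=
  mfderiv 𝓘(ℝ, E n) (I n) (extChartAt (I n) x₀).symm z

/-- The derivative of the preferred chart at `x₀`. -/
def coframe (x₀ y : M) : E n →L[ℝ] E n :=
  mfderiv (I n) 𝓘(ℝ, E n) (extChartAt (I n) x₀) y

/-- The vector field `V`, read in the preferred chart at `x₀`. -/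
def fieldRep (x₀ : M) (V : M → E n) (z : E n) : E n :=
  coframe x₀ ((extChartAt (I n) x₀).symm z) (V ((extChartAt (I n) x₀).symm z))

/-- The 1-form `α`, read in the preferred chart at `x₀`. -/
def formRep (x₀ : M) (α : M → E n →L[ℝ] ℝ) (z : E n) : E n →L[ℝ] ℝ :=
  (α ((extChartAt (I n) x₀).symm z)).comp (frame x₀ z)

theorem isOpen_target (x₀ : M) : IsOpen (extChartAt (I n) x₀).target :=
  isOpen_extChartAt_target x₀

theorem target_mem_nhds {x₀ : M} {z : E n} (hz : z ∈ (extChartAt (I n) x₀).target) :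
    (extChartAt (I n) x₀).target ∈ 𝓝 z :=
  (isOpen_target x₀).mem_nhds hz

theorem ext_mem_target (x₀ : M) : extChartAt (I n) x₀ x₀ ∈ (extChartAt (I n) x₀).target :=
  mem_extChartAt_target x₀

theorem symm_ext (x₀ : M) : (extChartAt (I n) x₀).symm (extChartAt (I n) x₀ x₀) = x₀ :=
  extChartAt_to_inv x₀

theorem contMDiffAt_of_rep {G : Type*} [NormedAddCommGroup G] [NormedSpace ℝ G] {f : M → G} {x₀ : M}
    (h : ContDiffAt ℝ ∞ (fun z => f ((extChartAt (I n) x₀).symm z)) (extChartAt (I n) x₀ x₀)) :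
    ContMDiffAt (I n) 𝓘(ℝ, G) ∞ f x₀ := by
  have h1 : ContMDiffAt (I n) 𝓘(ℝ, G) ∞
      (fun y => f ((extChartAt (I n) x₀).symm (extChartAt (I n) x₀ y))) x₀ :=
    (contMDiffAt_iff_contDiffAt.2 h).comp x₀ (contMDiffAt_extChartAt)
  refine h1.congr_of_eventuallyEq ?_
  filter_upwards [extChartAt_source_mem_nhds (I := I n) x₀] with y hy
  rw [(extChartAt (I n) x₀).left_inv hy]

variable [IsManifold (I n) ∞ M]

theorem coframe_comp_frame {x₀ : M} {z : E n} (hz : z ∈ (extChartAt (I n) x₀).target) :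
    (coframe x₀ ((extChartAt (I n) x₀).symm z)).comp (frame x₀ z) = ContinuousLinearMap.id ℝ _ := by
  have := mfderiv_extChartAt_comp_mfderivWithin_extChartAt_symm (I := I n) hz
  simp only [modelWithCornersSelf_coe, range_id, mfderivWithin_univ] at this
  exact this

theorem frame_comp_coframe {x₀ : M} {z : E n} (hz : z ∈ (extChartAt (I n) x₀).target) :
    (frame x₀ z).comp (coframe x₀ ((extChartAt (I n) x₀).symm z)) = ContinuousLinearMap.id ℝ _ := by
  have := mfderivWithin_extChartAt_symm_comp_mfderiv_extChartAt (I := I n) hz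
  simp only [modelWithCornersSelf_coe, range_id, mfderivWithin_univ] at this
  exact this

theorem coframe_frame {x₀ : M} {z : E n} (hz : z ∈ (extChartAt (I n) x₀).target) (v : E n) :
    coframe x₀ ((extChartAt (I n) x₀).symm z) (frame x₀ z v) = v :=
  DFunLike.congr_fun (coframe_comp_frame hz) v

theorem frame_coframe {x₀ : M} {z : E n} (hz : z ∈ (extChartAt (I n) x₀).target) (v : E n) :
    frame x₀ z (coframe x₀ ((extChartAt (I n) x₀).symm z) v) = v :=
  DFunLike.congr_fun (frame_comp_coframe hz) v

theorem frame_fieldRep {x₀ : M} {z : E n} (hz : z ∈ (extChartAt (I n) x₀).target) (V : M → E n) :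
    frame x₀ z (fieldRep x₀ V z) = V ((extChartAt (I n) x₀).symm z) :=
  frame_coframe hz _

theorem formRep_fieldRep {x₀ : M} {z : E n} (hz : z ∈ (extChartAt (I n) x₀).target)
    (α : M → E n →L[ℝ] ℝ) (V : M → E n) :
    formRep x₀ α z (fieldRep x₀ V z) =
      α ((extChartAt (I n) x₀).symm z) (V ((extChartAt (I n) x₀).symm z)) := by
  simp [formRep, frame_fieldRep hz]

/-- The tangent space at `x₀` is by construction the model space seen through the preferred chart at
`x₀`. Pointwise identities can therefore be checked at the centre of that chart without any change
of frame. -/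
theorem coframe_self (x₀ : M) : coframe (n := n) x₀ x₀ = ContinuousLinearMap.id ℝ _ :=
  mfderiv_extChartAt_self

theorem frame_self (x₀ : M) :
    frame (n := n) x₀ (extChartAt (I n) x₀ x₀) = ContinuousLinearMap.id ℝ _ := by
  have := frame_comp_coframe (ext_mem_target (n := n) x₀)
  rw [symm_ext, coframe_self] at this
  exact this

theorem fieldRep_self (x₀ : M) (V : M → E n) :
    fieldRep x₀ V (extChartAt (I n) x₀ x₀) = V x₀ := by
  rw [fieldRep, symm_ext, coframe_self]; rfl

theorem formRep_self (x₀ : M) (α : M → E n →L[ℝ] ℝ) :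
    formRep x₀ α (extChartAt (I n) x₀ x₀) = α x₀ := by
  rw [formRep, symm_ext, frame_self]; rfl

theorem contMDiffAt_symm {x₀ : M} {z : E n} (hz : z ∈ (extChartAt (I n) x₀).target) :
    ContMDiffAt 𝓘(ℝ, E n) (I n) ∞ (extChartAt (I n) x₀).symm z :=
  (contMDiffOn_extChartAt_symm x₀).contMDiffAt (target_mem_nhds hz)

theorem mdifferentiableAt_symm {x₀ : M} {z : E n} (hz : z ∈ (extChartAt (I n) x₀).target) :
    MDifferentiableAt 𝓘(ℝ, E n) (I n) (extChartAt (I n) x₀).symm z :=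
  (contMDiffAt_symm hz).mdifferentiableAt (by simp)

/-- Smoothness of a family of tangent vectors, read in a chart. -/
theorem contMDiffWithinAt_vector_iff {F H' N : Type*} [NormedAddCommGroup F] [NormedSpace ℝ F]
    [TopologicalSpace H'] {J : ModelWithCorners ℝ F H'} [TopologicalSpace N] [ChartedSpace H' N]
    {b : N → M} {v : N → E n} {s : Set N} {p : N} (x₀ : M)
    (hb : ContMDiffWithinAt J (I n) ∞ b s p) (hp : b p ∈ (extChartAt (I n) x₀).source) :
    ContMDiffWithinAt J (I n).tangent ∞ (fun q => (⟨b q, v q⟩ : TangentBundle (I n) M)) s p ↔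
      ContMDiffWithinAt J 𝓘(ℝ, E n) ∞ (fun q => coframe x₀ (b q) (v q)) s p := by
  rw [Bundle.contMDiffWithinAt_totalSpace]
  have h0 : b p ∈ (chartAt (E n) x₀).source := by simpa using hp
  rw [and_iff_right (by exact hb)]
  rw [Bundle.Trivialization.contMDiffWithinAt_snd_comp_iff₂ (IB := I n)
    (e' := trivializationAt (E n) (TangentSpace (I n)) x₀) hb
    (by simp) (by simpa using h0)]
  have key : ∀ q, b q ∈ (chartAt (E n) x₀).source →
      (trivializationAt (E n) (TangentSpace (I n)) x₀ (⟨b q, v q⟩ : TangentBundle (I n) M)).2 =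
        coframe x₀ (b q) (v q) := by
    intro q hq
    have := TangentBundle.continuousLinearMapAt_trivializationAt (I := I n) hq
    have h2 := Bundle.Trivialization.continuousLinearMapAt_apply_of_mem (R := ℝ) 
      (e := trivializationAt (E n) (TangentSpace (I n)) x₀) hq (v q)
    rw [← h2, this]; rfl
  have hev : ∀ᶠ q in 𝓝[s] p, b q ∈ (chartAt (E n) x₀).source :=
    hb.continuousWithinAt ((chartAt (E n) x₀).open_source.mem_nhds h0)
  constructor
  · intro h
    exact h.congr_of_eventuallyEq (hev.mono fun q hq => (key q hq).symm) (key p h0).symm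
  · intro h
    exact h.congr_of_eventuallyEq (hev.mono fun q hq => key q hq) (key p h0)

theorem contMDiffAt_frame {x₀ : M} {z : E n} (hz : z ∈ (extChartAt (I n) x₀).target) (w : E n) :
    ContMDiffAt 𝓘(ℝ, E n) (I n).tangent ∞
      (fun q => (⟨(extChartAt (I n) x₀).symm q, frame x₀ q w⟩ : TangentBundle (I n) M)) z := by
  rw [← contMDiffWithinAt_univ,
    contMDiffWithinAt_vector_iff x₀ (contMDiffAt_symm hz).contMDiffWithinAt
      ((extChartAt (I n) x₀).map_target hz), contMDiffWithinAt_univ]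
  refine (contMDiffAt_const (c := w)).congr_of_eventuallyEq ?_
  filter_upwards [target_mem_nhds hz] with q hq
  exact coframe_frame hq w

theorem contDiffAt_fieldRep {V : Π x : M, TangentSpace (I n) x} (hV : SmoothField V) {x₀ : M}
    {z : E n} (hz : z ∈ (extChartAt (I n) x₀).target) : ContDiffAt ℝ ∞ (fieldRep x₀ V) z := by
  rw [← contMDiffAt_iff_contDiffAt, ← contMDiffWithinAt_univ]
  refine (contMDiffWithinAt_vector_iff x₀ (contMDiffAt_symm hz).contMDiffWithinAt
      ((extChartAt (I n) x₀).map_target hz)).1 ?_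
  rw [contMDiffWithinAt_univ]
  exact (hV _).comp z (contMDiffAt_symm hz)

theorem smoothField_of_rep {V : Π x : M, TangentSpace (I n) x}
    (h : ∀ x₀ : M, ContDiffAt ℝ ∞ (fieldRep x₀ V) (extChartAt (I n) x₀ x₀)) : SmoothField V := by
  intro x₀
  rw [← contMDiffWithinAt_univ]
  refine (contMDiffWithinAt_vector_iff x₀ contMDiffWithinAt_id
    (mem_extChartAt_source (I := I n) x₀)).2 ?_
  rw [contMDiffWithinAt_univ]
  exact contMDiffAt_of_rep (h x₀)

theorem contDiffAt_rep {G : Type*} [NormedAddCommGroup G] [NormedSpace ℝ G] {f : M → G}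
    (hf : ContMDiff (I n) 𝓘(ℝ, G) ∞ f) {x₀ : M} {z : E n}
    (hz : z ∈ (extChartAt (I n) x₀).target) :
    ContDiffAt ℝ ∞ (fun q => f ((extChartAt (I n) x₀).symm q)) z := by
  rw [← contMDiffAt_iff_contDiffAt]
  exact (hf _).comp z (contMDiffAt_symm hz)

theorem contDiffAt_formRep {α : Π x : M, TangentSpace (I n) x →L[ℝ] ℝ}
    (hα : ContMDiff (I n) ((I n).prod 𝓘(ℝ, E n →L[ℝ] ℝ)) ∞
      (fun x => Bundle.TotalSpace.mk' (E n →L[ℝ] ℝ)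
        (E := fun x : M => TangentSpace (I n) x →L[ℝ] (Bundle.Trivial M ℝ x)) x (α x)))
    {x₀ : M} {z : E n} (hz : z ∈ (extChartAt (I n) x₀).target) :
    ContDiffAt ℝ ∞ (formRep x₀ α) z := by
  rw [contDiffAt_clm_apply_iff]
  intro w
  have h1 := ((hα _).comp z (contMDiffAt_symm hz)).clm_bundle_apply (E₁ := TangentSpace (I n))
    (E₂ := Bundle.Trivial M ℝ)
    (b := (extChartAt (I n) x₀).symm) (contMDiffAt_frame hz w)
  rw [Bundle.contMDiffAt_totalSpace] at h1
  exact contMDiffAt_iff_contDiffAt.1 h1.2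

/-- The endomorphism field `Φ`, read in the preferred chart at `x₀`. -/
def endoRep (x₀ : M) (Φ : M → E n →L[ℝ] E n) (z : E n) : E n →L[ℝ] E n :=
  (coframe x₀ ((extChartAt (I n) x₀).symm z)).comp
    ((Φ ((extChartAt (I n) x₀).symm z)).comp (frame x₀ z))

theorem contDiffAt_endoRep {Φ : Π x : M, TangentSpace (I n) x →L[ℝ] TangentSpace (I n) x}
    (hΦ : ContMDiff (I n) ((I n).prod 𝓘(ℝ, E n →L[ℝ] E n)) ∞
      (fun x => Bundle.TotalSpace.mk' (E n →L[ℝ] E n)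
        (E := fun x : M => TangentSpace (I n) x →L[ℝ] TangentSpace (I n) x) x (Φ x)))
    {x₀ : M} {z : E n} (hz : z ∈ (extChartAt (I n) x₀).target) :
    ContDiffAt ℝ ∞ (endoRep x₀ Φ) z := by
  rw [contDiffAt_clm_apply_iff]
  intro w
  have h1 := ((hΦ _).comp z (contMDiffAt_symm hz)).clm_bundle_apply (E₁ := TangentSpace (I n))
    (E₂ := TangentSpace (I n))
    (b := (extChartAt (I n) x₀).symm) (contMDiffAt_frame hz w)
  rw [← contMDiffAt_iff_contDiffAt, ← contMDiffWithinAt_univ]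
  refine (contMDiffWithinAt_vector_iff x₀ (contMDiffAt_symm hz).contMDiffWithinAt
      ((extChartAt (I n) x₀).map_target hz)).1 ?_
  rw [contMDiffWithinAt_univ]
  exact h1

theorem contDiffAt_fieldRep_family {ε : ℝ} {ζ : ℝ → Π x : M, TangentSpace (I n) x}
    (hζ : SasakianStructure.SmoothFamily ε ζ) {t : ℝ} (ht : t ∈ Ioo (-ε) ε) {x₀ : M}
    {z : E n} (hz : z ∈ (extChartAt (I n) x₀).target) :
    ContDiffAt ℝ ∞ (fun p : ℝ × E n => fieldRep x₀ (ζ p.1) p.2) (t, z) := by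
  have hm : ContMDiffAt (𝓘(ℝ, ℝ).prod 𝓘(ℝ, E n)) (𝓘(ℝ, ℝ).prod (I n)) ∞
      (fun p : ℝ × E n => (p.1, (extChartAt (I n) x₀).symm p.2)) (t, z) :=
    contMDiffAt_fst.prodMk ((contMDiffAt_symm hz).comp (t, z) contMDiffAt_snd)
  have h1 := (hζ.contMDiffAt (x := (t, (extChartAt (I n) x₀).symm z))
    ((isOpen_Ioo.prod isOpen_univ).mem_nhds ⟨ht, mem_univ _⟩)).comp (t, z) hm
  rw [← contMDiffAt_iff_contDiffAt, ← contMDiffWithinAt_univ]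
  rw [modelWithCornersSelf_prod, ← chartedSpaceSelf_prod]
  refine (contMDiffWithinAt_vector_iff x₀
    ((contMDiffAt_symm hz).comp (t, z) contMDiffAt_snd).contMDiffWithinAt
      ((extChartAt (I n) x₀).map_target hz)).1 ?_
  rw [contMDiffWithinAt_univ]
  exact h1

theorem contDiffAt_rep_family {ε : ℝ} {φ : ℝ → M → ℝ}
    (hφ : ContMDiffOn (𝓘(ℝ, ℝ).prod (I n)) 𝓘(ℝ, ℝ) ∞
        (fun p : ℝ × M => φ p.1 p.2) (Ioo (-ε) ε ×ˢ univ)) {t : ℝ} (ht : t ∈ Ioo (-ε) ε) {x₀ : M}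
    {z : E n} (hz : z ∈ (extChartAt (I n) x₀).target) :
    ContDiffAt ℝ ∞ (fun p : ℝ × E n => φ p.1 ((extChartAt (I n) x₀).symm p.2)) (t, z) := by
  have hm : ContMDiffAt (𝓘(ℝ, ℝ).prod 𝓘(ℝ, E n)) (𝓘(ℝ, ℝ).prod (I n)) ∞
      (fun p : ℝ × E n => (p.1, (extChartAt (I n) x₀).symm p.2)) (t, z) :=
    contMDiffAt_fst.prodMk ((contMDiffAt_symm hz).comp (t, z) contMDiffAt_snd)
  have h1 := (hφ.contMDiffAt (x := (t, (extChartAt (I n) x₀).symm z))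
    ((isOpen_Ioo.prod isOpen_univ).mem_nhds ⟨ht, mem_univ _⟩)).comp (t, z) hm
  rw [← contMDiffAt_iff_contDiffAt]
  rw [modelWithCornersSelf_prod, ← chartedSpaceSelf_prod]
  exact h1

theorem diff_frame {f : M → ℝ} {x₀ : M} {z : E n} (hz : z ∈ (extChartAt (I n) x₀).target)
    (hf : MDifferentiableAt (I n) 𝓘(ℝ, ℝ) f ((extChartAt (I n) x₀).symm z)) (v : E n) :
    diff (n := n) f ((extChartAt (I n) x₀).symm z) (frame x₀ z v) =
      fderiv ℝ (fun q => f ((extChartAt (I n) x₀).symm q)) z v := by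
  have h := mfderiv_comp (I := 𝓘(ℝ, E n)) (I' := I n) (I'' := 𝓘(ℝ, ℝ)) z hf (mdifferentiableAt_symm hz)
  rw [← mfderiv_eq_fderiv]
  have h2 := DFunLike.congr_fun h v
  exact h2.symm

theorem diff_eq_fderiv {f : M → ℝ} {x₀ : M} 
    (hf : MDifferentiableAt (I n) 𝓘(ℝ, ℝ) f x₀) (v : E n) :
    diff (n := n) f x₀ v =
      fderiv ℝ (fun q => f ((extChartAt (I n) x₀).symm q)) (extChartAt (I n) x₀ x₀) v := by
  have := diff_frame (ext_mem_target (n := n) x₀) (f := f) (by rwa [symm_ext]) v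
  rw [frame_self, symm_ext] at this
  exact this

/-- The bracket is defined by pulling fields back to the chart, where the inverse of `frame` is
`coframe`, and pushing the Euclidean bracket forward by the chart derivative at the centre, which is
the identity. -/
theorem mlieBracket_eq (V W : M → E n) (x₀ : M) :
    VectorField.mlieBracket (I n) V W x₀ =
      (fderiv ℝ (fieldRep x₀ W) (extChartAt (I n) x₀ x₀) (V x₀) -
        fderiv ℝ (fieldRep x₀ V) (extChartAt (I n) x₀ x₀) (W x₀) : E n) := by
  have key : ∀ V : Π x : M, TangentSpace (I n) x,
      VectorField.mpullbackWithin 𝓘(ℝ, E n) (I n) (extChartAt (I n) x₀).symm V (range (I n))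
        =ᶠ[𝓝 (extChartAt (I n) x₀ x₀)] fieldRep x₀ V := by
    intro V
    filter_upwards [target_mem_nhds (ext_mem_target (n := n) x₀)] with z hz
    rw [VectorField.mpullbackWithin_apply]
    simp only [modelWithCornersSelf_coe, range_id, mfderivWithin_univ]
    have : (mfderiv 𝓘(ℝ, E n) (I n) (extChartAt (I n) x₀).symm z).inverse =
      coframe x₀ ((extChartAt (I n) x₀).symm z) :=
      ContinuousLinearMap.inverse_eq (frame_comp_coframe hz) (coframe_comp_frame hz)
    rw [this]; rfl
  have hr : range (I n) = univ := by simp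
  have e1 : ∀ V' W' : E n → E n, V' =ᶠ[𝓝 (extChartAt (I n) x₀ x₀)] fieldRep x₀ V →
      W' =ᶠ[𝓝 (extChartAt (I n) x₀ x₀)] fieldRep x₀ W →
      VectorField.lieBracketWithin ℝ V' W'
        ((extChartAt (I n) x₀).symm ⁻¹' univ ∩ range (I n)) (extChartAt (I n) x₀ x₀) =
      fderiv ℝ (fieldRep x₀ W) (extChartAt (I n) x₀ x₀) (V x₀) -
        fderiv ℝ (fieldRep x₀ V) (extChartAt (I n) x₀ x₀) (W x₀) := by
    intro V' W' hV hW
    have hu : (extChartAt (I n) x₀).symm ⁻¹' univ ∩ range (I n) = univ := by rw [hr]; simp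
    rw [hu, VectorField.lieBracketWithin_univ,
      Filter.EventuallyEq.lieBracket_vectorField_eq hV hW, VectorField.lieBracket,
      fieldRep_self, fieldRep_self]
  have e2 : (coframe x₀ x₀).inverse = ContinuousLinearMap.id ℝ (E n) := by
    rw [coframe_self, ContinuousLinearMap.inverse_id]
  exact (congrArg (coframe x₀ x₀).inverse (e1 _ _ (key (fun x => V x)) (key (fun x => W x)))).trans (by rw [e2]; rfl)

/-- The exterior derivative of a 1-form on the model space. -/
def extD (a : E n → E n →L[ℝ] ℝ) (z v w : E n) : ℝ :=
  fderiv ℝ a z v w - fderiv ℝ a z w v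

omit [IsManifold (I n) ∞ M] in
theorem fderiv_coordForm {α : M → E n →L[ℝ] ℝ} {x₀ : M} {z : E n}
    (h : DifferentiableAt ℝ (formRep x₀ α) z) (v w : E n) :
    fderiv ℝ (coordForm α x₀ w) z v = fderiv ℝ (formRep x₀ α) z v w := by
  have h2 : coordForm α x₀ w = fun y => formRep x₀ α y w := rfl
  rw [h2, fderiv_clm_apply h (differentiableAt_const w)]
  simp

theorem extDeriv₁_eq {α : M → E n →L[ℝ] ℝ} {x₀ : M}
    (h : DifferentiableAt ℝ (formRep x₀ α) (extChartAt (I n) x₀ x₀)) (v w : E n) :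
    extDeriv₁ α x₀ v w = extD (formRep x₀ α) (extChartAt (I n) x₀ x₀) v w := by
  have e : ∀ v : E n, (mfderiv (I n) 𝓘(ℝ, E n) (extChartAt (I n) x₀) x₀ v : E n) = v := by
    intro v
    exact DFunLike.congr_fun (coframe_self (n := n) x₀) v
  simp only [extDeriv₁]
  rw [extD, ← fderiv_coordForm h, ← fderiv_coordForm h]
  exact congrArg₂ (fun v' w' : E n =>
    fderiv ℝ (coordForm α x₀ w') (extChartAt (I n) x₀ x₀) v' -
      fderiv ℝ (coordForm α x₀ v') (extChartAt (I n) x₀ x₀) w') (e v) (e w)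

/-- Chain rule for the inverse chart at `p` written as the inverse chart at `x₀` after the
transition map. Both the invariance of the exterior derivative and that of the chart measures rest
on it. -/
theorem frame_transition {x₀ p : M} {z : E n} (hz : z ∈ (extChartAt (I n) p).target)
    (hp : (extChartAt (I n) p).symm z ∈ (extChartAt (I n) x₀).source) :
    ContDiffAt ℝ ∞ (fun q => extChartAt (I n) x₀ ((extChartAt (I n) p).symm q)) z ∧
    frame p z = (frame x₀ (extChartAt (I n) x₀ ((extChartAt (I n) p).symm z))).comp
      (fderiv ℝ (fun q => extChartAt (I n) x₀ ((extChartAt (I n) p).symm q)) z) := by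
  have hc : (extChartAt (I n) p).symm z ∈ (chartAt (E n) x₀).source := by simpa using hp
  have h1 : ContDiffAt ℝ ∞ (fun q => extChartAt (I n) x₀ ((extChartAt (I n) p).symm q)) z := by
    rw [← contMDiffAt_iff_contDiffAt]
    exact (contMDiffAt_extChartAt' hc).comp z (contMDiffAt_symm hz)
  refine ⟨h1, ?_⟩
  have h2 : fderiv ℝ (fun q => extChartAt (I n) x₀ ((extChartAt (I n) p).symm q)) z =
      (coframe x₀ ((extChartAt (I n) p).symm z)).comp (frame p z) := by
    rw [← mfderiv_eq_fderiv]
    exact mfderiv_comp (I := 𝓘(ℝ, E n)) (I' := I n) (I'' := 𝓘(ℝ, E n)) z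
      (mdifferentiableAt_extChartAt hc) (mdifferentiableAt_symm hz)
  rw [h2]
  ext1 v
  have h3 := frame_coframe ((extChartAt (I n) x₀).map_source hp) (frame p z v)
  rw [(extChartAt (I n) x₀).left_inv hp] at h3
  exact h3.symm

/-- The exterior derivative may be computed in any chart. -/
theorem extDeriv₁_frame {α : M → E n →L[ℝ] ℝ} {x₀ : M} {z : E n}
    (hz : z ∈ (extChartAt (I n) x₀).target)
    (h : DifferentiableAt ℝ (formRep x₀ α) z) (v w : E n) :
    extDeriv₁ α ((extChartAt (I n) x₀).symm z) (frame x₀ z v) (frame x₀ z w) =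
      extD (formRep x₀ α) z v w := by
  set p : M := (extChartAt (I n) x₀).symm z with hp
  set τ : E n → E n := fun q => extChartAt (I n) x₀ ((extChartAt (I n) p).symm q) with hτ
  set y : E n := extChartAt (I n) p p with hy
  have hpx : p ∈ (extChartAt (I n) x₀).source := (extChartAt (I n) x₀).map_target hz
  have hyp : (extChartAt (I n) p).symm y = p := symm_ext p
  have hτy : τ y = z := by
    simp only [hτ, hyp]
    exact (extChartAt (I n) x₀).right_inv hz
  obtain ⟨hs, hf⟩ := frame_transition (ext_mem_target (n := n) p) (x₀ := x₀)
    (by rw [hyp]; exact hpx)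
  change ContDiffAt ℝ ∞ τ y at hs
  change frame p y = (frame x₀ (τ y)).comp (fderiv ℝ τ y) at hf
  -- On the overlap the two coordinate expressions of the form are related by pullback along the
  -- transition map.
  have hev : formRep p α =ᶠ[𝓝 y] fun q => (formRep x₀ α (τ q)).comp (fderiv ℝ τ q) := by
    have hcont : ContinuousAt (extChartAt (I n) p).symm y :=
      (contMDiffAt_symm (ext_mem_target (n := n) p)).continuousAt
    have h3 : ∀ᶠ q in 𝓝 y, (extChartAt (I n) p).symm q ∈ (extChartAt (I n) x₀).source := by
      refine hcont.eventually_mem ((isOpen_extChartAt_source x₀).mem_nhds ?_)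
      rw [hyp]; exact hpx
    filter_upwards [h3, target_mem_nhds (ext_mem_target (n := n) p)] with q hq hq2
    have := (frame_transition hq2 hq).2
    ext1 u
    simp only [formRep, this, ContinuousLinearMap.comp_apply, hτ,
      (extChartAt (I n) x₀).left_inv hq]
  have hdτ : DifferentiableAt ℝ τ y := hs.differentiableAt (by simp)
  have hd2 : DifferentiableAt ℝ (fderiv ℝ τ) y :=
    (hs.fderiv_right (m := 1) one_add_one_le_infty).differentiableAt (by simp)
  have hD : DifferentiableAt ℝ (fun q => (formRep x₀ α (τ q)).comp (fderiv ℝ τ q)) y :=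
    ((hτy ▸ h : DifferentiableAt ℝ (formRep x₀ α) (τ y)).comp y hdτ).clm_comp hd2
  have hdb : DifferentiableAt ℝ (formRep p α) y := hD.congr_of_eventuallyEq hev
  have hv : ∀ v : E n, fderiv ℝ τ y (frame x₀ z v) = v := by
    intro v
    have h4 := DFunLike.congr_fun hf (frame x₀ z v)
    rw [frame_self, hτy] at h4
    have h5 := congrArg (coframe x₀ p) h4
    simp only [ContinuousLinearMap.comp_apply, ContinuousLinearMap.id_apply] at h5
    rw [hp, coframe_frame hz, coframe_frame hz] at h5
    exact h5.symm
  -- The product rule produces a term with the second derivative of the transition map. It is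
  -- symmetric, so it cancels on antisymmetrization; this is why d does not depend on the chart.
  have hcomp : ∀ v w : E n, fderiv ℝ (formRep p α) y v w =
      fderiv ℝ (formRep x₀ α) z (fderiv ℝ τ y v) (fderiv ℝ τ y w) +
        formRep x₀ α z (fderiv ℝ (fderiv ℝ τ) y v w) := by
    intro v w
    rw [hev.fderiv_eq]
    have hg : DifferentiableAt ℝ (formRep x₀ α) (τ y) := hτy ▸ h
    have := fderiv_clm_comp (hg.comp y hdτ) hd2
    simp only [Function.comp_def] at this
    rw [this]
    have hc2 := fderiv_comp y hg hdτ
    simp only [Function.comp_def] at hc2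
    rw [hc2]
    simp only [_root_.add_apply, ContinuousLinearMap.comp_apply,
      ContinuousLinearMap.compL_apply, ContinuousLinearMap.flip_apply, hτy]
    exact add_comm _ _
  have hsymm := (hs.isSymmSndFDerivAt (by rw [minSmoothness_of_isRCLikeNormedField]; exact ENat.LEInfty.out)).eq
  rw [extDeriv₁_eq hdb, extD, hcomp, hcomp, hv, hv, hsymm (frame x₀ z v), extD]
  ring

end Charts

/-! ### Determinants of bilinear forms on the model space. -/

section LinearAlgebra

variable {n : ℕ}

/-- The standard basis of the model space. -/
abbrev stdBasis (n : ℕ) : Module.Basis (Fin (2 * n + 1)) ℝ (E n) :=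
  (EuclideanSpace.basisFun (Fin (2 * n + 1)) ℝ).toBasis

/-- The matrix of a bilinear form in the standard basis. -/
def bmat (B : LinearMap.BilinForm ℝ (E n)) : Matrix (Fin (2 * n + 1)) (Fin (2 * n + 1)) ℝ :=
  LinearMap.BilinForm.toMatrix (stdBasis n) B

/-- The determinant of a bilinear form in the standard basis. -/
def bdet (B : LinearMap.BilinForm ℝ (E n)) : ℝ := (bmat B).det

theorem bmat_apply (B : LinearMap.BilinForm ℝ (E n)) (i j) :
    bmat B i j = B (stdBasis n i) (stdBasis n j) :=
  LinearMap.BilinForm.toMatrix_apply _ _ _ _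

theorem bdet_comp (B : LinearMap.BilinForm ℝ (E n)) (L : E n →ₗ[ℝ] E n) :
    bdet (B.comp L L) = LinearMap.det L ^ 2 * bdet B := by
  rw [bdet, bmat, LinearMap.BilinForm.toMatrix_comp (stdBasis n) (stdBasis n), Matrix.det_mul,
    Matrix.det_mul, Matrix.det_transpose, LinearMap.det_toMatrix, bdet, bmat]
  ring

theorem bdet_compRight (B : LinearMap.BilinForm ℝ (E n)) (L : E n →ₗ[ℝ] E n) :
    bdet (B.compRight L) = bdet B * LinearMap.det L := by
  rw [bdet, bmat, LinearMap.BilinForm.toMatrix_compRight, Matrix.det_mul, LinearMap.det_toMatrix]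
  rfl

theorem bdet_smul (c : ℝ) (B : LinearMap.BilinForm ℝ (E n)) :
    bdet (c • B) = c ^ (2 * n + 1) * bdet B := by
  rw [bdet, bmat, map_smul, Matrix.det_smul, Fintype.card_fin]
  rfl

theorem bdet_ne_zero {B : LinearMap.BilinForm ℝ (E n)} (h : ∀ v, (∀ w, B v w = 0) → v = 0) :
    bdet B ≠ 0 := by
  intro h0
  obtain ⟨v, hv, h1⟩ := Matrix.exists_vecMul_eq_zero_iff.2 h0
  apply hv
  have h2 : WithLp.toLp 2 v = (0 : E n) := by
    apply h
    intro w
    have hw := LinearMap.BilinForm.dotProduct_toMatrix_mulVec (stdBasis n) B v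
      ((stdBasis n).equivFun w)
    rw [Matrix.dotProduct_mulVec] at hw
    rw [bmat] at h1
    rw [h1, zero_dotProduct, LinearEquiv.symm_apply_apply] at hw
    rw [hw]
    congr 1
  simpa using h2

theorem bdet_pos {B : LinearMap.BilinForm ℝ (E n)} (hs : ∀ v w, B v w = B w v)
    (h : ∀ v, v ≠ 0 → 0 < B v v) : 0 < bdet B := by
  refine Matrix.PosDef.det_pos (Matrix.posDef_iff_dotProduct_mulVec.2 ⟨?_, ?_⟩)
  · ext i j
    simpa [bmat_apply] using hs _ _
  · intro v hv
    have hw := LinearMap.BilinForm.dotProduct_toMatrix_mulVec (stdBasis n) B v v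
    rw [star_trivial, bmat, hw]
    apply h
    simpa using hv

/-- The determinant is a real number with fourth power one. -/
theorem abs_det_eq_one {L : E n →ₗ[ℝ] E n} (h : ∀ v, L (L (L (L v))) = v) :
    |LinearMap.det L| = 1 := by
  have h1 : L * L * (L * L) = 1 := by ext1 v; exact h v
  have h2 := congrArg LinearMap.det h1
  simp only [map_mul, map_one] at h2
  have h3 : (|LinearMap.det L| ^ 2) ^ 2 = 1 := by rw [sq_abs]; linarith [sq (LinearMap.det L)]
  have h4 : |LinearMap.det L| ^ 2 = 1 := by
    nlinarith [sq_nonneg (|LinearMap.det L|), h3]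
  nlinarith [abs_nonneg (LinearMap.det L)]

/-- A bilinear form `ω (·, P ·) + η ⊗ η` with `P² = -1 + ξ ⊗ η` has the determinant of
`ω + η ⊗ η` up to sign. -/
theorem abs_bdet_of_almost_contact {g B : LinearMap.BilinForm ℝ (E n)} {P : E n →ₗ[ℝ] E n}
    {η : E n →ₗ[ℝ] ℝ} {ξ : E n} (hη : η ξ = 1) (hP : ∀ v, P (P v) = -v + η v • ξ)
    (hηP : ∀ v, η (P v) = 0) (hB : ∀ v, B v ξ = η v) (hg : ∀ v w, g v w = B v (P w) + η v * η w) :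
    |bdet g| = |bdet B| := by
  set L : E n →ₗ[ℝ] E n := P + η.smulRight ξ with hL
  have hLv : ∀ v, L v = P v + η v • ξ := fun v => rfl
  have hPξ : P ξ = 0 := by
    have h1 : P (P ξ) = 0 := by rw [hP, hη]; simp
    have h2 := hP (P ξ)
    rw [h1, hηP] at h2
    simpa using h2.symm
  have h1 : g = B.compRight L := by
    ext v w
    simp only [LinearMap.BilinForm.compRight_apply, hLv, map_add, map_smul, hB, hg, smul_eq_mul]
    ring
  rw [h1, bdet_compRight, abs_mul, abs_det_eq_one, mul_one]
  intro v
  simp only [hLv, map_add, map_smul, hP, hηP, hPξ, hη, map_neg]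
  simp

/-- The metric `f g + ...` with transverse part scaled by `f` and Reeb field `X` has determinant
`f ^ (2 * n + 2) * det g`. -/
theorem bdet_cone {g g' : LinearMap.BilinForm ℝ (E n)} {η : E n →ₗ[ℝ] ℝ} {ξ X : E n} {f : ℝ}
    (hη : η ξ = 1) (hX : f * η X = 1) (hgξ : ∀ v, g v ξ = η v) (hsymm : ∀ v w, g v w = g w v)
    (hg' : ∀ v w, g' v w = f * (g (v - (f * η v) • X) (w - (f * η w) • X)
      - η (v - (f * η v) • X) * η (w - (f * η w) • X)) + (f * η v) * (f * η w)) :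
    bdet g' = f ^ (2 * n + 2) * bdet g := by
  have hf : f ≠ 0 := by rintro rfl; simp at hX
  -- `L` fixes the kernel of `η` and sends `ξ` to `f • X`, with determinant 1 because `f * η X = 1`;
  -- `R` stretches `ξ` by `f`. Pulled back by `L`, the new metric is `f` times the old one with `R`
  -- in one slot, so the exponent is 2n+1 from the factor `f` plus 1 from `R`.
  set L : E n →ₗ[ℝ] E n := LinearMap.transvection η (f • X - ξ) with hL
  set R : E n →ₗ[ℝ] E n := LinearMap.transvection η ((f - 1) • ξ) with hR
  have hLv : ∀ v, L v = v + η v • (f • X - ξ) := fun v => rfl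
  have hRv : ∀ v, R v = v + η v • ((f - 1) • ξ) := fun v => rfl
  have dL : LinearMap.det L = 1 := by
    rw [hL, LinearMap.transvection.det]; simp [hη, hX]
  have dR : LinearMap.det R = f := by
    rw [hR, LinearMap.transvection.det]; simp [hη]
  have key : g'.comp L L = f • (g.compRight R) := by
    ext v w
    have hηL : ∀ v, η (L v) = η v := by
      intro v
      simp only [hLv, map_add, map_smul, map_sub, smul_eq_mul, hη, hX]; ring
    have hD : ∀ v, L v - (f * η v) • X = v - η v • ξ := by
      intro v
      simp only [hLv, smul_sub, smul_smul, mul_comm f]; abel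
    have hξg : ∀ v, g ξ v = η v := fun v => by rw [hsymm, hgξ]
    simp only [LinearMap.BilinForm.comp_apply, hg', hηL, hD, LinearMap.smul_apply,
      LinearMap.BilinForm.compRight_apply, hRv, map_add, map_sub, map_smul, LinearMap.sub_apply,
      smul_eq_mul, hgξ, hξg, hη]
    ring
  have h1 := bdet_comp g' L
  rw [key, bdet_smul, bdet_compRight, dL, dR] at h1
  have : f ^ (2 * n + 2) = f ^ (2 * n + 1) * f := pow_succ _ _
  rw [this]
  linarith

end LinearAlgebra

/-! ### Smoothness and logarithmic derivatives of determinants. -/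

section DetDerivative

variable {ι : Type*} [Fintype ι] [DecidableEq ι]

theorem contDiff_det : ContDiff ℝ ∞ (fun A : ι → ι → ℝ => Matrix.det (Matrix.of A)) := by
  simp only [Matrix.det_apply, Matrix.of_apply]
  fun_prop

theorem contDiffAt_det {F : Type*} [NormedAddCommGroup F] [NormedSpace ℝ F]
    {A : F → Matrix ι ι ℝ} {x : F} (h : ∀ i j, ContDiffAt ℝ ∞ (fun y => A y i j) x) :
    ContDiffAt ℝ ∞ (fun y => (A y).det) x :=
  (contDiff_det (ι := ι)).contDiffAt.comp x
    (contDiffAt_pi.2 fun i => contDiffAt_pi.2 fun j => h i j)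

theorem contDiffAt_inv {F : Type*} [NormedAddCommGroup F] [NormedSpace ℝ F]
    {A : F → Matrix ι ι ℝ} {x : F} (h : ∀ i j, ContDiffAt ℝ ∞ (fun y => A y i j) x)
    (hA : (A x).det ≠ 0) (i j : ι) : ContDiffAt ℝ ∞ (fun y => (A y)⁻¹ i j) x := by
  simp only [Matrix.inv_def, Ring.inverse_eq_inv', Matrix.smul_apply, smul_eq_mul,
    Matrix.adjugate_apply]
  refine ((contDiffAt_det h).inv hA).mul (contDiffAt_det fun k l => ?_)
  simp only [Matrix.updateRow_apply]
  split_ifs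
  · exact contDiffAt_const
  · exact h k l

/-- Jacobi's formula. -/
theorem hasDerivAt_det {A : ℝ → Matrix ι ι ℝ} {A' : Matrix ι ι ℝ} {t : ℝ}
    (h : ∀ i j, HasDerivAt (fun s => A s i j) (A' i j) t) (hA : (A t).det ≠ 0) :
    HasDerivAt (fun s => (A s).det) ((A t).det * ((A t)⁻¹ * A').trace) t := by
  set D : (ι → ι → ℝ) → ℝ := fun A => Matrix.det (Matrix.of A) with hD
  have hdiff : ∀ B, HasFDerivAt D (fderiv ℝ D B) B := fun B =>
    ((contDiff_det (ι := ι)).differentiable (by simp) B).hasFDerivAt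
  -- The derivative of the determinant along a curve depends only on the position and velocity, so
  -- the curve may be replaced by its tangent line.
  have comp : ∀ {C : ℝ → Matrix ι ι ℝ} {s : ℝ}, C s = A t →
      (∀ i j, HasDerivAt (fun s => C s i j) (A' i j) s) →
      HasDerivAt (fun s => (C s).det) (fderiv ℝ D (fun i j => A t i j) (fun i j => A' i j)) s := by
    intro C s hs hC
    have h1 : HasDerivAt (fun s => (fun i j => C s i j : ι → ι → ℝ)) (fun i j => A' i j) s :=
      hasDerivAt_pi.2 fun i => hasDerivAt_pi.2 fun j => hC i j
    have h2 := (hdiff (fun i j => C s i j)).comp_hasDerivAt s h1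
    rw [hs] at h2
    exact h2
  have hline := comp (C := fun s => A t + s • A') (s := 0) (by simp) (fun i j => by
    simpa using ((hasDerivAt_id (0 : ℝ)).mul_const (A' i j)).const_add (A t i j))
  -- On the tangent line det(1 + sM) is a polynomial with constant term 1 and linear coefficient tr
  -- M; everything else carries a factor s².
  have heq : (fun s : ℝ => (A t + s • A').det) =
      fun s => (A t).det * (1 + ((A t)⁻¹ * A').trace * s +
        (Matrix.det (1 + (Polynomial.X : Polynomial ℝ) •
          ((A t)⁻¹ * A').map Polynomial.C)).divX.divX.eval s * s ^ 2) := by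
    funext s
    rw [← Matrix.det_one_add_smul, ← Matrix.det_mul, mul_add, mul_one, Matrix.mul_smul,
      Matrix.mul_nonsing_inv_cancel_left _ _ (isUnit_iff_ne_zero.2 hA)]
  have hpoly : HasDerivAt (fun s : ℝ => (A t + s • A').det)
      ((A t).det * ((A t)⁻¹ * A').trace) 0 := by
    rw [heq]
    set p := (Matrix.det (1 + (Polynomial.X : Polynomial ℝ) •
          ((A t)⁻¹ * A').map Polynomial.C)).divX.divX
    have e1 := (((hasDerivAt_id (0 : ℝ)).const_mul ((A t)⁻¹ * A').trace).const_add 1).add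
      ((p.hasDerivAt 0).mul ((hasDerivAt_id (0 : ℝ)).pow 2))
    have e2 := e1.const_mul (A t).det
    simpa using! e2
  rw [← hline.unique hpoly]
  exact comp rfl h

/-- The derivative of `f` is presented as `f t * d`, the shape in which Jacobi's formula delivers
it: the square root halves the logarithmic derivative `d`, and the absolute value leaves it alone.
-/
theorem hasDerivAt_sqrt_abs {f : ℝ → ℝ} {d t : ℝ} (h : HasDerivAt f (f t * d) t) (hf : f t ≠ 0) :
    HasDerivAt (fun s => √|f s|) (√|f t| * (d / 2)) t := by
  have h0 : 0 < |f t| := abs_pos.2 hf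
  have h1 : HasDerivAt (fun s => |f s|) (|f t| * d) t := by
    rcases lt_or_gt_of_ne hf with h2 | h2
    · have := h.neg
      refine (this.congr_of_eventuallyEq ?_).congr_deriv (by rw [abs_of_neg h2]; ring)
      filter_upwards [h.continuousAt.eventually_lt_const h2] with s hs
      simp [abs_of_neg hs]
    · refine (h.congr_of_eventuallyEq ?_).congr_deriv (by rw [abs_of_pos h2])
      filter_upwards [h.continuousAt.eventually_const_lt h2] with s hs
      simp [abs_of_pos hs]
  refine (h1.sqrt h0.ne').congr_deriv ?_
  have h2 := Real.sqrt_pos.2 h0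
  have h3 := Real.mul_self_sqrt h0.le
  field_simp
  rw [Real.sq_sqrt h0.le, mul_comm]

theorem contDiffAt_sqrt_abs {F : Type*} [NormedAddCommGroup F] [NormedSpace ℝ F]
    {f : F → ℝ} {x : F} (h : ContDiffAt ℝ ∞ f x) (hf : f x ≠ 0) :
    ContDiffAt ℝ ∞ (fun y => √|f y|) x :=
  ((contDiffAt_abs hf).comp x h).sqrt (abs_ne_zero.2 hf)

end DetDerivative

/-! ### The form da + a ⊗ a in coordinates, its Lie derivative and its trace. -/

section Model

variable {n : ℕ}

/-- The bilinear form `da + a ⊗ a` of a 1-form `a` on the model space. -/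
def formB (a : E n → E n →L[ℝ] ℝ) (z : E n) : LinearMap.BilinForm ℝ (E n) :=
  LinearMap.mk₂ ℝ (fun v w => extD a z v w + a z v * a z w)
    (by intros; simp only [extD, map_add, _root_.add_apply]; ring)
    (by intros; simp only [extD, map_smul, _root_.smul_apply, smul_eq_mul]; ring)
    (by intros; simp only [extD, map_add, _root_.add_apply]; ring)
    (by intros; simp only [extD, map_smul, _root_.smul_apply, smul_eq_mul]; ring)

theorem formB_apply (a : E n → E n →L[ℝ] ℝ) (z v w : E n) :
    formB a z v w = extD a z v w + a z v * a z w := rfl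

/-- The derivative `dc + c ⊗ a + a ⊗ c` of `formB` in the direction of the 1-form `c`. -/
def formB' (a c : E n → E n →L[ℝ] ℝ) (z : E n) : LinearMap.BilinForm ℝ (E n) :=
  LinearMap.mk₂ ℝ (fun v w => extD c z v w + (c z v * a z w + a z v * c z w))
    (by intros; simp only [extD, map_add, _root_.add_apply]; ring)
    (by intros; simp only [extD, map_smul, _root_.smul_apply, smul_eq_mul]; ring)
    (by intros; simp only [extD, map_add, _root_.add_apply]; ring)
    (by intros; simp only [extD, map_smul, _root_.smul_apply, smul_eq_mul]; ring)

theorem formB'_apply (a c : E n → E n →L[ℝ] ℝ) (z v w : E n) :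
    formB' a c z v w = extD c z v w + (c z v * a z w + a z v * c z w) := rfl

/-- The divergence of a vector field on the model space. -/
def divE (Y : E n → E n) (z : E n) : ℝ := ∑ k, (fderiv ℝ Y z (stdBasis n k)) k

theorem contDiffAt_fderiv {F G : Type*} [NormedAddCommGroup F] [NormedSpace ℝ F]
    [NormedAddCommGroup G] [NormedSpace ℝ G] {f : F → G} {x : F} (h : ContDiffAt ℝ ∞ f x) :
    ContDiffAt ℝ ∞ (fderiv ℝ f) x :=
  h.fderiv_right (by simp)

theorem contDiffAt_extD {a : E n → E n →L[ℝ] ℝ} {z : E n} (ha : ContDiffAt ℝ ∞ a z) (v w : E n) :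
    ContDiffAt ℝ ∞ (fun y => extD a y v w) z :=
  (((contDiffAt_fderiv ha).clm_apply contDiffAt_const).clm_apply contDiffAt_const).sub
    (((contDiffAt_fderiv ha).clm_apply contDiffAt_const).clm_apply contDiffAt_const)

theorem contDiffAt_formB {a : E n → E n →L[ℝ] ℝ} {z : E n} (ha : ContDiffAt ℝ ∞ a z) (v w : E n) :
    ContDiffAt ℝ ∞ (fun y => formB a y v w) z := by
  simp only [formB_apply]
  exact (contDiffAt_extD ha v w).add
    ((ha.clm_apply contDiffAt_const).mul (ha.clm_apply contDiffAt_const))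

theorem contDiffAt_bdet_formB {a : E n → E n →L[ℝ] ℝ} {z : E n} (ha : ContDiffAt ℝ ∞ a z) :
    ContDiffAt ℝ ∞ (fun y => bdet (formB a y)) z := by
  refine contDiffAt_det fun i j => ?_
  simp only [bmat_apply]
  exact contDiffAt_formB ha _ _

theorem sum_smul_stdBasis (v : E n) : ∑ k, v k • stdBasis n k = v := by
  have := (stdBasis n).sum_repr v
  simpa using this

theorem divE_smul {β : E n → ℝ} {Z : E n → E n} {z : E n} (hβ : DifferentiableAt ℝ β z)
    (hZ : DifferentiableAt ℝ Z z) :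
    divE (fun y => β y • Z y) z = fderiv ℝ β z (Z z) + β z * divE Z z := by
  have h1 : ∀ v, fderiv ℝ (fun y => β y • Z y) z v = β z • fderiv ℝ Z z v + fderiv ℝ β z v • Z z := by
    intro v
    rw [fderiv_fun_smul hβ hZ]; simp
  simp only [divE, h1, PiLp.add_apply, PiLp.smul_apply, smul_eq_mul, Finset.sum_add_distrib]
  rw [← Finset.mul_sum, add_comm]
  congr 1
  conv_rhs => rw [← sum_smul_stdBasis (Z z)]
  simp [mul_comm]

/-- The Lie derivative of `formB a` along `Z`. -/
theorem lie_formB {a c : E n → E n →L[ℝ] ℝ} {Z : E n → E n} {z : E n} {k : ℝ}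
    (ha : ContDiffAt ℝ ∞ a z) (hZ : DifferentiableAt ℝ Z z) (hcd : DifferentiableAt ℝ c z)
    (hc : ∀ᶠ y in 𝓝 z, ∀ w, c y w = extD a y (Z y) w) (hk : ∀ᶠ y in 𝓝 z, a y (Z y) = k)
    (v w : E n) :
    fderiv ℝ (fun y => formB a y v w) z (Z z) + formB a z (fderiv ℝ Z z v) w +
      formB a z v (fderiv ℝ Z z w) = formB' a c z v w := by
  -- Cartan's formula by hand: L_Z da = d(ι_Z da) = dc, and L_Z a = ι_Z da + d(a(Z)) = c since a(Z)
  -- is constant near z. The second derivatives of a that appear cancel by symmetry.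
  have had : DifferentiableAt ℝ a z := ha.differentiableAt (by simp)
  have hd2 : DifferentiableAt ℝ (fderiv ℝ a) z :=
    (contDiffAt_fderiv ha).differentiableAt (by simp)
  have hsymm : ∀ u v, fderiv ℝ (fderiv ℝ a) z u v = fderiv ℝ (fderiv ℝ a) z v u :=
    (ha.isSymmSndFDerivAt (by rw [minSmoothness_of_isRCLikeNormedField]; exact ENat.LEInfty.out)).eq
  have e0 : ∀ u v, fderiv ℝ (fun y => a y v) z u = fderiv ℝ a z u v := by
    intro u v
    rw [fderiv_clm_apply had (differentiableAt_const v)]; simp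
  have d0 : ∀ v, DifferentiableAt ℝ (fun y => a y v) z := fun v =>
    had.clm_apply (differentiableAt_const v)
  have d1 : ∀ v, DifferentiableAt ℝ (fun y => fderiv ℝ a y v) z := fun v =>
    hd2.clm_apply (differentiableAt_const v)
  have d2 : ∀ v w, DifferentiableAt ℝ (fun y => fderiv ℝ a y v w) z := fun v w =>
    (d1 v).clm_apply (differentiableAt_const w)
  have e1 : ∀ u v w, fderiv ℝ (fun y => fderiv ℝ a y v w) z u =
      fderiv ℝ (fderiv ℝ a) z u v w := by
    intro u v w
    rw [fderiv_clm_apply (d1 v) (differentiableAt_const w),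
      fderiv_clm_apply hd2 (differentiableAt_const v)]; simp
  have e2 : fderiv ℝ (fun y => formB a y v w) z (Z z) =
      fderiv ℝ (fderiv ℝ a) z (Z z) v w - fderiv ℝ (fderiv ℝ a) z (Z z) w v +
        (fderiv ℝ a z (Z z) v * a z w + a z v * fderiv ℝ a z (Z z) w) := by
    simp only [formB_apply, extD]
    rw [(((d2 v w).hasFDerivAt.fun_sub (d2 w v).hasFDerivAt).fun_add
      ((d0 v).hasFDerivAt.fun_mul (d0 w).hasFDerivAt)).fderiv]
    simp only [_root_.add_apply, _root_.sub_apply, _root_.smul_apply, e0, e1, smul_eq_mul]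
    ring
  have e3 : ∀ v w, fderiv ℝ c z v w =
      fderiv ℝ (fderiv ℝ a) z v (Z z) w + fderiv ℝ a z (fderiv ℝ Z z v) w -
        (fderiv ℝ (fderiv ℝ a) z v w (Z z) + fderiv ℝ a z w (fderiv ℝ Z z v)) := by
    intro v w
    have f1 : fderiv ℝ (fun y => c y w) z v = fderiv ℝ c z v w := by
      rw [fderiv_clm_apply hcd (differentiableAt_const w)]; simp
    have f2 : (fun y => c y w) =ᶠ[𝓝 z] fun y => fderiv ℝ a y (Z y) w - fderiv ℝ a y w (Z y) :=
      hc.mono fun y hy => hy w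
    rw [← f1, f2.fderiv_eq, fderiv_fun_sub ((hd2.clm_apply hZ).clm_apply (differentiableAt_const w))
      ((d1 w).clm_apply hZ), fderiv_clm_apply (hd2.clm_apply hZ) (differentiableAt_const w),
      fderiv_clm_apply hd2 hZ, fderiv_clm_apply (d1 w) hZ,
      fderiv_clm_apply hd2 (differentiableAt_const w)]
    simp
    ring
  have e4 : ∀ v, a z (fderiv ℝ Z z v) = - fderiv ℝ a z v (Z z) := by
    intro v
    have f1 : fderiv ℝ (fun y => a y (Z y)) z v = 0 := by
      rw [Filter.EventuallyEq.fderiv_eq (f₁ := fun y => a y (Z y)) (f := fun _ => k) hk]; simp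
    rw [fderiv_clm_apply had hZ] at f1
    simp at f1
    linarith
  have e5 : ∀ w, c z w = fderiv ℝ a z (Z z) w - fderiv ℝ a z w (Z z) := fun w =>
    hc.self_of_nhds w
  rw [e2]
  simp only [formB_apply, formB'_apply, extD, e3, e4, e5]
  rw [hsymm (Z z) v, hsymm (Z z) w, hsymm v w]
  ring

/-- The divergence of `Z` with respect to the density `√|det (da + a ⊗ a)|`. -/
theorem divE_density {a c : E n → E n →L[ℝ] ℝ} {Z : E n → E n} {z : E n} {k : ℝ}
    (ha : ContDiffAt ℝ ∞ a z) (hZ : DifferentiableAt ℝ Z z) (hcd : DifferentiableAt ℝ c z)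
    (hc : ∀ᶠ y in 𝓝 z, ∀ w, c y w = extD a y (Z y) w) (hk : ∀ᶠ y in 𝓝 z, a y (Z y) = k)
    (hdet : bdet (formB a z) ≠ 0) :
    divE (fun y => √|bdet (formB a y)| • Z y) z =
      √|bdet (formB a z)| * (((bmat (formB a z))⁻¹ * bmat (formB' a c z)).trace / 2) := by
  have hβ : DifferentiableAt ℝ (fun y => √|bdet (formB a y)|) z :=
    (contDiffAt_sqrt_abs (contDiffAt_bdet_formB ha) hdet).differentiableAt (by simp)
  rw [divE_smul hβ hZ]
  set B' : Matrix (Fin (2 * n + 1)) (Fin (2 * n + 1)) ℝ :=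
    Matrix.of fun i j => fderiv ℝ (fun y => formB a y (stdBasis n i) (stdBasis n j)) z (Z z)
  set L := LinearMap.toMatrix (stdBasis n) (stdBasis n) (fderiv ℝ Z z : E n →ₗ[ℝ] E n) with hL
  -- Matrix form of the Lie derivative: the derivative of the coefficients along `Z` plus the two
  -- terms with the Jacobian `L` of `Z`. After multiplication by the inverse matrix each of these
  -- two has trace div Z.
  have h1 : bmat (formB' a c z) = B' + L.transpose * bmat (formB a z) + bmat (formB a z) * L := by
    rw [bmat, bmat, hL, ← LinearMap.BilinForm.toMatrix_compLeft,
      ← LinearMap.BilinForm.toMatrix_compRight]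
    ext i j
    have := lie_formB ha hZ hcd hc hk (stdBasis n i) (stdBasis n j)
    simp only [Matrix.add_apply, LinearMap.BilinForm.toMatrix_apply, B', Matrix.of_apply,
      LinearMap.BilinForm.compLeft_apply, LinearMap.BilinForm.compRight_apply]
    exact this.symm
  have hu : IsUnit (bmat (formB a z)).det := isUnit_iff_ne_zero.2 hdet
  have h2 : L.trace = divE Z z := by
    simp [Matrix.trace, divE, hL, LinearMap.toMatrix_apply]
  have h3 : ((bmat (formB a z))⁻¹ * bmat (formB' a c z)).trace =
      ((bmat (formB a z))⁻¹ * B').trace + 2 * divE Z z := by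
    rw [h1, mul_add, mul_add, Matrix.trace_add, Matrix.trace_add, Matrix.nonsing_inv_mul_cancel_left _ _ hu,
      Matrix.trace_mul_comm _ (L.transpose * _), Matrix.mul_assoc, Matrix.mul_nonsing_inv _ hu, mul_one,
      Matrix.trace_transpose, h2]
    ring
  -- Jacobi's formula on the line through `z` in direction `Z z` accounts for the remaining trace.
  have h4 : fderiv ℝ (fun y => √|bdet (formB a y)|) z (Z z) =
      √|bdet (formB a z)| * (((bmat (formB a z))⁻¹ * B').trace / 2) := by
    have hA : ∀ i j, HasDerivAt (fun t : ℝ => bmat (formB a (z + t • Z z)) i j) (B' i j) 0 := by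
      intro i j
      simp only [bmat_apply]
      exact ((contDiffAt_formB ha (stdBasis n i) (stdBasis n j)).differentiableAt
          (by simp)).hasFDerivAt.hasLineDerivAt (Z z)
    have hz : z + (0 : ℝ) • Z z = z := by simp
    have h5 := hasDerivAt_det hA (by rw [hz]; exact hdet)
    have h6 := hasDerivAt_sqrt_abs h5 (by rw [hz]; exact hdet)
    rw [hz] at h6
    exact (hβ.hasFDerivAt.hasLineDerivAt (Z z)).unique h6
  rw [h4, h3]
  ring

/-- The inverse matrix of `B` turns the covector `η` back into `X`, and the trace of a rank one
matrix is the pairing of its two factors. -/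
theorem trace_inv_mul_rank_one {B : LinearMap.BilinForm ℝ (E n)} {η α : E n →L[ℝ] ℝ} {X : E n}
    (hB : bdet B ≠ 0) (hX : ∀ v, B X v = η v) :
    ((bmat B)⁻¹ * Matrix.vecMulVec (fun i => α (stdBasis n i))
      (fun j => η (stdBasis n j))).trace = α X := by
  have hu : IsUnit (bmat B).det := isUnit_iff_ne_zero.2 hB
  have h1 : Matrix.vecMul (X : Fin (2 * n + 1) → ℝ) (bmat B) = fun j => η (stdBasis n j) := by
    funext j
    conv_rhs => rw [← hX, ← sum_smul_stdBasis X]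
    simp only [Matrix.vecMul, dotProduct, bmat_apply, map_sum, map_smul, LinearMap.sum_apply,
      LinearMap.smul_apply, smul_eq_mul]
  have h2 : Matrix.vecMul (fun j => η (stdBasis n j)) (bmat B)⁻¹ = (X : Fin (2 * n + 1) → ℝ) := by
    rw [← h1, Matrix.vecMul_vecMul, Matrix.mul_nonsing_inv _ hu, Matrix.vecMul_one]
  rw [Matrix.mul_vecMulVec, Matrix.trace_vecMulVec, dotProduct_comm, Matrix.dotProduct_mulVec, h2]
  conv_rhs => rw [← sum_smul_stdBasis X]
  simp [dotProduct]

theorem trace_inv_mul_rank_one' {B : LinearMap.BilinForm ℝ (E n)} {η α : E n →L[ℝ] ℝ} {X : E n}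
    (hB : bdet B ≠ 0) (hX : ∀ v, B v X = η v) :
    ((bmat B)⁻¹ * Matrix.vecMulVec (fun j => η (stdBasis n j))
      (fun i => α (stdBasis n i))).trace = α X := by
  have hu : IsUnit (bmat B).det := isUnit_iff_ne_zero.2 hB
  have h1 : Matrix.mulVec (bmat B) (X : Fin (2 * n + 1) → ℝ) = fun j => η (stdBasis n j) := by
    funext j
    conv_rhs => rw [← hX, ← sum_smul_stdBasis X]
    simp only [Matrix.mulVec, dotProduct, bmat_apply, map_sum, map_smul, smul_eq_mul]
    exact Finset.sum_congr rfl fun _ _ => mul_comm _ _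
  have h2 : Matrix.mulVec (bmat B)⁻¹ (fun j => η (stdBasis n j)) = (X : Fin (2 * n + 1) → ℝ) := by
    rw [← h1, Matrix.mulVec_mulVec, Matrix.nonsing_inv_mul _ hu, Matrix.one_mulVec]
  rw [Matrix.mul_vecMulVec, Matrix.trace_vecMulVec, h2]
  conv_rhs => rw [← sum_smul_stdBasis X]
  simp [dotProduct]

/-- The trace that gives the first variation of the volume density in the direction of
`f η + γ / 2`. -/
theorem trace_first_variation {B C C' : LinearMap.BilinForm ℝ (E n)} {η δ : E n →L[ℝ] ℝ} {X : E n}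
    {f : ℝ} (hB : bdet B ≠ 0) (hX : ∀ v, B v X = η v) (hX' : ∀ v, B X v = η v) (hη : η X = 1)
    (hC : ∀ v w, C v w = f * B v w + f * (η v * η w) + (δ v * η w - δ w * η v) + 1 / 2 * C' v w) :
    ((bmat B)⁻¹ * bmat C).trace =
      2 * (n + 1) * f + 1 / 2 * ((bmat B)⁻¹ * bmat C').trace := by
  have hu : IsUnit (bmat B).det := isUnit_iff_ne_zero.2 hB
  -- The multiple of `B` has trace (2n+1)f after multiplication by the inverse, and `η ⊗ η` adds `f
  -- * η X = f`. The two `δ` terms have the same trace `δ X` and cancel, so the derivative of `f`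
  -- plays no role.
  have h1 : bmat C = f • bmat B +
      f • Matrix.vecMulVec (fun i => η (stdBasis n i)) (fun j => η (stdBasis n j)) +
      (Matrix.vecMulVec (fun i => δ (stdBasis n i)) (fun j => η (stdBasis n j)) -
        Matrix.vecMulVec (fun i => η (stdBasis n i)) (fun j => δ (stdBasis n j))) +
      (1 / 2 : ℝ) • bmat C' := by
    ext i j
    simp only [bmat_apply, hC, Matrix.add_apply, Matrix.sub_apply, Matrix.smul_apply,
      Matrix.vecMulVec_apply, smul_eq_mul]
    ring
  rw [h1]
  simp only [mul_add, mul_sub, Matrix.trace_add, Matrix.trace_sub, Matrix.mul_smul,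
    Matrix.trace_smul, trace_inv_mul_rank_one hB hX', trace_inv_mul_rank_one' hB hX,
    Matrix.nonsing_inv_mul _ hu, Matrix.trace_one, Fintype.card_fin, smul_eq_mul, hη]
  push_cast
  ring

end Model

/-! ### Gluing chart densities into a measure. -/

section Gluing

variable {n : ℕ} {M : Type*} [TopologicalSpace M] [ChartedSpace (E n) M]
  [MeasurableSpace M] [BorelSpace M]

/-- The density of `σ` in the preferred chart at `x`. -/
def chartDensity (σ : M → ℝ) (x : M) (z : E n) : ℝ :=
  |(frame x z).det| * σ ((extChartAt (I n) x).symm z)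

/-- The measure with density `|det frame| * σ`, transported from the preferred chart at `x`. -/
def chartDensityMeasure (σ : M → ℝ) (x : M) : Measure M :=
  Measure.map (extChartAt (I n) x).symm
    ((volume.restrict (extChartAt (I n) x).target).withDensity
      (fun z => ENNReal.ofReal (chartDensity σ x z)))

/-- The measure glued from the chart measures of `σ`. -/
def densityMeasure (n : ℕ) {M : Type*} [TopologicalSpace M] [ChartedSpace (E n) M]
    [MeasurableSpace M] (σ : M → ℝ) : Measure M :=
  ⨆ x : M, chartDensityMeasure (n := n) σ x

theorem aemeasurable_symm (x : M) : AEMeasurable (extChartAt (I n) x).symm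
    (volume.restrict (extChartAt (I n) x).target) :=
  (continuousOn_extChartAt_symm x).aemeasurable (isOpen_target x).measurableSet

theorem aemeasurable_symm' (σ : M → ℝ) (x : M) : AEMeasurable (extChartAt (I n) x).symm
    ((volume.restrict (extChartAt (I n) x).target).withDensity
      (fun z => ENNReal.ofReal (chartDensity σ x z))) :=
  (aemeasurable_symm x).mono_ac (withDensity_absolutelyContinuous _ _)

theorem chartDensityMeasure_apply (σ : M → ℝ) (x : M) {s : Set M} (hs : MeasurableSet s) :
    chartDensityMeasure (n := n) σ x s = ∫⁻ z in (extChartAt (I n) x).symm ⁻¹' s ∩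
      (extChartAt (I n) x).target, ENNReal.ofReal (chartDensity σ x z) := by
  rw [chartDensityMeasure, Measure.map_apply_of_aemeasurable (aemeasurable_symm' σ x) hs,
    withDensity_apply', Measure.restrict_restrict' (isOpen_target x).measurableSet]

theorem measurableSet_source (x : M) : MeasurableSet (extChartAt (I n) x).source :=
  (isOpen_extChartAt_source x).measurableSet

open Classical in
theorem measurableSet_symm_preimage (x : M) {s : Set M} (hs : MeasurableSet s) :
    MeasurableSet ((extChartAt (I n) x).symm ⁻¹' s ∩ (extChartAt (I n) x).target) := by
  have hT := (isOpen_target (n := n) x).measurableSet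
  -- The inverse chart is continuous only on its target, so it is replaced by a constant outside.
  have hm : Measurable ((extChartAt (I n) x).target.piecewise (extChartAt (I n) x).symm
      (fun _ => x)) :=
    (continuousOn_extChartAt_symm x).measurable_piecewise continuousOn_const hT
  have h2 := (hm hs).inter hT
  convert h2 using 1
  ext z
  simp only [mem_inter_iff, mem_preimage]
  refine and_congr_left fun hz => ?_
  rw [piecewise_eq_of_mem _ _ _ hz]

theorem chartDensityMeasure_inter_source (σ : M → ℝ) (x : M) {s : Set M} (hs : MeasurableSet s) :
    chartDensityMeasure (n := n) σ x (s ∩ (extChartAt (I n) x).source) =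
      chartDensityMeasure (n := n) σ x s := by
  rw [chartDensityMeasure_apply σ x hs,
    chartDensityMeasure_apply σ x (hs.inter (measurableSet_source x))]
  congr 2
  ext z
  simp only [preimage_inter, mem_inter_iff, mem_preimage]
  exact ⟨fun h => ⟨h.1.1, h.2⟩, fun h => ⟨⟨h.1, (extChartAt (I n) x).map_target h.2⟩, h.2⟩⟩

variable [IsManifold (I n) ∞ M]

/-- Change of variables along the transition map: by the chain rule the determinants of the two
frames differ by exactly its Jacobian determinant. -/
theorem chartDensityMeasure_congr (σ : M → ℝ) (x y : M) {s : Set M} (hs : MeasurableSet s)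
    (hx : s ⊆ (extChartAt (I n) x).source) (hy : s ⊆ (extChartAt (I n) y).source) :
    chartDensityMeasure (n := n) σ x s = chartDensityMeasure (n := n) σ y s := by
  rw [chartDensityMeasure_apply σ x hs, chartDensityMeasure_apply σ y hs]
  set τ : E n → E n := fun q => extChartAt (I n) y ((extChartAt (I n) x).symm q) with hτ
  set A := (extChartAt (I n) x).symm ⁻¹' s ∩ (extChartAt (I n) x).target with hA
  have him : (extChartAt (I n) y).symm ⁻¹' s ∩ (extChartAt (I n) y).target = τ '' A := by
    ext z
    constructor
    · rintro ⟨h1, h2⟩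
      refine ⟨extChartAt (I n) x ((extChartAt (I n) y).symm z), ⟨?_, ?_⟩, ?_⟩
      · rw [mem_preimage, (extChartAt (I n) x).left_inv (hx h1)]; exact h1
      · exact (extChartAt (I n) x).map_source (hx h1)
      · simp only [hτ, (extChartAt (I n) x).left_inv (hx h1), (extChartAt (I n) y).right_inv h2]
    · rintro ⟨w, ⟨h1, h2⟩, rfl⟩
      refine ⟨?_, (extChartAt (I n) y).map_source (hy h1)⟩
      rw [mem_preimage, (extChartAt (I n) y).left_inv (hy h1)]; exact h1
  have hinj : InjOn τ A := by
    rintro w ⟨h1, h2⟩ w' ⟨h1', h2'⟩ hww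
    have := (extChartAt (I n) y).injOn (hy h1) (hy h1') hww
    exact (extChartAt (I n) x).symm.injOn h2 h2' this
  have htr : ∀ z ∈ A, _ := fun z hz => frame_transition (x₀ := y) hz.2 (hy hz.1)
  rw [him, lintegral_image_eq_lintegral_abs_det_fderiv_mul volume (measurableSet_symm_preimage x hs)
    (fun z hz => ((htr z hz).1.differentiableAt (by simp)).hasFDerivAt.hasFDerivWithinAt) hinj]
  refine setLIntegral_congr_fun (measurableSet_symm_preimage x hs) fun z hz => ?_
  rw [← ENNReal.ofReal_mul (abs_nonneg _)]
  congr 1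
  have h3 : (extChartAt (I n) y).symm (τ z) = (extChartAt (I n) x).symm z :=
    (extChartAt (I n) y).left_inv (hy hz.1)
  have h4 : (frame x z).det = (frame y (τ z)).det * (fderiv ℝ τ z).det := by
    rw [(htr z hz).2]
    exact LinearMap.det_comp _ _
  simp only [chartDensity]
  rw [h3, h4, abs_mul]
  ring

omit [MeasurableSpace M] [BorelSpace M] in
theorem frame_det_ne_zero {x : M} {z : E n} (hz : z ∈ (extChartAt (I n) x).target) :
    (frame x z).det ≠ 0 := by
  have h1 : LinearMap.det ((coframe (n := n) x ((extChartAt (I n) x).symm z) : E n →ₗ[ℝ] E n) ∘ₗ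
      (frame x z : E n →ₗ[ℝ] E n)) = 1 := by
    rw [← ContinuousLinearMap.toLinearMap_comp, coframe_comp_frame hz]
    exact LinearMap.det_id
  rw [LinearMap.det_comp] at h1
  exact right_ne_zero_of_mul_eq_one h1

variable [CompactSpace M]

/-- A finite chart cover, listed by natural numbers with repetitions and made disjoint. The listing
requires `M` to be nonempty. -/
theorem exists_chart_partition (n : ℕ) (M : Type*) [TopologicalSpace M] [ChartedSpace (E n) M]
    [MeasurableSpace M] [BorelSpace M] [CompactSpace M] [Nonempty M] :
    ∃ (f : ℕ → M) (P : ℕ → Set M), (∀ i, MeasurableSet (P i)) ∧ Pairwise (Function.onFun Disjoint P) ∧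
      ⋃ i, P i = univ ∧ (∀ i, P i ⊆ (extChartAt (I n) (f i)).source) ∧
      ⋃ i, (extChartAt (I n) (f i)).source = univ := by
  obtain ⟨t, ht⟩ := CompactSpace.elim_nhds_subcover (fun x : M => (extChartAt (I n) x).source)
    (fun x => extChartAt_source_mem_nhds x)
  have htn : (t : Set M).Nonempty := by
    by_contra h
    rw [not_nonempty_iff_eq_empty, Finset.coe_eq_empty] at h
    subst h
    simp at ht
    exact (univ_nonempty (α := M)).ne_empty ht.symm
  obtain ⟨f, hf⟩ := t.countable_toSet.exists_eq_range htn
  have hcov : ⋃ i, (extChartAt (I n) (f i)).source = univ := by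
    rw [← top_eq_univ, ← ht]
    ext y
    simp only [mem_iUnion]
    constructor
    · rintro ⟨i, hi⟩
      exact ⟨f i, by rw [← Finset.mem_coe, hf]; exact mem_range_self i, hi⟩
    · rintro ⟨x, hx, hy⟩
      rw [← Finset.mem_coe, hf] at hx
      obtain ⟨i, rfl⟩ := hx
      exact ⟨i, hy⟩
  refine ⟨f, disjointed fun i => (extChartAt (I n) (f i)).source, ?_, disjoint_disjointed _, ?_, ?_,
    hcov⟩
  · exact fun i => MeasurableSet.disjointed (fun i => measurableSet_source (f i)) i
  · rw [iUnion_disjointed, hcov]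
  · exact fun i => disjointed_subset _ i

/-- A supremum of measures is not computed set by set. Here it is dominated by the sum of chart
measures restricted to a chart partition, since all of them agree on overlaps; on a set inside one
chart that sum is the measure of this chart. -/
theorem densityMeasure_apply (σ : M → ℝ) (x : M) {s : Set M} (hs : MeasurableSet s)
    (hx : s ⊆ (extChartAt (I n) x).source) :
    densityMeasure n σ s = chartDensityMeasure (n := n) σ x s := by
  have : Nonempty M := ⟨x⟩
  obtain ⟨f, P, hPm, hPd, hPu, hPs, -⟩ := exists_chart_partition n M
  have hsplit : ∀ (m : Measure M) {s : Set M}, MeasurableSet s → m s = ∑' i, m (s ∩ P i) := by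
    intro m s hs
    rw [← measure_iUnion (fun i j hij => (hPd hij).mono inter_subset_right inter_subset_right)
      (fun i => hs.inter (hPm i)), ← inter_iUnion, hPu, inter_univ]
  have hle : densityMeasure n σ ≤
      Measure.sum fun i => (chartDensityMeasure (n := n) σ (f i)).restrict (P i) := by
    refine iSup_le fun y => ?_
    rw [Measure.le_iff]
    intro s hs
    rw [Measure.sum_apply _ hs, hsplit _ hs]
    refine ENNReal.tsum_le_tsum fun i => ?_
    rw [Measure.restrict_apply hs, ← chartDensityMeasure_inter_source σ y (hs.inter (hPm i)),
      chartDensityMeasure_congr σ y (f i) ((hs.inter (hPm i)).inter (measurableSet_source y))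
        inter_subset_right (inter_subset_left.trans (inter_subset_right.trans (hPs i)))]
    exact measure_mono inter_subset_left
  refine le_antisymm ?_ (Measure.le_iff.1 (le_iSup (fun x => chartDensityMeasure (n := n) σ x) x) s hs)
  refine (Measure.le_iff.1 hle s hs).trans ?_
  rw [Measure.sum_apply _ hs, hsplit _ hs]
  refine ENNReal.tsum_le_tsum fun i => ?_
  rw [Measure.restrict_apply hs, chartDensityMeasure_congr σ (f i) x (hs.inter (hPm i))
    (inter_subset_right.trans (hPs i)) (inter_subset_left.trans hx)]

theorem densityMeasure_restrict (σ : M → ℝ) (x : M) :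
    (densityMeasure n σ).restrict (extChartAt (I n) x).source = chartDensityMeasure (n := n) σ x := by
  ext s hs
  rw [Measure.restrict_apply hs, densityMeasure_apply σ x (hs.inter (measurableSet_source x))
    inter_subset_right, chartDensityMeasure_inter_source σ x hs]

omit [IsManifold (I n) ∞ M] in
theorem measure_ext_of_charts {m₁ m₂ : Measure M}
    (h : ∀ x, m₁.restrict (extChartAt (I n) x).source = m₂.restrict (extChartAt (I n) x).source) :
    m₁ = m₂ := by
  rcases isEmpty_or_nonempty M with hM | hM
  · rw [Measure.eq_zero_of_isEmpty m₁, Measure.eq_zero_of_isEmpty m₂]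
  · obtain ⟨f, P, -, -, -, -, hc⟩ := exists_chart_partition n M
    have := (Measure.restrict_iUnion_congr (μ := m₁) (ν := m₂)
      (s := fun i => (extChartAt (I n) (f i)).source)).2 fun i => h (f i)
    rwa [hc, Measure.restrict_univ, Measure.restrict_univ] at this

omit [CompactSpace M] [IsManifold (I n) ∞ M] [MeasurableSpace M] [BorelSpace M] in
theorem aemeasurable_chartDensity {σ : M → ℝ} {x : M}
    (hσ : ContinuousOn (chartDensity (n := n) σ x) (extChartAt (I n) x).target) :
    AEMeasurable (fun z => ENNReal.ofReal (chartDensity (n := n) σ x z))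
      (volume.restrict (extChartAt (I n) x).target) :=
  (hσ.aemeasurable (isOpen_target x).measurableSet).ennreal_ofReal

/-- This compares two volume elements through their quotient. The function `σ` is taken relative to
the preferred chart at each point, which may jump from point to point; so regularity is asked of the
chart densities and of `r`, never of `σ` itself. -/
theorem densityMeasure_mul {σ r : M → ℝ}
    (hσ : ∀ x, ContinuousOn (chartDensity (n := n) σ x) (extChartAt (I n) x).target)
    (hσ0 : ∀ p, 0 ≤ σ p) (hr : Measurable r) :
    densityMeasure n (fun p => σ p * r p) =
      (densityMeasure n σ).withDensity (fun p => ENNReal.ofReal (r p)) := by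
  refine measure_ext_of_charts (n := n) fun x => ?_
  rw [restrict_withDensity (measurableSet_source x), densityMeasure_restrict,
    densityMeasure_restrict]
  have hr' : AEMeasurable (fun z => ENNReal.ofReal (r ((extChartAt (I n) x).symm z)))
      (volume.restrict (extChartAt (I n) x).target) :=
    (hr.comp_aemeasurable (aemeasurable_symm x)).ennreal_ofReal
  ext s hs
  rw [withDensity_apply _ hs, chartDensityMeasure_apply _ x hs, chartDensityMeasure,
    Measure.restrict_map_of_aemeasurable (aemeasurable_symm' σ x) hs,
    lintegral_map' hr.ennreal_ofReal.aemeasurable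
      ((aemeasurable_symm' σ x).mono_measure Measure.restrict_le_self),
    restrict_withDensity', Measure.restrict_restrict' (isOpen_target x).measurableSet,
    lintegral_withDensity_eq_lintegral_mul₀]
  · refine lintegral_congr fun z => ?_
    simp only [chartDensity, Pi.mul_apply]
    rw [← ENNReal.ofReal_mul (mul_nonneg (abs_nonneg _) (hσ0 _))]
    congr 1; ring
  · exact (aemeasurable_chartDensity (hσ x)).mono_measure (Measure.restrict_mono inter_subset_right le_rfl)
  · exact hr'.mono_measure (Measure.restrict_mono inter_subset_right le_rfl)

theorem isFiniteMeasure_densityMeasure {σ : M → ℝ}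
    (hσ : ∀ x, ContinuousOn (chartDensity (n := n) σ x) (extChartAt (I n) x).target) :
    IsFiniteMeasure (densityMeasure n σ) := by
  have hloc : ∀ x : M, ∃ s ∈ 𝓝 x, densityMeasure n σ s < ⊤ := by
    intro x
    obtain ⟨K, hK, hKT, hKc⟩ := LocallyCompactSpace.local_compact_nhds _ _
      (target_mem_nhds (ext_mem_target (n := n) x))
    set s := (extChartAt (I n) x).source ∩ extChartAt (I n) x ⁻¹' (interior K) with hs
    have hso : IsOpen s :=
      (continuousOn_extChartAt x).isOpen_inter_preimage (isOpen_extChartAt_source x) isOpen_interior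
    refine ⟨s, hso.mem_nhds ⟨mem_extChartAt_source x, mem_interior_iff_mem_nhds.2 hK⟩, ?_⟩
    rw [densityMeasure_apply σ x hso.measurableSet inter_subset_left,
      chartDensityMeasure_apply σ x hso.measurableSet]
    have hsub : (extChartAt (I n) x).symm ⁻¹' s ∩ (extChartAt (I n) x).target ⊆ K := by
      rintro z ⟨hz1, hz2⟩
      have := hz1.2
      rw [mem_preimage, (extChartAt (I n) x).right_inv hz2] at this
      exact interior_subset this
    refine (lintegral_mono_set hsub).trans_lt ?_
    exact ((hσ x).mono hKT).integrableOn_compact hKc |>.lintegral_lt_top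
  choose U hU hU2 using hloc
  obtain ⟨t, ht⟩ := CompactSpace.elim_nhds_subcover U hU
  refine ⟨?_⟩
  rw [← top_eq_univ, ← ht]
  exact (measure_biUnion_lt_top t.finite_toSet fun x _ => hU2 x)

theorem isOpenPosMeasure_densityMeasure {σ : M → ℝ}
    (hσ : ∀ x, ContinuousOn (chartDensity (n := n) σ x) (extChartAt (I n) x).target)
    (hσ0 : ∀ p, 0 < σ p) : (densityMeasure n σ).IsOpenPosMeasure := by
  refine ⟨fun U hU ⟨x, hx⟩ h0 => ?_⟩
  have h1 : densityMeasure n σ (U ∩ (extChartAt (I n) x).source) = 0 :=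
    measure_mono_null inter_subset_left h0
  have hms := hU.measurableSet.inter (measurableSet_source (n := n) x)
  rw [densityMeasure_apply σ x hms inter_subset_right, chartDensityMeasure_apply σ x hms] at h1
  set A := (extChartAt (I n) x).symm ⁻¹' (U ∩ (extChartAt (I n) x).source) ∩
    (extChartAt (I n) x).target with hA
  have hAo : IsOpen A := by
    rw [hA, inter_comm]
    exact (continuousOn_extChartAt_symm x).isOpen_inter_preimage (isOpen_target x)
      (hU.inter (isOpen_extChartAt_source x))
  have hAn : A.Nonempty := ⟨extChartAt (I n) x x, by
    refine ⟨?_, ext_mem_target x⟩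
    rw [mem_preimage, symm_ext]; exact ⟨hx, mem_extChartAt_source x⟩⟩
  have hAT : A ⊆ (extChartAt (I n) x).target := inter_subset_right
  rw [lintegral_eq_zero_iff' ((aemeasurable_chartDensity (hσ x)).mono_measure
    (Measure.restrict_mono hAT le_rfl)), Filter.EventuallyEq, ae_restrict_iff' hAo.measurableSet] at h1
  have h2 : volume A = 0 := by
    refine measure_mono_null ?_ (ae_iff.1 h1)
    intro z hz
    simp only [mem_ofPred_eq, Classical.not_imp, Pi.zero_apply, ENNReal.ofReal_eq_zero, not_le]
    refine ⟨hz, mul_pos (abs_pos.2 ?_) (hσ0 _)⟩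
    exact frame_det_ne_zero (hAT hz)
  exact hAo.measure_ne_zero volume hAn h2

/-- The integral of a function that vanishes off a chart, computed in the chart. -/
theorem integral_densityMeasure {σ : M → ℝ} (x : M)
    (hσ : ContinuousOn (chartDensity (n := n) σ x) (extChartAt (I n) x).target)
    (hσ0 : ∀ p, 0 ≤ σ p) {f : M → ℝ} (hf : Measurable f)
    (hfs : ∀ p ∉ (extChartAt (I n) x).source, f p = 0) :
    ∫ p, f p ∂(densityMeasure n σ) = ∫ z in (extChartAt (I n) x).target,
      chartDensity (n := n) σ x z * f ((extChartAt (I n) x).symm z) := by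
  rw [← setIntegral_eq_integral_of_forall_compl_eq_zero hfs, densityMeasure_restrict,
    chartDensityMeasure, integral_map (aemeasurable_symm' σ x) hf.aestronglyMeasurable,
    integral_withDensity_eq_integral_toReal_smul₀ (aemeasurable_chartDensity hσ)
      (by simp)]
  refine integral_congr_ae (Eventually.of_forall fun z => ?_)
  simp only [smul_eq_mul]
  rw [ENNReal.toReal_ofReal (show 0 ≤ chartDensity (n := n) σ x z from
    mul_nonneg (abs_nonneg _) (hσ0 _))]

end Gluing

/-! ### The divergence theorem on a closed manifold. -/

section Divergence

variable {n : ℕ}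

theorem divE_congr {Y Y' : E n → E n} {z : E n} (h : Y =ᶠ[𝓝 z] Y') : divE Y z = divE Y' z := by
  simp only [divE, h.fderiv_eq]

/-- Integration by parts against the constant function 1; only the products with `f` and its
derivative have to be integrable. -/
theorem integral_fderiv_eq_zero_of_compactSupport {f : E n → ℝ} (hf : ContDiff ℝ 1 f)
    (hc : HasCompactSupport f) (v : E n) : ∫ z, fderiv ℝ f z v = 0 := by
  have h1 : Continuous fun z => fderiv ℝ f z v :=
    (hf.continuous_fderiv (by simp)).clm_apply continuous_const
  have h2 : HasCompactSupport fun z => fderiv ℝ f z v := hc.fderiv_apply (𝕜 := ℝ) v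
  have h3 := integral_mul_fderiv_eq_neg_fderiv_mul_of_integrable (μ := (volume : Measure (E n)))
    (f := f) (g := fun _ => (1 : ℝ)) (v := v)
    (by simpa using h1.integrable_of_hasCompactSupport h2) (by simp)
    (by simpa using hf.continuous.integrable_of_hasCompactSupport hc)
    (fun z _ => hf.differentiable (by simp) z) (fun z _ => differentiableAt_const _)
  simpa using h3.symm

theorem integral_divE_eq_zero {Y : E n → E n} (hY : ContDiff ℝ 1 Y) (hc : HasCompactSupport Y) :
    ∫ z, divE Y z = 0 := by
  have hk : ∀ k v z, fderiv ℝ (fun y => Y y k) z v = (fderiv ℝ Y z v) k := by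
    intro k v z
    have := ((EuclideanSpace.proj (𝕜 := ℝ) k).hasFDerivAt.comp z
      (hY.differentiable (by simp) z).hasFDerivAt).fderiv
    exact DFunLike.congr_fun this v
  have hYk : ∀ k, ContDiff ℝ 1 fun y => Y y k := fun k =>
    (EuclideanSpace.proj (𝕜 := ℝ) k).contDiff.comp hY
  have hck : ∀ k, HasCompactSupport fun y => Y y k := fun k =>
    hc.comp_left (g := fun v : E n => v k) rfl
  simp only [divE]
  rw [integral_finsetSum]
  · refine Finset.sum_eq_zero fun k _ => ?_
    simp only [← hk]
    exact integral_fderiv_eq_zero_of_compactSupport (hYk k) (hck k) _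
  · intro k _
    simp only [← hk]
    exact (((hYk k).continuous_fderiv (by simp)).clm_apply continuous_const
      ).integrable_of_hasCompactSupport ((hck k).fderiv_apply (𝕜 := ℝ) _)

variable {M : Type*} [TopologicalSpace M] [ChartedSpace (E n) M] [IsManifold (I n) ∞ M]

omit [IsManifold (I n) ∞ M] in
theorem mdifferentiable_of_contMDiff {f : M → ℝ} (hf : ContMDiff (I n) 𝓘(ℝ, ℝ) ∞ f) (p : M) :
    MDifferentiableAt (I n) 𝓘(ℝ, ℝ) f p :=
  (hf p).mdifferentiableAt (by simp)

theorem diff_field {f : M → ℝ} (hf : ContMDiff (I n) 𝓘(ℝ, ℝ) ∞ f) (Y : M → E n) {x : M} {z : E n}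
    (hz : z ∈ (extChartAt (I n) x).target) :
    diff (n := n) f ((extChartAt (I n) x).symm z) (Y ((extChartAt (I n) x).symm z)) =
      fderiv ℝ (fun q => f ((extChartAt (I n) x).symm q)) z (fieldRep x Y z) := by
  rw [← diff_frame hz (mdifferentiable_of_contMDiff hf _), frame_fieldRep hz]

theorem contMDiff_diff {f : M → ℝ} (hf : ContMDiff (I n) 𝓘(ℝ, ℝ) ∞ f) {Y : M → E n}
    (hY : ∀ x : M, ContDiffAt ℝ ∞ (fieldRep x Y) (extChartAt (I n) x x)) :
    ContMDiff (I n) 𝓘(ℝ, ℝ) ∞ fun p => diff (n := n) f p (Y p) := by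
  intro x
  refine contMDiffAt_of_rep ?_
  have h1 := (contDiffAt_fderiv (contDiffAt_rep hf (ext_mem_target (n := n) x))).clm_apply (hY x)
  refine h1.congr_of_eventuallyEq ?_
  filter_upwards [target_mem_nhds (ext_mem_target (n := n) x)] with z hz
  exact diff_field hf Y hz

omit [IsManifold (I n) ∞ M] in
theorem diff_const (c : ℝ) (p : M) (v : E n) : diff (n := n) (fun _ : M => c) p v = 0 := by
  have h : mfderiv (I n) 𝓘(ℝ, ℝ) (fun _ : M => c) p = 0 := mfderiv_const
  exact congrArg (fun L : E n →L[ℝ] ℝ => L v) h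

omit [IsManifold (I n) ∞ M] in
theorem diff_congr {f f' : M → ℝ} {p : M} (h : f =ᶠ[𝓝 p] f') (v : E n) :
    diff (n := n) f p v = diff (n := n) f' p v :=
  congrArg (fun L : E n →L[ℝ] ℝ => L v) (Filter.EventuallyEq.mfderiv_eq h)

theorem sum_diff {ι : Type*} {s : Finset ι} {f : ι → M → ℝ}
    (hf : ∀ i, ContMDiff (I n) 𝓘(ℝ, ℝ) ∞ (f i)) (p : M) (v : E n) :
    diff (n := n) (fun q => ∑ i ∈ s, f i q) p v = ∑ i ∈ s, diff (n := n) (f i) p v := by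
  have h1 : ContMDiff (I n) 𝓘(ℝ, ℝ) ∞ (fun q => ∑ i ∈ s, f i q) :=
    contMDiff_finsetSum fun i _ => hf i
  rw [diff_eq_fderiv (mdifferentiable_of_contMDiff h1 p), fderiv_fun_sum
    fun i _ => (contDiffAt_rep (hf i) (ext_mem_target (n := n) p)).differentiableAt (by simp)]
  rw [_root_.sum_apply]
  exact Finset.sum_congr rfl fun i _ =>
    (diff_eq_fderiv (mdifferentiable_of_contMDiff (hf i) p) v).symm

variable [MeasurableSpace M] [BorelSpace M] [CompactSpace M] [T2Space M]

omit [T2Space M] in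
/-- The divergence theorem for a field supported in a chart. -/
theorem integral_divergence_of_tsupport_subset {σ : M → ℝ} {Y : M → E n} {d χ : M → ℝ} (x : M)
    (hσ : ∀ z ∈ (extChartAt (I n) x).target, ContDiffAt ℝ ∞ (chartDensity (n := n) σ x) z)
    (hσ0 : ∀ p, 0 ≤ σ p)
    (hY : ∀ x : M, ∀ z ∈ (extChartAt (I n) x).target, ContDiffAt ℝ ∞ (fieldRep x Y) z)
    (hd : Continuous d) (hχ : ContMDiff (I n) 𝓘(ℝ, ℝ) ∞ χ)
    (hχs : tsupport χ ⊆ (extChartAt (I n) x).source)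
    (hdiv : ∀ z ∈ (extChartAt (I n) x).target, chartDensity (n := n) σ x z *
      d ((extChartAt (I n) x).symm z) =
        divE (fun y => chartDensity (n := n) σ x y • fieldRep x Y y) z) :
    ∫ p, (χ p * d p + diff (n := n) χ p (Y p)) ∂(densityMeasure n σ) = 0 := by
  have hχ0 : ∀ p ∉ tsupport χ, χ p = 0 ∧ diff (n := n) χ p (Y p) = 0 := by
    intro p hp
    have h1 : χ =ᶠ[𝓝 p] fun _ => 0 := notMem_tsupport_iff_eventuallyEq.1 hp
    refine ⟨h1.eq_of_nhds, ?_⟩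
    exact (diff_congr h1 _).trans (diff_const 0 p _)
  have hcont : Continuous fun p => χ p * d p + diff (n := n) χ p (Y p) :=
    (hχ.continuous.mul hd).add
      (contMDiff_diff hχ fun x => hY x _ (ext_mem_target x)).continuous
  rw [integral_densityMeasure x (fun z hz => (hσ z hz).continuousAt.continuousWithinAt) hσ0
    hcont.measurable (fun p hp => by
      obtain ⟨h1, h2⟩ := hχ0 p fun h => hp (hχs h)
      rw [h1, h2]; simp)]
  set T := (extChartAt (I n) x).target with hT
  set K := extChartAt (I n) x '' tsupport χ with hK
  have hKc : IsCompact K := (isClosed_tsupport χ).isCompact.image_of_continuousOn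
    ((continuousOn_extChartAt x).mono hχs)
  have hKT : K ⊆ T := by
    rintro _ ⟨p, hp, rfl⟩
    exact (extChartAt (I n) x).map_source (hχs hp)
  have hχK : ∀ z ∈ T, z ∉ K → (extChartAt (I n) x).symm z ∉ tsupport χ := by
    intro z hz hzK h
    exact hzK ⟨_, h, (extChartAt (I n) x).right_inv hz⟩
  classical
  -- The cut-off density field lives on the chart target. Extended by zero it is smooth on the whole
  -- model space, because the support of `χ` has compact image inside the target.
  set W : E n → E n := fun z => χ ((extChartAt (I n) x).symm z) •
    (chartDensity (n := n) σ x z • fieldRep x Y z) with hW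
  set W' : E n → E n := T.indicator W with hW'
  have hWT : ∀ z ∈ T, W' =ᶠ[𝓝 z] W := fun z hz => by
    filter_upwards [target_mem_nhds hz] with y hy
    exact indicator_of_mem hy W
  have hWK : ∀ z ∉ K, W' =ᶠ[𝓝 z] fun _ => 0 := fun z hz => by
    filter_upwards [hKc.isClosed.isOpen_compl.mem_nhds hz] with y hy
    by_cases hyT : y ∈ T
    · rw [hW', indicator_of_mem hyT]
      simp only [hW, (hχ0 _ (hχK y hyT hy)).1, zero_smul]
    · exact indicator_of_notMem hyT W
  have hWs : ContDiff ℝ ∞ W' := by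
    rw [contDiff_iff_contDiffAt]
    intro z
    by_cases hz : z ∈ T
    · exact ((contDiffAt_rep hχ hz).smul ((hσ z hz).smul (hY x z hz))).congr_of_eventuallyEq (hWT z hz)
    · exact contDiffAt_const.congr_of_eventuallyEq (hWK z fun h => hz (hKT h))
  have hWc : HasCompactSupport W' :=
    HasCompactSupport.intro hKc fun z hz => (hWK z hz).eq_of_nhds
  have e : ∫ z, divE W' z = ∫ z in T, divE W' z := by
    refine (setIntegral_eq_integral_of_forall_compl_eq_zero fun z hz => ?_).symm
    rw [divE_congr (hWK z fun h => hz (hKT h))]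
    simp [divE]
  rw [← integral_divE_eq_zero (hWs.of_le (by simp)) hWc, e]
  refine setIntegral_congr_fun (isOpen_target x).measurableSet fun z hz => ?_
  have h5 : divE W z = fderiv ℝ (fun q => χ ((extChartAt (I n) x).symm q)) z
      (chartDensity (n := n) σ x z • fieldRep x Y z) + χ ((extChartAt (I n) x).symm z) *
        divE (fun y => chartDensity (n := n) σ x y • fieldRep x Y y) z :=
    divE_smul (Z := fun y => chartDensity (n := n) σ x y • fieldRep x Y y)
      ((contDiffAt_rep hχ hz).differentiableAt (by simp))
      (((hσ z hz).smul (hY x z hz)).differentiableAt (by simp))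
  have h6 := diff_field hχ Y hz
  rw [divE_congr (hWT z hz), h5, ← hdiv z hz, map_smul, smul_eq_mul]
  beta_reduce
  rw [h6]
  ring

/-- The divergence theorem on a closed manifold. -/
theorem integral_divergence {σ : M → ℝ} {Y : M → E n} {d : M → ℝ}
    (hσ : ∀ x : M, ∀ z ∈ (extChartAt (I n) x).target, ContDiffAt ℝ ∞ (chartDensity (n := n) σ x) z)
    (hσ0 : ∀ p, 0 ≤ σ p)
    (hY : ∀ x : M, ∀ z ∈ (extChartAt (I n) x).target, ContDiffAt ℝ ∞ (fieldRep x Y) z)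
    (hd : Continuous d)
    (hdiv : ∀ x : M, ∀ z ∈ (extChartAt (I n) x).target, chartDensity (n := n) σ x z *
      d ((extChartAt (I n) x).symm z) =
        divE (fun y => chartDensity (n := n) σ x y • fieldRep x Y y) z) :
    ∫ p, d p ∂(densityMeasure n σ) = 0 := by
  obtain ⟨t, ht⟩ := CompactSpace.elim_nhds_subcover (fun x : M => (extChartAt (I n) x).source)
    (fun x => extChartAt_source_mem_nhds x)
  obtain ⟨ρ, hρ⟩ := SmoothPartitionOfUnity.exists_isSubordinate (I n) (isClosed_univ (X := M))
    (fun i : t => (extChartAt (I n) (i : M)).source) (fun i => isOpen_extChartAt_source _) (by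
      rw [← top_eq_univ, ← ht]
      intro y hy
      simp only [mem_iUnion] at hy ⊢
      obtain ⟨x, hx, hy⟩ := hy
      exact ⟨⟨x, hx⟩, hy⟩)
  have hsum : ∀ p, ∑ i, ρ i p = 1 := fun p => by
    rw [← finsum_eq_sum_of_fintype]; exact ρ.sum_eq_one (mem_univ p)
  have hρs : ∀ i, ContMDiff (I n) 𝓘(ℝ, ℝ) ∞ (ρ i) := fun i => (ρ i).contMDiff
  -- The partition functions sum to 1, so their derivatives along `Y` sum to 0. Hence `d` is the sum
  -- of the localized terms `ρ i * d + Y (ρ i)`, each of which integrates to zero.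
  have hdsum : ∀ p, ∑ i, diff (n := n) (ρ i) p (Y p) = 0 := fun p => by
    rw [← sum_diff hρs]
    simp only [hsum]
    exact diff_const 1 p _
  have := isFiniteMeasure_densityMeasure (n := n) (σ := σ)
    fun x z hz => (hσ x z hz).continuousAt.continuousWithinAt
  have h1 : ∀ p, d p = ∑ i, (ρ i p * d p + diff (n := n) (ρ i) p (Y p)) := fun p => by
    rw [Finset.sum_add_distrib, hdsum, ← Finset.sum_mul, hsum]; ring
  rw [integral_congr_ae (Eventually.of_forall h1), integral_finsetSum]
  · exact Finset.sum_eq_zero fun i _ =>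
      integral_divergence_of_tsupport_subset (i : M) (hσ i) hσ0 hY hd (hρs i) (hρ i) (hdiv i)
  · intro i _
    have hcont : Continuous fun p => ρ i p * d p + diff (n := n) (ρ i) p (Y p) :=
      ((hρs i).continuous.mul hd).add
        (contMDiff_diff (hρs i) fun x => hY x _ (ext_mem_target x)).continuous
    exact hcont.integrable_of_hasCompactSupport (HasCompactSupport.of_compactSpace _)

end Divergence

/-! ### Smooth one-parameter families: uniform Taylor expansion and differentiation under the
integral. -/

section Families

/-- The mean value inequality applied twice, first to `g'` and then to `g` minus its tangent. The
sharp factor one half in the remainder is not needed. -/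
theorem abs_sub_sub_le_of_second_deriv {g g' g'' : ℝ → ℝ} {t₀ δ C : ℝ}
    (h1 : ∀ s ∈ Ioo (t₀ - δ) (t₀ + δ), HasDerivAt g (g' s) s)
    (h2 : ∀ s ∈ Ioo (t₀ - δ) (t₀ + δ), HasDerivAt g' (g'' s) s)
    (h3 : ∀ s ∈ Ioo (t₀ - δ) (t₀ + δ), |g'' s| ≤ C) {t : ℝ} (ht : t ∈ Ioo (t₀ - δ) (t₀ + δ)) :
    |g t - g t₀ - (t - t₀) * g' t₀| ≤ C * (t - t₀) ^ 2 := by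
  have ht₀ : t₀ ∈ Ioo (t₀ - δ) (t₀ + δ) := by
    have := ht.1.trans ht.2
    constructor <;> linarith
  have hC : 0 ≤ C := (abs_nonneg _).trans (h3 t₀ ht₀)
  have hsub : uIcc t₀ t ⊆ Ioo (t₀ - δ) (t₀ + δ) := ordConnected_Ioo.uIcc_subset ht₀ ht
  have hg' : ∀ s ∈ uIcc t₀ t, |g' s - g' t₀| ≤ C * |t - t₀| := by
    intro s hs
    have h4 := (convex_Ioo (t₀ - δ) (t₀ + δ)).norm_image_sub_le_of_norm_hasDerivWithin_le
      (fun s hs => (h2 s hs).hasDerivWithinAt) (fun s hs => h3 s hs) ht₀ (hsub hs)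
    refine h4.trans (mul_le_mul_of_nonneg_left ?_ hC)
    exact abs_sub_left_of_mem_uIcc hs
  have h5 := (convex_uIcc t₀ t).norm_image_sub_le_of_norm_hasDerivWithin_le
    (f := fun s => g s - s * g' t₀) (f' := fun s => g' s - g' t₀) (C := C * |t - t₀|)
    (fun s hs => (((h1 s (hsub hs)).sub ((hasDerivAt_id s).mul_const (g' t₀))).congr_deriv
      (by simp)).hasDerivWithinAt) (fun s hs => hg' s hs) left_mem_uIcc right_mem_uIcc
  simp only [Real.norm_eq_abs] at h5
  calc |g t - g t₀ - (t - t₀) * g' t₀| = |g t - t * g' t₀ - (g t₀ - t₀ * g' t₀)| := by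
        congr 1; ring
    _ ≤ C * |t - t₀| * |t - t₀| := h5
    _ = C * (t - t₀) ^ 2 := by rw [mul_assoc, ← sq, sq_abs]

/-- The partial derivative in the real variable. -/
def timeDeriv {F G : Type*} [NormedAddCommGroup F] [NormedSpace ℝ F] [NormedAddCommGroup G]
    [NormedSpace ℝ G] (f : ℝ × F → G) (p : ℝ × F) : G := fderiv ℝ f p (1, 0)

section
variable {F G : Type*} [NormedAddCommGroup F] [NormedSpace ℝ F] [NormedAddCommGroup G]
    [NormedSpace ℝ G]

theorem contDiffAt_timeDeriv {f : ℝ × F → G} {p : ℝ × F} (h : ContDiffAt ℝ ∞ f p) :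
    ContDiffAt ℝ ∞ (timeDeriv f) p :=
  (contDiffAt_fderiv h).clm_apply contDiffAt_const

theorem hasDerivAt_timeDeriv {f : ℝ × F → G} {t : ℝ} {z : F}
    (h : DifferentiableAt ℝ f (t, z)) : HasDerivAt (fun s => f (s, z)) (timeDeriv f (t, z)) t :=
  h.hasFDerivAt.comp_hasDerivAt t ((hasDerivAt_id t).prodMk (hasDerivAt_const t z))

theorem eventually_differentiableAt {f : F → G} {p : F} (h : ContDiffAt ℝ ∞ f p) :
    ∀ᶠ q in 𝓝 p, DifferentiableAt ℝ f q := by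
  have := (h.of_le (m := 1) (by simp)).eventually (by simp)
  exact this.mono fun q hq => hq.differentiableAt (by simp)

/-- The second time derivative is continuous at the base point, hence bounded on a product
neighbourhood, which makes the remainder uniform in the space variable. -/
theorem local_taylor {f : ℝ × F → ℝ} {t₀ : ℝ} {z₀ : F} (h : ContDiffAt ℝ ∞ f (t₀, z₀)) :
    ∃ C δ : ℝ, 0 < δ ∧ ∃ V ∈ 𝓝 z₀, ∀ t ∈ Ioo (t₀ - δ) (t₀ + δ), ∀ z ∈ V,
      |f (t, z) - f (t₀, z) - (t - t₀) * timeDeriv f (t₀, z)| ≤ C * (t - t₀) ^ 2 := by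
  have h2 := contDiffAt_timeDeriv h
  have h3 := (contDiffAt_timeDeriv h2).continuousAt
  have h4 : ∀ᶠ p in 𝓝 (t₀, z₀), |timeDeriv (timeDeriv f) p| ≤
      |timeDeriv (timeDeriv f) (t₀, z₀)| + 1 := by
    filter_upwards [h3.abs.eventually_lt_const (lt_add_one _)] with p hp using hp.le
  have h5 := ((eventually_differentiableAt h).and (eventually_differentiableAt h2)).and h4
  rw [nhds_prod_eq, eventually_prod_iff] at h5
  obtain ⟨pa, hpa, pb, hpb, hp⟩ := h5
  obtain ⟨δ, hδ, hδ'⟩ := Metric.eventually_nhds_iff.1 hpa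
  refine ⟨|timeDeriv (timeDeriv f) (t₀, z₀)| + 1, δ, hδ, {z | pb z}, hpb, fun t ht z hz => ?_⟩
  have hball : ∀ s ∈ Ioo (t₀ - δ) (t₀ + δ), pa s := fun s hs => hδ' (by
    rw [Real.dist_eq, abs_lt]; constructor <;> linarith [hs.1, hs.2])
  exact abs_sub_sub_le_of_second_deriv (g := fun s => f (s, z))
    (g' := fun s => timeDeriv f (s, z)) (g'' := fun s => timeDeriv (timeDeriv f) (s, z))
    (fun s hs => hasDerivAt_timeDeriv (hp (hball s hs) hz).1.1)
    (fun s hs => hasDerivAt_timeDeriv (hp (hball s hs) hz).1.2)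
    (fun s hs => (hp (hball s hs) hz).2) ht

theorem fderiv_slice {f : ℝ × F → G} {s : ℝ} {z : F} (h : DifferentiableAt ℝ f (s, z)) (v : F) :
    fderiv ℝ (fun y => f (s, y)) z v = fderiv ℝ f (s, z) (0, v) := by
  have h1 := (h.hasFDerivAt.comp z ((hasFDerivAt_const s z).prodMk (hasFDerivAt_id z))).fderiv
  exact DFunLike.congr_fun h1 v

/-- Derivatives in the parameter commute with derivatives in the other variable. -/
theorem hasDerivAt_fderiv_family {f : ℝ × F → G} {t : ℝ} {z : F} (h : ContDiffAt ℝ ∞ f (t, z))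
    (v : F) : HasDerivAt (fun s => fderiv ℝ (fun y => f (s, y)) z v)
      (fderiv ℝ (fun y => timeDeriv f (t, y)) z v) t := by
  have hsymm := (h.isSymmSndFDerivAt
    (by rw [minSmoothness_of_isRCLikeNormedField]; exact ENat.LEInfty.out)).eq
  have hd : DifferentiableAt ℝ (fderiv ℝ f) (t, z) :=
    (contDiffAt_fderiv h).differentiableAt (by simp)
  have hev : (fun s => fderiv ℝ (fun y => f (s, y)) z v) =ᶠ[𝓝 t]
      fun s => fderiv ℝ f (s, z) (0, v) := by
    have hc : ContinuousAt (fun s : ℝ => (s, z)) t := by fun_prop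
    filter_upwards [hc.eventually (eventually_differentiableAt h)] with s hs using fderiv_slice hs v
  refine HasDerivAt.congr_of_eventuallyEq ?_ hev
  have h3 : HasDerivAt (fun s => fderiv ℝ f (s, z) (0, v))
      (fderiv ℝ (fderiv ℝ f) (t, z) (1, 0) (0, v)) t := by
    have h4 := hd.hasFDerivAt.comp_hasDerivAt t ((hasDerivAt_id t).prodMk (hasDerivAt_const t z))
    exact h4.clm_apply (hasDerivAt_const t (0, v)) |>.congr_deriv (by simp)
  refine h3.congr_deriv ?_
  rw [fderiv_slice ((contDiffAt_timeDeriv h).differentiableAt (by simp)), hsymm]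
  have h5 := (hd.hasFDerivAt.clm_apply (hasFDerivAt_const ((1 : ℝ), (0 : F)) (t, z))).fderiv
  have h6 : fderiv ℝ (timeDeriv f) (t, z) = _ := h5
  rw [h6]
  simp

end

variable {n : ℕ} {M : Type*} [TopologicalSpace M] [ChartedSpace (E n) M] [IsManifold (I n) ∞ M]

/-- The family of functions `F t` on `M` is jointly smooth near `{t₀} × M`. -/
def JointSmoothAt (n : ℕ) {M : Type*} [TopologicalSpace M] [ChartedSpace (E n) M]
    (F : ℝ → M → ℝ) (t₀ : ℝ) : Prop :=
  ∀ x : M, ContDiffAt ℝ ∞ (fun p : ℝ × E n => F p.1 ((extChartAt (I n) x).symm p.2))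
    (t₀, extChartAt (I n) x x)

omit [IsManifold (I n) ∞ M] in
theorem JointSmoothAt.contMDiff {F : ℝ → M → ℝ} {t₀ : ℝ} (h : JointSmoothAt n F t₀) :
    ContMDiff (I n) 𝓘(ℝ, ℝ) ∞ (F t₀) := fun x =>
  contMDiffAt_of_rep ((h x).comp (extChartAt (I n) x x) (contDiffAt_const.prodMk contDiffAt_id))

omit [IsManifold (I n) ∞ M] in
theorem timeDeriv_eq {F : ℝ → M → ℝ} {F' : M → ℝ} {t₀ : ℝ}
    (h' : ∀ x, HasDerivAt (fun t => F t x) (F' x) t₀) {x : M} {z : E n}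
    (h : DifferentiableAt ℝ (fun p : ℝ × E n => F p.1 ((extChartAt (I n) x).symm p.2)) (t₀, z)) :
    timeDeriv (fun p : ℝ × E n => F p.1 ((extChartAt (I n) x).symm p.2)) (t₀, z) =
      F' ((extChartAt (I n) x).symm z) :=
  (hasDerivAt_timeDeriv h).unique (h' ((extChartAt (I n) x).symm z))

omit [IsManifold (I n) ∞ M] in
theorem JointSmoothAt.eventually_timeDeriv_eq {F : ℝ → M → ℝ} {F' : M → ℝ} {t₀ : ℝ}
    (h : JointSmoothAt n F t₀) (h' : ∀ x, HasDerivAt (fun t => F t x) (F' x) t₀) (x : M) :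
    ∀ᶠ z in 𝓝 (extChartAt (I n) x x),
      timeDeriv (fun p : ℝ × E n => F p.1 ((extChartAt (I n) x).symm p.2)) (t₀, z) =
        F' ((extChartAt (I n) x).symm z) := by
  have hc : ContinuousAt (fun z : E n => (t₀, z)) (extChartAt (I n) x x) := by fun_prop
  filter_upwards [hc.eventually (eventually_differentiableAt (h x))] with z hz
  exact timeDeriv_eq h' hz

omit [IsManifold (I n) ∞ M] in
theorem JointSmoothAt.contMDiff_deriv {F : ℝ → M → ℝ} {F' : M → ℝ} {t₀ : ℝ}
    (h : JointSmoothAt n F t₀) (h' : ∀ x, HasDerivAt (fun t => F t x) (F' x) t₀) :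
    ContMDiff (I n) 𝓘(ℝ, ℝ) ∞ F' := fun x => by
  refine contMDiffAt_of_rep (ContDiffAt.congr_of_eventuallyEq ?_
    ((h.eventually_timeDeriv_eq h' x).mono fun z hz => hz.symm))
  exact (contDiffAt_timeDeriv (h x)).comp (extChartAt (I n) x x)
    (contDiffAt_const.prodMk contDiffAt_id)

variable [CompactSpace M]

omit [IsManifold (I n) ∞ M] in
/-- The first order Taylor expansion of a smooth family of functions is uniform. -/
theorem JointSmoothAt.taylor {F : ℝ → M → ℝ} {F' : M → ℝ} {t₀ : ℝ}
    (h : JointSmoothAt n F t₀) (h' : ∀ x, HasDerivAt (fun t => F t x) (F' x) t₀) :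
    ∃ C δ : ℝ, 0 < δ ∧ ∀ t : ℝ, |t - t₀| < δ → ∀ x : M,
      |F t x - F t₀ x - (t - t₀) * F' x| ≤ C * (t - t₀) ^ 2 := by
  have hloc : ∀ x : M, ∃ C δ : ℝ, 0 < δ ∧ ∃ U ∈ 𝓝 x, ∀ t : ℝ, |t - t₀| < δ → ∀ y ∈ U,
      |F t y - F t₀ y - (t - t₀) * F' y| ≤ C * (t - t₀) ^ 2 := by
    intro x
    obtain ⟨C, δ, hδ, V, hV, hT⟩ := local_taylor (h x)
    refine ⟨C, δ, hδ, _, Filter.inter_mem (extChartAt_source_mem_nhds (I := I n) x)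
      ((continuousAt_extChartAt (I := I n) x).preimage_mem_nhds
        (Filter.inter_mem hV (h.eventually_timeDeriv_eq h' x))), fun t ht y hy => ?_⟩
    have h1 := hT t (by rw [abs_lt] at ht; constructor <;> linarith [ht.1, ht.2]) _ hy.2.1
    have h2 := hy.2.2
    simp only [mem_ofPred_eq] at h2
    rw [h2] at h1
    simpa only [(extChartAt (I n) x).left_inv hy.1] using h1
  choose C δ hδ U hU hT using hloc
  obtain ⟨t, ht⟩ := CompactSpace.elim_nhds_subcover U hU
  rcases t.eq_empty_or_nonempty with rfl | hne
  · refine ⟨0, 1, one_pos, fun s _ x => ?_⟩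
    have : x ∈ (⊤ : Set M) := mem_univ x
    rw [← ht] at this
    simp at this
  -- Finite subcover: the smallest of the time radii, and a constant above all local ones. Absolute
  -- values appear because no sign was recorded for the local constants.
  · refine ⟨∑ x ∈ t, |C x|, t.inf' hne δ, (Finset.lt_inf'_iff hne).2 fun x _ => hδ x,
      fun s hs y => ?_⟩
    have : y ∈ (⊤ : Set M) := mem_univ y
    rw [← ht] at this
    simp only [mem_iUnion] at this
    obtain ⟨x, hx, hy⟩ := this
    refine (hT x s (hs.trans_le (Finset.inf'_le _ hx)) y hy).trans ?_
    gcongr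
    exact (le_abs_self _).trans (Finset.single_le_sum (f := fun x => |C x|)
      (fun _ _ => abs_nonneg _) hx)

theorem hasDerivAt_of_quadratic {f : ℝ → ℝ} {d t₀ C : ℝ}
    (h : ∀ᶠ t in 𝓝 t₀, |f t - f t₀ - (t - t₀) * d| ≤ C * (t - t₀) ^ 2) : HasDerivAt f d t₀ := by
  rw [hasDerivAt_iff_isLittleO]
  have h1 : (fun t => f t - f t₀ - (t - t₀) • d) =O[𝓝 t₀] fun t => (t - t₀) ^ 2 := by
    refine Asymptotics.IsBigO.of_bound C (h.mono fun t ht => ?_)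
    rw [Real.norm_eq_abs, Real.norm_eq_abs, abs_of_nonneg (sq_nonneg (t - t₀))]
    exact ht
  refine h1.trans_isLittleO ?_
  have h2 : (fun t : ℝ => (t - t₀) * (t - t₀)) =o[𝓝 t₀] fun t => (t - t₀) * 1 := by
    refine (Asymptotics.isBigO_refl _ _).mul_isLittleO ?_
    rw [Asymptotics.isLittleO_one_iff]
    have : ContinuousAt (fun t : ℝ => t - t₀) t₀ := by fun_prop
    simpa [ContinuousAt] using this
  simpa [sq] using h2

variable [MeasurableSpace M] [BorelSpace M]

omit [CompactSpace M] in
theorem integrable_of_continuous [CompactSpace M] {m : Measure M} [IsFiniteMeasure m] {f : M → ℝ}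
    (hf : Continuous f) : Integrable f m :=
  hf.integrable_of_hasCompactSupport (HasCompactSupport.of_compactSpace f)

omit [IsManifold (I n) ∞ M] in
/-- Differentiation under the integral sign. -/
theorem JointSmoothAt.hasDerivAt_integral {m : Measure M} [IsFiniteMeasure m] {F : ℝ → M → ℝ}
    {F' : M → ℝ} {t₀ : ℝ} (h : JointSmoothAt n F t₀)
    (h' : ∀ x, HasDerivAt (fun t => F t x) (F' x) t₀) (hc : ∀ᶠ t in 𝓝 t₀, Continuous (F t)) :
    HasDerivAt (fun t => ∫ x, F t x ∂m) (∫ x, F' x ∂m) t₀ := by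
  obtain ⟨C, δ, hδ, hT⟩ := h.taylor h'
  refine hasDerivAt_of_quadratic (C := C * m.real univ) ?_
  filter_upwards [hc, Metric.ball_mem_nhds t₀ hδ] with t ht htδ
  have hF' := integrable_of_continuous (m := m) (h.contMDiff_deriv h').continuous
  have hF0 := integrable_of_continuous (m := m) h.contMDiff.continuous
  have hFt := integrable_of_continuous (m := m) ht
  have h1 : ∫ x, F t x ∂m - ∫ x, F t₀ x ∂m - (t - t₀) * ∫ x, F' x ∂m =
      ∫ x, (F t x - F t₀ x - (t - t₀) * F' x) ∂m := by
    rw [integral_sub (f := fun x => F t x - F t₀ x) (hFt.sub hF0) (hF'.const_mul _),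
      integral_sub hFt hF0, integral_const_mul]
  rw [h1]
  have := norm_integral_le_of_norm_le_const (μ := m)
    (f := fun x => F t x - F t₀ x - (t - t₀) * F' x) (Eventually.of_forall (hT t htδ))
  calc _ ≤ C * (t - t₀) ^ 2 * m.real univ := this
    _ = _ := by ring

end Families

/-! ### The volume density of a 1-form. -/

section ContactForms

variable {n : ℕ} {M : Type*} [TopologicalSpace M] [ChartedSpace (E n) M]

/-- The 1-form `α` is smooth in the preferred charts. -/
def SmoothForm (α : M → E n →L[ℝ] ℝ) : Prop :=
  ∀ x : M, ∀ z ∈ (extChartAt (I n) x).target, ContDiffAt ℝ ∞ (formRep x α) z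

/-- The bilinear form `dα + α ⊗ α` at a point. -/
def contactB (α : M → E n →L[ℝ] ℝ) (p : M) : LinearMap.BilinForm ℝ (E n) :=
  formB (formRep p α) (extChartAt (I n) p p)

/-- The volume density of the 1-form `α` with respect to the preferred chart at each point. -/
def contactDensity (α : M → E n →L[ℝ] ℝ) (p : M) : ℝ := √|bdet (contactB α p)|

theorem contactDensity_nonneg (α : M → E n →L[ℝ] ℝ) (p : M) : 0 ≤ contactDensity α p :=
  Real.sqrt_nonneg _

theorem contactDensity_pos {α : M → E n →L[ℝ] ℝ} {p : M} (h : bdet (contactB α p) ≠ 0) :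
    0 < contactDensity α p := Real.sqrt_pos.2 (abs_pos.2 h)

variable [IsManifold (I n) ∞ M]

omit [IsManifold (I n) ∞ M] in
theorem SmoothForm.differentiableAt {α : M → E n →L[ℝ] ℝ} (hα : SmoothForm α) {x : M} {z : E n}
    (hz : z ∈ (extChartAt (I n) x).target) : DifferentiableAt ℝ (formRep x α) z :=
  (hα x z hz).differentiableAt (by simp)

theorem contactB_apply {α : M → E n →L[ℝ] ℝ} (hα : SmoothForm α) (p : M) (v w : E n) :
    contactB α p v w = extDeriv₁ α p v w + α p v * α p w := by
  rw [contactB, formB_apply, extDeriv₁_eq (hα.differentiableAt (ext_mem_target p)), formRep_self]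

theorem formB_formRep {α : M → E n →L[ℝ] ℝ} (hα : SmoothForm α) {x : M} {z : E n}
    (hz : z ∈ (extChartAt (I n) x).target) (v w : E n) :
    formB (formRep x α) z v w =
      contactB α ((extChartAt (I n) x).symm z) (frame x z v) (frame x z w) := by
  rw [contactB_apply hα, extDeriv₁_frame hz (hα.differentiableAt hz), formB_apply]
  rfl

/-- In another frame the determinant picks up the square of the frame determinant. Its square root
therefore transforms as a density, which makes the chart measures of `contactDensity` compatible. -/
theorem bdet_formB_formRep {α : M → E n →L[ℝ] ℝ} (hα : SmoothForm α) {x : M} {z : E n}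
    (hz : z ∈ (extChartAt (I n) x).target) :
    bdet (formB (formRep x α) z) =
      (frame x z).det ^ 2 * bdet (contactB α ((extChartAt (I n) x).symm z)) := by
  have h : formB (formRep x α) z = (contactB α ((extChartAt (I n) x).symm z)).comp
      (frame x z : E n →ₗ[ℝ] E n) (frame x z : E n →ₗ[ℝ] E n) := by
    ext v w
    exact formB_formRep hα hz v w
  rw [h, bdet_comp]

theorem bdet_formB_formRep_ne_zero {α : M → E n →L[ℝ] ℝ} (hα : SmoothForm α)
    (h : ∀ p, bdet (contactB α p) ≠ 0) {x : M} {z : E n}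
    (hz : z ∈ (extChartAt (I n) x).target) : bdet (formB (formRep x α) z) ≠ 0 := by
  rw [bdet_formB_formRep hα hz]
  exact mul_ne_zero (pow_ne_zero 2 (frame_det_ne_zero hz)) (h _)

theorem chartDensity_contactDensity {α : M → E n →L[ℝ] ℝ} (hα : SmoothForm α) {x : M} {z : E n}
    (hz : z ∈ (extChartAt (I n) x).target) :
    chartDensity (contactDensity α) x z = √|bdet (formB (formRep x α) z)| := by
  rw [bdet_formB_formRep hα hz, abs_mul, abs_of_nonneg (sq_nonneg _), Real.sqrt_mul (sq_nonneg _),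
    Real.sqrt_sq_eq_abs]
  rfl

theorem contDiffAt_chartDensity {α : M → E n →L[ℝ] ℝ} (hα : SmoothForm α)
    (h : ∀ p, bdet (contactB α p) ≠ 0) {x : M} {z : E n}
    (hz : z ∈ (extChartAt (I n) x).target) :
    ContDiffAt ℝ ∞ (chartDensity (contactDensity α) x) z := by
  refine ContDiffAt.congr_of_eventuallyEq (contDiffAt_sqrt_abs (contDiffAt_bdet_formB (hα x z hz))
    (bdet_formB_formRep_ne_zero hα h hz)) ?_
  filter_upwards [target_mem_nhds hz] with y hy
  exact chartDensity_contactDensity hα hy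

theorem continuousOn_chartDensity {α : M → E n →L[ℝ] ℝ} (hα : SmoothForm α)
    (h : ∀ p, bdet (contactB α p) ≠ 0) (x : M) :
    ContinuousOn (chartDensity (contactDensity α) x) (extChartAt (I n) x).target := fun _ hz =>
  (contDiffAt_chartDensity hα h hz).continuousAt.continuousWithinAt

omit [IsManifold (I n) ∞ M] in
/-- The Riemannian measure of a field of bilinear forms, in terms of determinants in the frames of
the preferred charts. -/
theorem riemannianMeasure_eq [MeasurableSpace M] [BorelSpace M] (G : M → LinearMap.BilinForm ℝ (E n)) :
    riemannianMeasure (fun p v w => G p v w) = densityMeasure n fun p => √(bdet (G p)) := by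
  refine iSup_congr fun x => ?_
  rw [chartMeasure, chartDensityMeasure]
  congr 1
  refine withDensity_congr_ae ?_
  refine (ae_restrict_iff' (isOpen_target x).measurableSet).2 (Eventually.of_forall fun z hz => ?_)
  have h : (gram (fun p v w => G p v w) x z).det =
      (frame x z).det ^ 2 * bdet (G ((extChartAt (I n) x).symm z)) := by
    have h1 := bdet_comp (G ((extChartAt (I n) x).symm z)) (frame x z : E n →ₗ[ℝ] E n)
    refine Eq.trans ?_ h1
    rw [bdet]
    congr 1
    ext i j
    simp only [bmat_apply, gram, Matrix.of_apply, OrthonormalBasis.coe_toBasis]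
    rfl
  beta_reduce
  rw [h, Real.sqrt_mul (sq_nonneg _), Real.sqrt_sq_eq_abs]
  rfl

end ContactForms

/-! ### Pointwise identities of a Sasakian structure and its measure. -/

namespace SasakianStructure

variable {n : ℕ} {M : Type*} [TopologicalSpace M] [ChartedSpace (E n) M] [IsManifold (I n) ∞ M]
  (S : SasakianStructure n M)

/-- The Reeb field, with values in the model space. -/
def xi (p : M) : E n := S.ξ p

/-- The contact form, with arguments in the model space. -/
def eta (p : M) : E n →L[ℝ] ℝ := S.η p

/-- The tensor `Φ`, on the model space. -/
def phi (p : M) : E n →L[ℝ] E n := S.Φ p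

/-- The metric as a bilinear form on the model space. -/
def gB (p : M) : LinearMap.BilinForm ℝ (E n) :=
  LinearMap.mk₂ ℝ (fun v w => S.g.inner p v w)
    (fun v v' w => congrArg (fun L : E n →L[ℝ] ℝ => L w) ((S.g.inner p).map_add v v'))
    (fun c v w => congrArg (fun L : E n →L[ℝ] ℝ => L w) ((S.g.inner p).map_smul c v))
    (fun v w w' => (S.g.inner p v).map_add w w')
    (fun c v w => (S.g.inner p v).map_smul c w)

theorem gB_symm (p : M) (v w : E n) : S.gB p v w = S.gB p w v := S.g.symm p v w

theorem gB_pos (p : M) (v : E n) (hv : v ≠ 0) : 0 < S.gB p v v := S.g.pos p v hv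

theorem eta_xi (p : M) : S.eta p (S.xi p) = 1 := S.η_ξ p

theorem phi_phi (p : M) (v : E n) : S.phi p (S.phi p v) = -v + S.eta p v • S.xi p := S.Φ_sq p v

theorem gB_phi_phi (p : M) (v w : E n) :
    S.gB p (S.phi p v) (S.phi p w) = S.gB p v w - S.eta p v * S.eta p w := S.g_compat p v w

theorem extDeriv₁_eta (p : M) (v w : E n) : extDeriv₁ S.eta p v w = S.gB p (S.phi p v) w :=
  (S.contact p v w).symm

theorem smoothForm_eta : SmoothForm S.eta := fun _ _ hz => contDiffAt_formRep S.smooth_η hz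

/-- From Φ² = -1 + η ⊗ ξ one has Φ²ξ = 0, and the same identity at Φξ gives Φξ = cξ with c = η(Φξ).
Then Φ²ξ = c²ξ, so c = 0. -/
theorem phi_xi (p : M) : S.phi p (S.xi p) = 0 := by
  have h1 : S.phi p (S.phi p (S.xi p)) = 0 := by rw [phi_phi, eta_xi]; simp
  have h2 := S.phi_phi p (S.phi p (S.xi p))
  rw [h1, map_zero] at h2
  have h3 : S.phi p (S.xi p) = S.eta p (S.phi p (S.xi p)) • S.xi p := by
    rw [eq_comm, neg_add_eq_zero] at h2; exact h2
  have h4 : S.eta p (S.phi p (S.xi p)) * S.eta p (S.phi p (S.xi p)) = 0 := by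
    have h5 := congrArg (S.eta p) h1
    rw [h3, map_smul, h3, map_smul, map_smul, map_zero] at h5
    simpa [eta_xi] using h5
  rw [h3, mul_self_eq_zero.1 h4, zero_smul]

/-- Compare the two ways of expanding Φ³v, using Φξ = 0. -/
theorem eta_phi (p : M) (v : E n) : S.eta p (S.phi p v) = 0 := by
  have h1 := S.phi_phi p (S.phi p v)
  rw [S.phi_phi p v, map_add, map_neg, map_smul, phi_xi, smul_zero, add_zero, left_eq_add] at h1
  simpa [eta_xi] using congrArg (S.eta p) h1

theorem gB_xi (p : M) (v : E n) : S.gB p v (S.xi p) = S.eta p v := by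
  have := S.gB_phi_phi p v (S.xi p)
  rw [phi_xi, map_zero, eta_xi] at this
  linarith

theorem extDeriv₁_eta_phi (p : M) (v w : E n) :
    extDeriv₁ S.eta p v (S.phi p w) = S.gB p v w - S.eta p v * S.eta p w := by
  rw [extDeriv₁_eta, gB_phi_phi]

theorem extDeriv₁_eta_xi (p : M) (v : E n) : extDeriv₁ S.eta p v (S.xi p) = 0 := by
  rw [extDeriv₁_eta, gB_xi, eta_phi]

theorem extDeriv₁_xi_eta (p : M) (v : E n) : extDeriv₁ S.eta p (S.xi p) v = 0 := by
  rw [extDeriv₁_eta, phi_xi, map_zero]; rfl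

theorem contactB_xi (p : M) (v : E n) : contactB S.eta p v (S.xi p) = S.eta p v := by
  rw [contactB_apply S.smoothForm_eta, extDeriv₁_eta_xi, eta_xi]; ring

theorem contactB_xi_left (p : M) (v : E n) : contactB S.eta p (S.xi p) v = S.eta p v := by
  rw [contactB_apply S.smoothForm_eta, extDeriv₁_xi_eta, eta_xi]; ring

theorem bdet_gB_pos (p : M) : 0 < bdet (S.gB p) := bdet_pos (S.gB_symm p) (S.gB_pos p)

/-- The tensor Φ drops out: the Riemannian density of a Sasakian metric is a function of the contact
form and its differential only. All variations of volume below are variations of contact forms. -/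
theorem bdet_gB (p : M) : bdet (S.gB p) = |bdet (contactB S.eta p)| := by
  rw [← abs_of_pos (S.bdet_gB_pos p)]
  refine abs_bdet_of_almost_contact (P := (S.phi p : E n →ₗ[ℝ] E n))
    (η := (S.eta p : E n →ₗ[ℝ] ℝ)) (S.eta_xi p) (S.phi_phi p) (S.eta_phi p) (S.contactB_xi p)
    fun v w => ?_
  change S.gB p v w = contactB S.eta p v (S.phi p w) + S.eta p v * S.eta p w
  rw [contactB_apply S.smoothForm_eta, extDeriv₁_eta_phi, eta_phi]
  ring

theorem bdet_contactB_ne_zero (p : M) : bdet (contactB S.eta p) ≠ 0 :=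
  abs_pos.1 (S.bdet_gB p ▸ S.bdet_gB_pos p)

theorem contactDensity_eta (p : M) : contactDensity S.eta p = √(bdet (S.gB p)) := by
  rw [contactDensity, bdet_gB]

theorem contactDensity_eta_pos (p : M) : 0 < contactDensity S.eta p :=
  contactDensity_pos (S.bdet_contactB_ne_zero p)

variable [MeasurableSpace M] [BorelSpace M]

theorem μ_eq : S.μ = densityMeasure n (contactDensity S.eta) := by
  have := riemannianMeasure_eq S.gB
  simp only [← contactDensity_eta] at this
  exact this

variable [CompactSpace M]

instance : IsFiniteMeasure S.μ := by
  rw [μ_eq]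
  exact isFiniteMeasure_densityMeasure
    (continuousOn_chartDensity S.smoothForm_eta S.bdet_contactB_ne_zero)

-- Needed to conclude that a continuous nonnegative function which is not identically zero has
-- positive integral.
instance : S.μ.IsOpenPosMeasure := by
  rw [μ_eq]
  exact isOpenPosMeasure_densityMeasure
    (continuousOn_chartDensity S.smoothForm_eta S.bdet_contactB_ne_zero) S.contactDensity_eta_pos

/-- A measure with a density relative to the volume density of `S`. -/
theorem densityMeasure_eta_mul {r : M → ℝ} (hr : Measurable r) :
    densityMeasure n (fun p => contactDensity S.eta p * r p) =
      S.μ.withDensity fun p => ENNReal.ofReal (r p) := by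
  rw [μ_eq]
  exact densityMeasure_mul (continuousOn_chartDensity S.smoothForm_eta S.bdet_contactB_ne_zero)
    (contactDensity_nonneg _) hr

end SasakianStructure

/-! ### Brackets, Cartan's formula and extension of vectors to fields. -/

section Fields

variable {n : ℕ} {M : Type*} [TopologicalSpace M] [ChartedSpace (E n) M]

/-- The Lie bracket of two vector fields, with values in the model space. -/
def bracket (V W : M → E n) (p : M) : E n :=
  fderiv ℝ (fieldRep p W) (extChartAt (I n) p p) (V p) -
    fderiv ℝ (fieldRep p V) (extChartAt (I n) p p) (W p)

variable [IsManifold (I n) ∞ M]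

theorem mlieBracket_eq_bracket (V W : M → E n) (p : M) :
    VectorField.mlieBracket (I n) V W p = bracket V W p := mlieBracket_eq V W p

theorem contMDiff_apply {α : M → E n →L[ℝ] ℝ} {V : M → E n} (hα : SmoothForm α)
    (hV : SmoothField (n := n) V) : ContMDiff (I n) 𝓘(ℝ, ℝ) ∞ fun p => α p (V p) := by
  intro p
  refine contMDiffAt_of_rep (ContDiffAt.congr_of_eventuallyEq ((hα p _ (ext_mem_target p)).clm_apply
    (contDiffAt_fieldRep hV (ext_mem_target p))) ?_)
  filter_upwards [target_mem_nhds (ext_mem_target (n := n) p)] with z hz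
  rw [formRep_fieldRep hz]

theorem differentiableAt_fieldRep {V : M → E n} (hV : SmoothField (n := n) V) {x : M} {z : E n}
    (hz : z ∈ (extChartAt (I n) x).target) : DifferentiableAt ℝ (fieldRep x V) z :=
  (contDiffAt_fieldRep hV hz).differentiableAt (by simp)

/-- The derivative of a function `α(W)`. -/
theorem diff_apply {α : M → E n →L[ℝ] ℝ} {W : M → E n} (hα : SmoothForm α)
    (hW : SmoothField (n := n) W) (p : M) (v : E n) :
    diff (n := n) (fun q => α q (W q)) p v =
      fderiv ℝ (formRep p α) (extChartAt (I n) p p) v (W p) +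
        α p (fderiv ℝ (fieldRep p W) (extChartAt (I n) p p) v) := by
  have ht := ext_mem_target (n := n) p
  rw [diff_eq_fderiv (mdifferentiable_of_contMDiff (contMDiff_apply hα hW) p)]
  have h : (fun q => α ((extChartAt (I n) p).symm q) (W ((extChartAt (I n) p).symm q)))
      =ᶠ[𝓝 (extChartAt (I n) p p)] fun q => formRep p α q (fieldRep p W q) := by
    filter_upwards [target_mem_nhds ht] with z hz
    rw [formRep_fieldRep hz]
  rw [h.fderiv_eq, fderiv_clm_apply (hα.differentiableAt ht) (differentiableAt_fieldRep hW ht)]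
  simp only [formRep_self, fieldRep_self, _root_.add_apply, ContinuousLinearMap.comp_apply,
    ContinuousLinearMap.flip_apply]
  ring

/-- Cartan's formula `dα(V, W) = V(αW) - W(αV) - α[V, W]`. -/
theorem extDeriv₁_bracket {α : M → E n →L[ℝ] ℝ} {V W : M → E n} (hα : SmoothForm α)
    (hV : SmoothField (n := n) V) (hW : SmoothField (n := n) W) (p : M) :
    extDeriv₁ α p (V p) (W p) = diff (n := n) (fun q => α q (W q)) p (V p) -
      diff (n := n) (fun q => α q (V q)) p (W p) - α p (bracket V W p) := by
  rw [diff_apply hα hW, diff_apply hα hV, extDeriv₁_eq (hα.differentiableAt (ext_mem_target p)),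
    extD, bracket, map_sub]
  ring

/-- The exterior derivative of `f α`. -/
theorem extDeriv₁_smul {α : M → E n →L[ℝ] ℝ} {f : M → ℝ} (hα : SmoothForm α)
    (hf : ContMDiff (I n) 𝓘(ℝ, ℝ) ∞ f) (p : M) (v w : E n) :
    extDeriv₁ (fun q => f q • α q) p v w = f p * extDeriv₁ α p v w +
      (diff (n := n) f p v * α p w - diff (n := n) f p w * α p v) := by
  have ht := ext_mem_target (n := n) p
  have hfd := (contDiffAt_rep hf ht).differentiableAt (by simp)
  have h : formRep p (fun q => f q • α q) = fun z => f ((extChartAt (I n) p).symm z) • formRep p α z :=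
    rfl
  have hd : DifferentiableAt ℝ (formRep p (fun q => f q • α q)) (extChartAt (I n) p p) :=
    hfd.smul (hα.differentiableAt ht)
  rw [extDeriv₁_eq hd, extDeriv₁_eq (hα.differentiableAt ht),
    diff_eq_fderiv (mdifferentiable_of_contMDiff hf p), diff_eq_fderiv (mdifferentiable_of_contMDiff hf p),
    extD, extD, h, fderiv_fun_smul hfd (hα.differentiableAt ht)]
  simp only [formRep_self, symm_ext, _root_.add_apply, _root_.smul_apply,
    ContinuousLinearMap.smulRight_apply, smul_eq_mul]
  ring

theorem smoothForm_smul {α : M → E n →L[ℝ] ℝ} {f : M → ℝ} (hα : SmoothForm α)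
    (hf : ContMDiff (I n) 𝓘(ℝ, ℝ) ∞ f) : SmoothForm (fun q => f q • α q) := fun x z hz =>
  (contDiffAt_rep hf hz).smul (hα x z hz)

/-- Every tangent vector extends to a smooth vector field. -/
theorem exists_smoothField [T2Space M] (p : M) (v : E n) :
    ∃ V : M → E n, SmoothField (n := n) V ∧ V p = v := by
  obtain ⟨f⟩ : Nonempty (SmoothBumpFunction (I n) p) := inferInstance
  set s : Π q : M, TangentSpace (I n) q := fun q => frame p (extChartAt (I n) p q) v with hs
  have hsm : ContMDiffOn (I n) (I n).tangent ∞ (fun q => (⟨q, s q⟩ : TangentBundle (I n) M))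
      (extChartAt (I n) p).source := by
    intro q hq
    refine (contMDiffWithinAt_vector_iff p contMDiffWithinAt_id hq).2 ?_
    refine (contMDiffWithinAt_const (c := v)).congr_of_mem (fun y hy => ?_) hq
    have := coframe_frame ((extChartAt (I n) p).map_source hy) v
    rw [(extChartAt (I n) p).left_inv hy] at this
    exact this
  have h1 := ContMDiffOn.smul_section_of_tsupport (ψ := f) f.contMDiff.contMDiffOn
    (isOpen_extChartAt_source p) (by rw [extChartAt_source]; exact f.tsupport_subset_chartAt_source) hsm
  refine ⟨_, h1, ?_⟩
  have h2 : f p • frame (n := n) p (extChartAt (I n) p p) v = v := by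
    rw [f.eq_one, frame_self]; simp
  exact h2

theorem smoothField_add {V W : M → E n} (hV : SmoothField (n := n) V) (hW : SmoothField (n := n) W) :
    SmoothField (n := n) fun p => V p + W p := smoothField_of_rep fun x => by
  have ht := ext_mem_target (n := n) x
  refine ((contDiffAt_fieldRep hV ht).add (contDiffAt_fieldRep hW ht)).congr_of_eventuallyEq ?_
  exact Eventually.of_forall fun z => map_add (coframe x _) _ _

theorem smoothField_smul {V : M → E n} {f : M → ℝ} (hf : ContMDiff (I n) 𝓘(ℝ, ℝ) ∞ f)
    (hV : SmoothField (n := n) V) : SmoothField (n := n) fun p => f p • V p :=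
  smoothField_of_rep fun x => by
    have ht := ext_mem_target (n := n) x
    refine ((contDiffAt_rep hf ht).smul (contDiffAt_fieldRep hV ht)).congr_of_eventuallyEq ?_
    exact Eventually.of_forall fun z => map_smul (coframe x _) _ _

theorem smoothField_sub {V W : M → E n} (hV : SmoothField (n := n) V) (hW : SmoothField (n := n) W) :
    SmoothField (n := n) fun p => V p - W p := smoothField_of_rep fun x => by
  have ht := ext_mem_target (n := n) x
  refine ((contDiffAt_fieldRep hV ht).sub (contDiffAt_fieldRep hW ht)).congr_of_eventuallyEq ?_
  exact Eventually.of_forall fun z => map_sub (coframe x _) _ _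

theorem endoRep_fieldRep {x₀ : M} {z : E n} (hz : z ∈ (extChartAt (I n) x₀).target)
    (Φ : M → E n →L[ℝ] E n) (V : M → E n) :
    endoRep x₀ Φ z (fieldRep x₀ V z) = fieldRep x₀ (fun q => Φ q (V q)) z := by
  simp [endoRep, frame_fieldRep hz]; rfl

theorem SasakianStructure.smoothField_phi (S : SasakianStructure n M) {V : M → E n}
    (hV : SmoothField (n := n) V) : SmoothField (n := n) fun p => S.phi p (V p) :=
  smoothField_of_rep fun x => by
    have ht := ext_mem_target (n := n) x
    refine ((contDiffAt_endoRep S.smooth_Φ ht).clm_apply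
      (contDiffAt_fieldRep hV ht)).congr_of_eventuallyEq ?_
    filter_upwards [target_mem_nhds ht] with z hz
    exact (endoRep_fieldRep hz S.phi V).symm

end Fields

/-! ### Brackets of fields on the cone that are invariant under dilation. -/

section Cone

variable {n : ℕ} {M : Type*} [TopologicalSpace M] [ChartedSpace (E n) M]

/-- A vector field on `M × ℝ` that does not depend on the second coordinate. -/
def coneField (A : M → E n) (a : M → ℝ) (q : M × ℝ) : TangentSpace ((I n).prod 𝓘(ℝ, ℝ)) q :=
  (A q.1, a q.1)

variable [IsManifold (I n) ∞ M]

theorem smoothConeField_const {A : M → E n} (hA : SmoothField (n := n) A) (c : ℝ) :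
    SmoothConeField (n := n) (coneField A fun _ => c) := by
  have h1 : ContMDiff 𝓘(ℝ, ℝ) 𝓘(ℝ, ℝ).tangent ∞ (fun t : ℝ => (⟨t, c⟩ : TangentBundle 𝓘(ℝ, ℝ) ℝ)) :=
    fun t => contMDiffAt_vectorSpace_iff_contDiffAt.2 contDiffAt_const
  have h2 := (contMDiff_equivTangentBundleProd_symm (I := I n) (I' := 𝓘(ℝ, ℝ)) (M := M) (M' := ℝ)
    (n := ∞)).comp ((ContMDiff.comp hA contMDiff_fst).prodMk (h1.comp contMDiff_snd))
  exact h2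

/-- Nothing depends on the radial coordinate, so only derivatives along `M` survive; the radial
component of the bracket differentiates the functions `a` and `b` along the fields on `M`. -/
theorem mlieBracket_coneField (A B : M → E n) (a b : M → ℝ) (p : M) (s : ℝ)
    (hA : DifferentiableAt ℝ (fieldRep p A) (extChartAt (I n) p p))
    (hB : DifferentiableAt ℝ (fieldRep p B) (extChartAt (I n) p p))
    (ha : DifferentiableAt ℝ (fun z => a ((extChartAt (I n) p).symm z)) (extChartAt (I n) p p))
    (hb : DifferentiableAt ℝ (fun z => b ((extChartAt (I n) p).symm z)) (extChartAt (I n) p p)) :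
    VectorField.mlieBracket ((I n).prod 𝓘(ℝ, ℝ)) (coneField A a) (coneField B b) (p, s) =
      ((bracket A B p, fderiv ℝ (fun z => b ((extChartAt (I n) p).symm z)) (extChartAt (I n) p p) (A p) -
        fderiv ℝ (fun z => a ((extChartAt (I n) p).symm z)) (extChartAt (I n) p p) (B p)) : E n × ℝ) := by
  set e := extChartAt (I n) p with he
  set R : (M → E n) → (M → ℝ) → E n × ℝ → E n × ℝ := fun A a q => (fieldRep p A q.1, a (e.symm q.1))
    with hR
  have hsy : ((extChartAt ((I n).prod 𝓘(ℝ, ℝ)) (p, s)).symm : E n × ℝ → M × ℝ) =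
      Prod.map e.symm (id : ℝ → ℝ) := by
    rw [extChartAt_prod]; rfl
  have hpt : extChartAt ((I n).prod 𝓘(ℝ, ℝ)) (p, s) (p, s) = (e p, s) := by
    rw [extChartAt_prod]; rfl
  have hr : range ((I n).prod 𝓘(ℝ, ℝ)) = univ := by
    simp
  have key : ∀ (A : M → E n) (a : M → ℝ),
      VectorField.mpullbackWithin 𝓘(ℝ, E n × ℝ) ((I n).prod 𝓘(ℝ, ℝ))
        (extChartAt ((I n).prod 𝓘(ℝ, ℝ)) (p, s)).symm (coneField A a) (range ((I n).prod 𝓘(ℝ, ℝ)))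
        =ᶠ[𝓝 (e p, s)] R A a := by
    intro A a
    have hn : e.target ×ˢ (univ : Set ℝ) ∈ 𝓝 (e p, s) :=
      prod_mem_nhds (target_mem_nhds (ext_mem_target p)) univ_mem
    filter_upwards [hn] with q hq
    have hd : mfderiv 𝓘(ℝ, E n × ℝ) ((I n).prod 𝓘(ℝ, ℝ))
        (extChartAt ((I n).prod 𝓘(ℝ, ℝ)) (p, s)).symm q =
          (frame p q.1).prodMap (ContinuousLinearMap.id ℝ ℝ) := by
      rw [hsy]
      have := mfderiv_prodMap (I := 𝓘(ℝ, E n)) (I' := 𝓘(ℝ, ℝ)) (J := I n) (J' := 𝓘(ℝ, ℝ)) (p := q)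
        (f := e.symm) (g := (id : ℝ → ℝ)) (mdifferentiableAt_symm hq.1) mdifferentiableAt_id
      rw [← modelWithCornersSelf_prod, chartedSpaceSelf_prod] at this
      refine this.trans ?_
      rw [mfderiv_id]; rfl
    rw [VectorField.mpullbackWithin_apply, hr, mfderivWithin_univ]
    have hi : (mfderiv 𝓘(ℝ, E n × ℝ) ((I n).prod 𝓘(ℝ, ℝ))
        (extChartAt ((I n).prod 𝓘(ℝ, ℝ)) (p, s)).symm q).inverse =
          ((coframe p (e.symm q.1)).prodMap (ContinuousLinearMap.id ℝ ℝ) : E n × ℝ →L[ℝ] E n × ℝ) := by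
      rw [hd]
      refine ContinuousLinearMap.inverse_eq ?_ ?_
      · ext1 v
        exact Prod.ext (frame_coframe hq.1 v.1) rfl
      · ext1 v
        exact Prod.ext (coframe_frame hq.1 v.1) rfl
    rw [hi, hsy]
    rfl
  have hdR : ∀ (A : M → E n) (a : M → ℝ), DifferentiableAt ℝ (fieldRep p A) (e p) →
      DifferentiableAt ℝ (fun z => a (e.symm z)) (e p) → ∀ v : E n × ℝ,
      fderiv ℝ (R A a) (e p, s) v =
        (fderiv ℝ (fieldRep p A) (e p) v.1, fderiv ℝ (fun z => a (e.symm z)) (e p) v.1) := by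
    intro A a hA ha v
    have h1 : HasFDerivAt (fun q : E n × ℝ => fieldRep p A q.1) _ (e p, s) :=
      HasFDerivAt.comp (g := fieldRep p A) (f := Prod.fst) (e p, s) hA.hasFDerivAt hasFDerivAt_fst
    have h2 : HasFDerivAt (fun q : E n × ℝ => a (e.symm q.1)) _ (e p, s) :=
      HasFDerivAt.comp (g := fun z => a (e.symm z)) (f := Prod.fst) (e p, s) ha.hasFDerivAt
        hasFDerivAt_fst
    rw [(h1.prodMk h2).fderiv]
    rfl
  have e1 : ∀ V' W' : E n × ℝ → E n × ℝ, V' =ᶠ[𝓝 (e p, s)] R A a → W' =ᶠ[𝓝 (e p, s)] R B b →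
      VectorField.lieBracketWithin ℝ V' W'
        ((extChartAt ((I n).prod 𝓘(ℝ, ℝ)) (p, s)).symm ⁻¹' univ ∩ range ((I n).prod 𝓘(ℝ, ℝ)))
        (e p, s) = (bracket A B p, fderiv ℝ (fun z => b (e.symm z)) (e p) (A p) -
          fderiv ℝ (fun z => a (e.symm z)) (e p) (B p)) := by
    intro V' W' hV hW
    have hu : (extChartAt ((I n).prod 𝓘(ℝ, ℝ)) (p, s)).symm ⁻¹' univ ∩
        range ((I n).prod 𝓘(ℝ, ℝ)) = univ := by rw [hr]; simp
    rw [hu, VectorField.lieBracketWithin_univ,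
      Filter.EventuallyEq.lieBracket_vectorField_eq hV hW, VectorField.lieBracket, hdR _ _ hA ha,
      hdR _ _ hB hb]
    simp only [hR, he, fieldRep_self, symm_ext, bracket, Prod.mk_sub_mk]
  have hid : mfderiv ((I n).prod 𝓘(ℝ, ℝ)) 𝓘(ℝ, E n × ℝ)
      (extChartAt ((I n).prod 𝓘(ℝ, ℝ)) (p, s)) (p, s) = ContinuousLinearMap.id ℝ (E n × ℝ) :=
    mfderiv_extChartAt_self
  have hinv : (mfderiv ((I n).prod 𝓘(ℝ, ℝ)) 𝓘(ℝ, E n × ℝ)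
      (extChartAt ((I n).prod 𝓘(ℝ, ℝ)) (p, s)) (p, s)).inverse = ContinuousLinearMap.id ℝ (E n × ℝ) :=
    (congrArg ContinuousLinearMap.inverse hid).trans ContinuousLinearMap.inverse_id
  rw [VectorField.mlieBracket, VectorField.mlieBracketWithin_apply, hinv, hpt]
  exact e1 _ _ (key A a) (key B b)

end Cone

/-! ### Infinitesimal CR automorphisms. -/

namespace SasakianStructure

variable {n : ℕ} {M : Type*} [TopologicalSpace M] [ChartedSpace (E n) M] [IsManifold (I n) ∞ M]
  (S : SasakianStructure n M)

theorem smoothField_xi : SmoothField (n := n) S.xi := S.smooth_ξ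

/-- The Reeb flow preserves `Φ`. -/
theorem bracket_xi_phi {Y : M → E n} (hY : SmoothField (n := n) Y) (p : M) :
    bracket S.xi (fun q => S.phi q (Y q)) p = S.phi p (bracket S.xi Y p) := by
  have ht := ext_mem_target (n := n) p
  have h0 : SmoothField (n := n) (fun _ : M => (0 : E n)) := smoothField_of_rep fun x => by
    refine contDiffAt_const (c := (0 : E n)) |>.congr_of_eventuallyEq ?_
    exact Eventually.of_forall fun z => map_zero (coframe x _)
  -- Integrability is tested on the radial field, which `coneI` sends to the Reeb field, and on `Y`.
  -- Brackets with the radial field vanish, and the `M`-component of the Nijenhuis tensor is [ξ, ΦY]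
  -- - Φ[ξ, Y].
  have hN := S.normal _ _ (smoothConeField_const h0 1) (smoothConeField_const hY 0) (p, 0)
  have e1 : (fun q : M × ℝ => coneI S.ξ S.η S.Φ q (coneField (fun _ => (0 : E n)) (fun _ => (1 : ℝ)) q)) =
      coneField S.xi fun _ => 0 := by
    funext q
    refine Prod.ext ?_ ?_
    · change S.phi q.1 0 + (1 : ℝ) • S.xi q.1 = S.xi q.1
      rw [map_zero, one_smul, zero_add]
    · change -(S.eta q.1 0) = (0 : ℝ)
      rw [map_zero, neg_zero]
  have e2 : (fun q : M × ℝ => coneI S.ξ S.η S.Φ q (coneField Y (fun _ => (0 : ℝ)) q)) =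
      coneField (fun q => S.phi q (Y q)) fun q => -S.eta q (Y q) := by
    funext q
    refine Prod.ext ?_ rfl
    change S.phi q.1 (Y q.1) + (0 : ℝ) • S.xi q.1 = S.phi q.1 (Y q.1)
    rw [zero_smul, add_zero]
  have dc : ∀ c : ℝ, DifferentiableAt ℝ (fun _ : E n => c) (extChartAt (I n) p p) := fun c =>
    differentiableAt_const c
  have dη : DifferentiableAt ℝ (fun z => -S.eta ((extChartAt (I n) p).symm z)
      (Y ((extChartAt (I n) p).symm z))) (extChartAt (I n) p p) :=
    ((contDiffAt_rep (contMDiff_apply S.smoothForm_eta hY) ht).differentiableAt (by simp)).neg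
  have d0 := differentiableAt_fieldRep h0 ht
  have dY := differentiableAt_fieldRep hY ht
  have dξ := differentiableAt_fieldRep S.smoothField_xi ht
  have dP := differentiableAt_fieldRep (S.smoothField_phi hY) ht
  rw [e1, e2, mlieBracket_coneField _ _ _ _ p 0 dξ dP (dc 0) dη,
    mlieBracket_coneField _ _ _ _ p 0 dξ dY (dc 0) (dc 0),
    mlieBracket_coneField _ _ _ _ p 0 d0 dP (dc 1) dη,
    mlieBracket_coneField _ _ _ _ p 0 d0 dY (dc 1) (dc 0)] at hN
  have hb : ∀ W : M → E n, bracket (fun _ : M => (0 : E n)) W p = 0 := by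
    intro W
    have : fieldRep p (fun _ : M => (0 : E n)) = fun _ => 0 := by
      funext z; exact map_zero (coframe p _)
    rw [bracket, this]; simp
  have h1 : bracket S.xi (fun q => S.phi q (Y q)) p -
      (S.phi p (bracket S.xi Y p) + (fderiv ℝ (fun _ : E n => (0 : ℝ)) (extChartAt (I n) p p) (S.xi p) -
        fderiv ℝ (fun _ : E n => (0 : ℝ)) (extChartAt (I n) p p) (Y p)) • S.xi p) -
      (S.phi p (bracket (fun _ : M => (0 : E n)) (fun q => S.phi q (Y q)) p) +
        (fderiv ℝ (fun z => -S.eta ((extChartAt (I n) p).symm z) (Y ((extChartAt (I n) p).symm z)))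
          (extChartAt (I n) p p) 0 -
          fderiv ℝ (fun _ : E n => (1 : ℝ)) (extChartAt (I n) p p) (S.phi p (Y p))) • S.xi p) -
      bracket (fun _ : M => (0 : E n)) Y p = 0 := congrArg Prod.fst hN
  rw [hb, hb] at h1
  simpa [sub_eq_zero] using h1

theorem bracket_eta {X Y : M → E n} (hX : SmoothField (n := n) X) (hY : SmoothField (n := n) Y)
    (p : M) : S.eta p (bracket X Y p) = diff (n := n) (fun q => S.eta q (Y q)) p (X p) -
      diff (n := n) (fun q => S.eta q (X q)) p (Y p) - extDeriv₁ S.eta p (X p) (Y p) := by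
  rw [extDeriv₁_bracket S.smoothForm_eta hX hY]; ring

theorem mem_cr_iff {X : M → E n} : X ∈ S.cr ↔ SmoothField (n := n) X ∧
    ∀ Y : M → E n, SmoothField (n := n) Y → (∀ p, S.eta p (Y p) = 0) → ∀ p,
      S.eta p (bracket X Y p) = 0 ∧
        bracket X (fun q => S.phi q (Y q)) p = S.phi p (bracket X Y p) := by
  refine and_congr_right fun hX => forall_congr' fun Y => forall_congr' fun hY =>
    forall_congr' fun hη => forall_congr' fun p => ?_
  have e1 := mlieBracket_eq_bracket X Y p
  have e2 := mlieBracket_eq_bracket X (fun q => S.phi q (Y q)) p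
  exact Iff.of_eq (congrArg₂ (fun a b : E n => S.eta p a = 0 ∧ b = S.phi p a) e1 e2)

/-- Since η(ξ) is constant and ι_ξ dη = 0, the Reeb flow preserves the kernel of η; normality makes
it preserve Φ. -/
theorem xi_mem_cr : S.xi ∈ S.cr := by
  refine S.mem_cr_iff.2 ⟨S.smoothField_xi, fun Y hY hη p => ⟨?_, S.bracket_xi_phi hY p⟩⟩
  rw [S.bracket_eta S.smoothField_xi hY, extDeriv₁_xi_eta]
  simp only [hη, eta_xi, diff_const, sub_zero]

omit [IsManifold (I n) ∞ M] in
theorem bracket_combination {X X' Y : M → E n} (a b : ℝ) {p : M}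
    (hX : DifferentiableAt ℝ (fieldRep p X) (extChartAt (I n) p p))
    (hX' : DifferentiableAt ℝ (fieldRep p X') (extChartAt (I n) p p)) :
    bracket (fun q => a • X q + b • X' q) Y p = a • bracket X Y p + b • bracket X' Y p := by
  have h : fieldRep p (fun q => a • X q + b • X' q) =
      fun z => a • fieldRep p X z + b • fieldRep p X' z := by
    funext z; simp [fieldRep]
  rw [bracket, bracket, bracket, h, fderiv_fun_add (hX.fun_const_smul a) (hX'.fun_const_smul b),
    fderiv_fun_const_smul hX, fderiv_fun_const_smul hX']
  simp only [_root_.add_apply, _root_.smul_apply, map_add, map_smul]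
  module

theorem combination_mem_cr {X X' : M → E n} (hX : X ∈ S.cr) (hX' : X' ∈ S.cr) (a b : ℝ) :
    (fun p => a • X p + b • X' p) ∈ S.cr := by
  rw [mem_cr_iff] at hX hX' ⊢
  refine ⟨smoothField_add (smoothField_smul contMDiff_const hX.1)
    (smoothField_smul contMDiff_const hX'.1), fun Y hY hη p => ?_⟩
  have ht := ext_mem_target (n := n) p
  have d := differentiableAt_fieldRep hX.1 ht
  have d' := differentiableAt_fieldRep hX'.1 ht
  rw [bracket_combination a b d d', bracket_combination a b d d', map_add, map_smul, map_smul,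
    map_add, map_smul, map_smul, (hX.2 Y hY hη p).1, (hX'.2 Y hY hη p).1, (hX.2 Y hY hη p).2,
    (hX'.2 Y hY hη p).2]
  simp

/-- Every vector in the contact distribution extends to a smooth section of it. -/
theorem exists_section [T2Space M] (p : M) {v : E n} (hv : S.eta p v = 0) :
    ∃ Y : M → E n, SmoothField (n := n) Y ∧ Y p = v ∧ ∀ q, S.eta q (Y q) = 0 := by
  obtain ⟨V, hV, rfl⟩ := exists_smoothField p v
  refine ⟨fun q => V q - S.eta q (V q) • S.xi q, smoothField_sub hV
    (smoothField_smul (contMDiff_apply S.smoothForm_eta hV) S.smoothField_xi), ?_, fun q => ?_⟩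
  · simp [hv]
  · simp [eta_xi]

/-- The contact vector fields have the Hamiltonian `η(X)`. -/
theorem extDeriv₁_cr [T2Space M] {X : M → E n} (hX : X ∈ S.cr) (p : M) {v : E n}
    (hv : S.eta p v = 0) :
    extDeriv₁ S.eta p (X p) v = -diff (n := n) (fun q => S.eta q (X q)) p v := by
  rw [mem_cr_iff] at hX
  obtain ⟨Y, hY, rfl, hη⟩ := S.exists_section p hv
  have h := S.bracket_eta hX.1 hY p
  rw [(hX.2 Y hY hη p).1] at h
  simp only [hη, diff_const] at h
  linarith

/-! ### Metrics of the Sasaki cone and the integral formula for their volume. -/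

section Cone

variable {S} {X : M → E n}

theorem eta_pos (hX : X ∈ S.crPos) (p : M) : 0 < S.eta p (X p) := hX.2 p

theorem contMDiff_eta (hX : X ∈ S.cr) : ContMDiff (I n) 𝓘(ℝ, ℝ) ∞ fun p => S.eta p (X p) :=
  contMDiff_apply S.smoothForm_eta (S.mem_cr_iff.1 hX).1

theorem contMDiff_inv_eta (hX : X ∈ S.crPos) :
    ContMDiff (I n) 𝓘(ℝ, ℝ) ∞ fun p => (S.eta p (X p))⁻¹ := fun p =>
  ContMDiffAt.inv₀ (contMDiff_eta hX.1 p) (eta_pos hX p).ne'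

theorem diff_inv {f : M → ℝ} (hf : ContMDiff (I n) 𝓘(ℝ, ℝ) ∞ f) (h0 : ∀ p, f p ≠ 0)
    (p : M) (v : E n) : diff (n := n) (fun q => (f q)⁻¹) p v = -(f p)⁻¹ ^ 2 * diff (n := n) f p v := by
  have hfi : ContMDiff (I n) 𝓘(ℝ, ℝ) ∞ fun q => (f q)⁻¹ := fun q => ContMDiffAt.inv₀ (hf q) (h0 q)
  rw [diff_eq_fderiv (mdifferentiable_of_contMDiff hfi p),
    diff_eq_fderiv (mdifferentiable_of_contMDiff hf p)]
  have hd := ((contDiffAt_rep hf (ext_mem_target (n := n) p)).differentiableAt (by simp)).hasFDerivAt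
  have h1 := ((hasDerivAt_inv (h0 ((extChartAt (I n) p).symm (extChartAt (I n) p p)))).comp_hasFDerivAt
    (extChartAt (I n) p p) hd).fderiv
  refine (congrArg (fun L : E n →L[ℝ] ℝ => L v) h1).trans ?_
  rw [symm_ext, _root_.smul_apply, smul_eq_mul, inv_pow]

variable [T2Space M]

/-- The determinants of the metrics in the Sasaki cone. -/
theorem exists_coneMetric (hX : X ∈ S.crPos) : ∃ G : M → LinearMap.BilinForm ℝ (E n),
    (∀ p v w, S.coneMetric X p v w = G p v w) ∧
      ∀ p, bdet (G p) = (S.eta p (X p))⁻¹ ^ (2 * n + 2) * bdet (S.gB p) := by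
  set f : M → ℝ := fun p => (S.eta p (X p))⁻¹ with hf
  have hfX : ∀ p, f p * S.eta p (X p) = 1 := fun p => inv_mul_cancel₀ (eta_pos hX p).ne'
  set P : M → E n →ₗ[ℝ] E n := fun p =>
    LinearMap.id - (f p • (S.eta p : E n →ₗ[ℝ] ℝ)).smulRight (X p) with hP
  have hPa : ∀ p v, P p v = v - (f p * S.eta p v) • X p := fun p v => rfl
  have hηP : ∀ p v, S.eta p (P p v) = 0 := by
    intro p v
    rw [hPa, map_sub, map_smul, smul_eq_mul]
    linear_combination (-S.eta p v) * hfX p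
  set N : M → LinearMap.BilinForm ℝ (E n) := fun p =>
    LinearMap.BilinForm.linMulLin (S.eta p : E n →ₗ[ℝ] ℝ) (S.eta p : E n →ₗ[ℝ] ℝ) with hN
  set G : M → LinearMap.BilinForm ℝ (E n) := fun p =>
    f p • ((S.gB p - N p).comp (P p) (P p)) + (f p * f p) • N p with hG
  have hGa : ∀ p v w, G p v w = f p * (S.gB p (v - (f p * S.eta p v) • X p) (w - (f p * S.eta p w) • X p)
      - S.eta p (v - (f p * S.eta p v) • X p) * S.eta p (w - (f p * S.eta p w) • X p)) +
      (f p * S.eta p v) * (f p * S.eta p w) := by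
    intro p v w
    change f p * (S.gB p (P p v) (P p w) - S.eta p (P p v) * S.eta p (P p w)) +
      f p * f p * (S.eta p v * S.eta p w) = _
    rw [hPa, hPa]
    ring
  -- Split v into its part `P p v` in D and a multiple of X. In d(fη) the term df ⊗ η contributes f²
  -- η(v) d(η(X)), and the X-part of f dη contributes its negative by `extDeriv₁_cr`. What is left
  -- is f dη on D: the statement that X is the Reeb field of η/η(X).
  have hmain : ∀ (p : M) (v w : E n), extDeriv₁ (fun q => f q • S.eta q) p v (S.phi p (P p w)) +
      (f p * S.eta p v) * (f p * S.eta p w) = G p v w := by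
    intro p v w
    have hηu : S.eta p (S.phi p (P p w)) = 0 := S.eta_phi p _
    have hv : v = P p v + (f p * S.eta p v) • X p := by rw [hPa]; simp
    have h3 : extDeriv₁ S.eta p v (S.phi p (P p w)) = extDeriv₁ S.eta p (P p v) (S.phi p (P p w)) +
        (f p * S.eta p v) * extDeriv₁ S.eta p (X p) (S.phi p (P p w)) := by
      rw [extDeriv₁_eta, extDeriv₁_eta, extDeriv₁_eta]
      conv_lhs => rw [hv]
      simp only [map_add, map_smul, LinearMap.add_apply, LinearMap.smul_apply, smul_eq_mul]
    have h4 : diff (n := n) f p (S.phi p (P p w)) = -f p ^ 2 *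
        diff (n := n) (fun q => S.eta q (X q)) p (S.phi p (P p w)) :=
      diff_inv (contMDiff_eta hX.1) (fun p => (eta_pos hX p).ne') p _
    rw [extDeriv₁_smul S.smoothForm_eta (contMDiff_inv_eta hX), h3, extDeriv₁_eta_phi, hηP,
      S.extDeriv₁_cr hX.1 p hηu, hηu, h4, hGa, ← hPa, ← hPa, hηP, hηP]
    ring
  refine ⟨G, fun p v w => hmain p v w, fun p => ?_⟩
  · exact bdet_cone (η := (S.eta p : E n →ₗ[ℝ] ℝ)) (S.eta_xi p) (hfX p) (S.gB_xi p) (S.gB_symm p)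
      (hGa p)

variable [MeasurableSpace M] [BorelSpace M] [CompactSpace M]

/-- Half of the exponent 2n+2 of the determinant ratio survives the square root; positivity of η(X)
removes the absolute value. -/
theorem riemannianMeasure_coneMetric (hX : X ∈ S.crPos) :
    riemannianMeasure (S.coneMetric X) =
      S.μ.withDensity fun p => ENNReal.ofReal ((S.eta p (X p))⁻¹ ^ (n + 1)) := by
  obtain ⟨G, hG, hd⟩ := exists_coneMetric hX
  have h1 : S.coneMetric X = fun p v w => G p v w := by funext p v w; exact hG p v w
  have hm : Measurable fun p => (S.eta p (X p))⁻¹ ^ (n + 1) :=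
    ((contMDiff_inv_eta hX).continuous.pow (n + 1)).measurable
  rw [h1, ← S.densityMeasure_eta_mul hm]
  refine (riemannianMeasure_eq G).trans ?_
  congr 1
  funext p
  have h0 : 0 ≤ (S.eta p (X p))⁻¹ := (inv_pos.2 (eta_pos hX p)).le
  have h2 : (S.eta p (X p))⁻¹ ^ (2 * n + 2) = ((S.eta p (X p))⁻¹ ^ (n + 1)) ^ 2 := by
    rw [← pow_mul]; congr 1; ring
  rw [hd, S.contactDensity_eta, h2, Real.sqrt_mul (sq_nonneg _),
    Real.sqrt_sq (pow_nonneg h0 _), mul_comm]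

omit [T2Space M] in
theorem _root_.Sasaki.real_univ_withDensity {m : Measure M} [IsFiniteMeasure m] {r : M → ℝ}
    (hr : Continuous r) (h0 : ∀ p, 0 ≤ r p) :
    (m.withDensity fun p => ENNReal.ofReal (r p)).real univ = ∫ p, r p ∂m := by
  rw [measureReal_def, withDensity_apply _ MeasurableSet.univ, Measure.restrict_univ,
    ← ofReal_integral_eq_lintegral_ofReal (integrable_of_continuous hr) (Eventually.of_forall h0),
    ENNReal.toReal_ofReal (integral_nonneg h0)]

/-- The volume functional on the Sasaki cone. -/
theorem coneVolume_eq (hX : X ∈ S.crPos) :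
    S.coneVolume X = ∫ p, (S.eta p (X p))⁻¹ ^ (n + 1) ∂S.μ := by
  change (riemannianMeasure (S.coneMetric X)).real univ = _
  rw [riemannianMeasure_coneMetric hX, real_univ_withDensity
    (r := fun p => (S.eta p (X p))⁻¹ ^ (n + 1)) ((contMDiff_inv_eta hX).continuous.pow (n + 1))
    fun p => pow_nonneg (inv_pos.2 (eta_pos hX p)).le _]

end Cone
end SasakianStructure

/-! ### Integrals of inverse powers of positive functions. -/

section InvPow

variable {n : ℕ} {M : Type*} [TopologicalSpace M] [ChartedSpace (E n) M]

theorem JointSmoothAt.inv_pow {u : ℝ → M → ℝ} {t₀ : ℝ} (hu : JointSmoothAt n u t₀)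
    (h0 : ∀ p, u t₀ p ≠ 0) (k : ℕ) : JointSmoothAt n (fun t p => (u t p)⁻¹ ^ k) t₀ := fun x =>
  (ContDiffAt.inv (hu x) (h0 _)).pow k

theorem JointSmoothAt.mul {u v : ℝ → M → ℝ} {t₀ : ℝ} (hu : JointSmoothAt n u t₀)
    (hv : JointSmoothAt n v t₀) : JointSmoothAt n (fun t p => u t p * v t p) t₀ := fun x =>
  (hu x).mul (hv x)

theorem hasDerivAt_inv_pow {u : ℝ → ℝ} {u' t₀ : ℝ} (hu : HasDerivAt u u' t₀) (h0 : u t₀ ≠ 0) (k : ℕ) :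
    HasDerivAt (fun t => (u t)⁻¹ ^ k) (-k * u' * (u t₀)⁻¹ ^ (k + 1)) t₀ := by
  refine ((hu.fun_inv h0).fun_pow k).congr_deriv ?_
  rcases k with _ | k
  · simp
  · rw [Nat.add_sub_cancel, div_eq_mul_inv, ← inv_pow]
    ring

/-- Compactness of `M` makes the range of admissible parameters uniform in the point; it keeps small
perturbations inside the positive cone. -/
theorem eventually_forall_pos [CompactSpace M] {f g : M → ℝ} (hf : Continuous f) (hg : Continuous g)
    (h0 : ∀ p, 0 < f p) : ∀ᶠ t in 𝓝 (0 : ℝ), ∀ p, 0 < f p + t * g p := by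
  have h1 := isCompact_univ.eventually_forall_of_forall_eventually
    (P := fun (t : ℝ) (p : M) => 0 < f p + t * g p) (x₀ := (0 : ℝ)) fun p _ => by
      have hc : Continuous fun q : ℝ × M => f q.2 + q.1 * g q.2 := by fun_prop
      exact (hc.continuousAt (x := (0, p))).eventually_const_lt (by simpa using h0 p)
  simpa using h1

variable [IsManifold (I n) ∞ M]

theorem jointSmoothAt_const {f : M → ℝ} (hf : ContMDiff (I n) 𝓘(ℝ, ℝ) ∞ f) (t₀ : ℝ) :
    JointSmoothAt n (fun _ => f) t₀ := fun x =>
  ContDiffAt.comp (g := fun z => f ((extChartAt (I n) x).symm z)) (f := Prod.snd)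
    (t₀, extChartAt (I n) x x) (contDiffAt_rep hf (ext_mem_target x)) contDiffAt_snd

theorem jointSmoothAt_affine {f g : M → ℝ} (hf : ContMDiff (I n) 𝓘(ℝ, ℝ) ∞ f)
    (hg : ContMDiff (I n) 𝓘(ℝ, ℝ) ∞ g) (t₀ : ℝ) : JointSmoothAt n (fun t p => f p + t * g p) t₀ :=
  fun x => (jointSmoothAt_const hf t₀ x).add (contDiffAt_fst.mul (jointSmoothAt_const hg t₀ x))

variable [CompactSpace M] [MeasurableSpace M] [BorelSpace M]

theorem hasDerivAt_integral_inv_pow {m : Measure M} [IsFiniteMeasure m] {u : ℝ → M → ℝ}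
    {u' w : M → ℝ} {t₀ : ℝ} (hw : ContMDiff (I n) 𝓘(ℝ, ℝ) ∞ w) (hu : JointSmoothAt n u t₀)
    (hd : ∀ p, HasDerivAt (fun t => u t p) (u' p) t₀)
    (h0 : ∀ᶠ t in 𝓝 t₀, Continuous (u t) ∧ ∀ p, 0 < u t p) (k : ℕ) :
    HasDerivAt (fun t => ∫ p, w p * (u t p)⁻¹ ^ k ∂m)
      (∫ p, w p * (-k * u' p * (u t₀ p)⁻¹ ^ (k + 1)) ∂m) t₀ := by
  have hpos := h0.self_of_nhds.2
  refine JointSmoothAt.hasDerivAt_integral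
    ((jointSmoothAt_const hw t₀).mul (hu.inv_pow (fun p => (hpos p).ne') k))
    (fun p => (hasDerivAt_inv_pow (hd p) (hpos p).ne' k).const_mul (w p)) ?_
  filter_upwards [h0] with t ht
  exact hw.continuous.mul ((ht.1.inv₀ fun p => (ht.2 p).ne').pow k)

theorem hasDerivAt_integral_affine_inv_pow {m : Measure M} [IsFiniteMeasure m] {f g w : M → ℝ}
    (hw : ContMDiff (I n) 𝓘(ℝ, ℝ) ∞ w) (hf : ContMDiff (I n) 𝓘(ℝ, ℝ) ∞ f)
    (hg : ContMDiff (I n) 𝓘(ℝ, ℝ) ∞ g) {t₀ : ℝ} (h0 : ∀ᶠ t in 𝓝 t₀, ∀ p, 0 < f p + t * g p) (k : ℕ) :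
    HasDerivAt (fun t => ∫ p, w p * (f p + t * g p)⁻¹ ^ k ∂m)
      (∫ p, w p * (-k * g p * (f p + t₀ * g p)⁻¹ ^ (k + 1)) ∂m) t₀ := by
  refine hasDerivAt_integral_inv_pow hw (jointSmoothAt_affine hf hg t₀) (fun p => ?_)
    (h0.mono fun t ht => ⟨hf.continuous.add (continuous_const.mul hg.continuous), ht⟩) k
  simpa using ((hasDerivAt_id t₀).mul_const (g p)).const_add (f p)

/-- Integrals of inverse powers of an affine family are smooth in the parameter. -/
theorem contDiffOn_integral_affine_inv_pow {m : Measure M} [IsFiniteMeasure m] {f g : M → ℝ}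
    (hf : ContMDiff (I n) 𝓘(ℝ, ℝ) ∞ f) (hg : ContMDiff (I n) 𝓘(ℝ, ℝ) ∞ g) {s : Set ℝ} (hs : IsOpen s)
    (h0 : ∀ t ∈ s, ∀ p, 0 < f p + t * g p) (N : ℕ) : ∀ (k : ℕ) (w : M → ℝ),
      ContMDiff (I n) 𝓘(ℝ, ℝ) ∞ w →
        ContDiffOn ℝ N (fun t => ∫ p, w p * (f p + t * g p)⁻¹ ^ k ∂m) s := by
  -- The derivative is an integral of the same kind with exponent `k + 1` and weight `w * (-k * g)`.
  -- The induction on the order of smoothness therefore runs over all exponents and weights at once.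
  have hd : ∀ (k : ℕ) (w : M → ℝ), ContMDiff (I n) 𝓘(ℝ, ℝ) ∞ w → ∀ t ∈ s,
      HasDerivAt (fun t => ∫ p, w p * (f p + t * g p)⁻¹ ^ k ∂m)
        (∫ p, w p * (-k * g p) * (f p + t * g p)⁻¹ ^ (k + 1) ∂m) t := fun k w hw t ht => by
    have := hasDerivAt_integral_affine_inv_pow (m := m) hw hf hg
      (eventually_of_mem (hs.mem_nhds ht) h0) k
    simpa only [mul_assoc] using this
  induction N with
  | zero =>
    intro k w hw
    exact contDiffOn_zero.2 fun t ht => (hd k w hw t ht).continuousAt.continuousWithinAt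
  | succ N ih =>
    intro k w hw
    push_cast
    rw [contDiffOn_succ_iff_deriv_of_isOpen hs]
    refine ⟨fun t ht => (hd k w hw t ht).differentiableAt.differentiableWithinAt, by simp, ?_⟩
    refine (ih (k + 1) (fun p => w p * (-k * g p)) (hw.mul (contMDiff_const.mul hg))).congr
      fun t ht => (hd k w hw t ht).deriv

end InvPow

/-! ### Convexity and Hessian of the volume functional. -/

namespace SasakianStructure

variable {n : ℕ} {M : Type*} [TopologicalSpace M] [ChartedSpace (E n) M] [IsManifold (I n) ∞ M]
  {S : SasakianStructure n M}

theorem xi_add_mem_crPos {X : M → E n} (hX : X ∈ S.cr) {t : ℝ}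
    (h : ∀ p, 0 < 1 + t * S.eta p (X p)) : (fun p => S.xi p + t • X p) ∈ S.crPos := by
  have h1 := S.combination_mem_cr S.xi_mem_cr hX 1 t
  simp only [one_smul] at h1
  refine ⟨h1, fun p => ?_⟩
  change 0 < S.eta p (S.xi p + t • X p)
  rw [map_add, map_smul, eta_xi, smul_eq_mul]
  exact h p

theorem smul_mem_crPos {X : M → E n} (hX : X ∈ S.crPos) {c : ℝ} (hc : 0 < c) :
    (fun p => c • X p) ∈ S.crPos := by
  have h1 := S.combination_mem_cr hX.1 hX.1 c 0
  simp only [zero_smul, add_zero] at h1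
  refine ⟨h1, fun p => ?_⟩
  change 0 < S.eta p (c • X p)
  rw [map_smul, smul_eq_mul]
  exact mul_pos hc (hX.2 p)

theorem combination_mem_crPos {X Y : M → E n} (hX : X ∈ S.crPos) (hY : Y ∈ S.crPos) {a b : ℝ}
    (ha : 0 ≤ a) (hb : 0 ≤ b) (hab : a + b = 1) : (fun p => a • X p + b • Y p) ∈ S.crPos := by
  refine ⟨S.combination_mem_cr hX.1 hY.1 a b, fun p => ?_⟩
  change 0 < S.eta p (a • X p + b • Y p)
  rw [map_add, map_smul, map_smul, smul_eq_mul, smul_eq_mul]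
  rcases ha.eq_or_lt with rfl | ha
  · obtain rfl : b = 1 := by linarith
    simpa using eta_pos hY p
  · exact add_pos_of_pos_of_nonneg (mul_pos ha (eta_pos hX p)) (mul_nonneg hb (eta_pos hY p).le)

variable [CompactSpace M] [MeasurableSpace M] [BorelSpace M]

theorem integrable_coneVolume {X : M → E n} (hX : X ∈ S.crPos) :
    Integrable (fun p => (S.eta p (X p))⁻¹ ^ (n + 1)) S.μ :=
  integrable_of_continuous ((contMDiff_inv_eta hX).continuous.pow (n + 1))

variable [T2Space M]

/-- The integrand is x^(-(n+1)) at x = η(X) > 0. It is convex in x, and x is linear in X, so the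
inequality holds pointwise and is then integrated. -/
theorem coneVolume_combination_le {X Y : M → E n} (hX : X ∈ S.crPos) (hY : Y ∈ S.crPos) {a b : ℝ}
    (ha : 0 ≤ a) (hb : 0 ≤ b) (hab : a + b = 1) :
    S.coneVolume (fun p => a • X p + b • Y p) ≤ a * S.coneVolume X + b * S.coneVolume Y := by
  have hZ := combination_mem_crPos hX hY ha hb hab
  rw [coneVolume_eq hZ, coneVolume_eq hX, coneVolume_eq hY,
    ← integral_const_mul, ← integral_const_mul,
    ← integral_add ((integrable_coneVolume hX).const_mul a) ((integrable_coneVolume hY).const_mul b)]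
  refine integral_mono (integrable_coneVolume hZ)
    (((integrable_coneVolume hX).const_mul a).add ((integrable_coneVolume hY).const_mul b)) fun p => ?_
  have hc := (convexOn_zpow (𝕜 := ℝ) (-(n + 1 : ℕ) : ℤ)).2 (eta_pos hX p) (eta_pos hY p) ha hb hab
  simp only [zpow_neg, zpow_natCast, smul_eq_mul, ← inv_pow] at hc
  simpa only [map_add, map_smul, smul_eq_mul] using hc

/-- The volume functional is convex. -/
theorem convexOn_coneVolume (S : SasakianStructure n M) : ConvexOn ℝ S.crPos S.coneVolume :=
  ⟨fun _ hX _ hY _ _ ha hb hab => combination_mem_crPos hX hY ha hb hab,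
    fun _ hX _ hY _ _ ha hb hab => coneVolume_combination_le hX hY ha hb hab⟩

/-- The Hessian of the volume functional. -/
theorem hessian_coneVolume {X Y : M → E n} (hX : X ∈ S.cr) (hY : Y ∈ S.cr) : ∃ D : ℝ → ℝ,
      (∀ᶠ s in 𝓝 (0 : ℝ),
        HasDerivAt (fun t : ℝ => S.coneVolume (fun p => S.xi p + s • X p + t • Y p)) (D s) 0) ∧
      HasDerivAt D (((n : ℝ) + 1) * (n + 2) * ∫ p, S.eta p (X p) * S.eta p (Y p) ∂S.μ) 0 := by
  set a : M → ℝ := fun p => S.eta p (X p) with ha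
  set b : M → ℝ := fun p => S.eta p (Y p) with hb
  have has : ContMDiff (I n) 𝓘(ℝ, ℝ) ∞ a := contMDiff_eta hX
  have hbs : ContMDiff (I n) 𝓘(ℝ, ℝ) ∞ b := contMDiff_eta hY
  have h1s : ContMDiff (I n) 𝓘(ℝ, ℝ) ∞ fun _ : M => (1 : ℝ) := contMDiff_const
  have hE1 := eventually_forall_pos continuous_const has.continuous fun _ : M => one_pos (α := ℝ)
  -- The t-derivative at 0 of the integral of (1 + sa + tb)^(-(n+1)), for s so small that 1 + sa
  -- stays positive. Differentiating once more in s at 0 brings down the factor n+2.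
  refine ⟨fun s => ∫ p, -(n + 1) * b p * (1 + s * a p)⁻¹ ^ (n + 2) ∂S.μ, ?_, ?_⟩
  · filter_upwards [hE1] with s hs
    have hfs : ContMDiff (I n) 𝓘(ℝ, ℝ) ∞ fun p => 1 + s * a p := h1s.add (contMDiff_const.mul has)
    have hE2 := eventually_forall_pos hfs.continuous hbs.continuous hs
    have h3 := hasDerivAt_integral_affine_inv_pow (m := S.μ) h1s hfs hbs hE2 (n + 1)
    refine (h3.congr_of_eventuallyEq ?_).congr_deriv ?_
    · filter_upwards [hE2] with t ht
      have hs' := S.combination_mem_cr hX hY s t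
      have hmem := xi_add_mem_crPos hs' (t := 1) fun p => by
        have := ht p
        simp only [map_add, map_smul, smul_eq_mul]
        linarith
      have e : (fun p => S.xi p + s • X p + t • Y p) = fun p => S.xi p + (1 : ℝ) • (s • X p + t • Y p) := by
        funext p; rw [one_smul, add_assoc]
      refine (congrArg S.coneVolume e).trans ((coneVolume_eq hmem).trans ?_)
      refine integral_congr_ae (Eventually.of_forall fun p => ?_)
      simp only [map_add, map_smul, smul_eq_mul, eta_xi, one_smul, one_mul, ha, hb]
      rw [add_assoc]
    · refine integral_congr_ae (Eventually.of_forall fun p => ?_)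
      push_cast
      simp
  · have h3 := hasDerivAt_integral_affine_inv_pow (m := S.μ)
      (w := fun p => -(n + 1) * b p) (contMDiff_const.mul hbs) h1s has hE1 (n + 2)
    refine h3.congr_deriv ?_
    rw [← integral_const_mul]
    refine integral_congr_ae (Eventually.of_forall fun p => ?_)
    push_cast
    simp
    ring

end SasakianStructure

/-! ### Volume preserving paths in the cone. -/

namespace SasakianStructure

variable {n : ℕ} {M : Type*} [TopologicalSpace M] [ChartedSpace (E n) M] [IsManifold (I n) ∞ M]
  {S : SasakianStructure n M}

/-- A smooth family of vector fields paired with a smooth 1-form. -/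
theorem jointSmoothAt_apply {α : M → E n →L[ℝ] ℝ} (hα : SmoothForm α) {ε : ℝ} {ζ : ℝ → M → E n}
    (hζ : SmoothFamily (n := n) ε ζ) {t : ℝ} (ht : t ∈ Ioo (-ε) ε) :
    JointSmoothAt n (fun t p => α p (ζ t p)) t := fun x => by
  have hx := ext_mem_target (n := n) x
  have h1 : ContDiffAt ℝ ∞ (fun q : ℝ × E n => formRep x α q.2) (t, extChartAt (I n) x x) :=
    ContDiffAt.comp (g := formRep x α) (f := Prod.snd) (t, extChartAt (I n) x x) (hα x _ hx)
      contDiffAt_snd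
  refine (h1.clm_apply (contDiffAt_fieldRep_family hζ ht hx)).congr_of_eventuallyEq ?_
  have h2 : ∀ᶠ q : ℝ × E n in 𝓝 (t, extChartAt (I n) x x), q.2 ∈ (extChartAt (I n) x).target :=
    continuousAt_snd.eventually (target_mem_nhds hx)
  filter_upwards [h2] with q hq
  rw [formRep_fieldRep hq]

omit [IsManifold (I n) ∞ M] in
theorem hasDerivAt_apply {α : M → E n →L[ℝ] ℝ} {ζ : ℝ → M → E n} {ζ' : M → E n}
    (h : HasVelocity (n := n) ζ ζ') (p : M) : HasDerivAt (fun t => α p (ζ t p)) (α p (ζ' p)) 0 :=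
  (α p).hasFDerivAt.comp_hasDerivAt 0 (h p)

variable [T2Space M] [CompactSpace M] [MeasurableSpace M] [BorelSpace M]

/-- Since η(ξ) = 1, the volume along the path has derivative -(n+1)∫η(X) at the start. It is also
constant, and n+1 is not zero. -/
theorem integral_eta_eq_zero_of_path {X : M → E n} {ε : ℝ} {ζ : ℝ → M → E n} (hε : 0 < ε)
    (h0 : ζ 0 = S.xi) (hζ : SmoothFamily (n := n) ε ζ) (hpos : ∀ t ∈ Ioo (-ε) ε, ζ t ∈ S.crPos)
    (hv : HasVelocity (n := n) ζ X)
    (hvol : ∀ t ∈ Ioo (-ε) ε, S.coneVolume (ζ t) = S.coneVolume S.xi) :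
    ∫ p, S.eta p (X p) ∂S.μ = 0 := by
  have hI : Ioo (-ε) ε ∈ 𝓝 (0 : ℝ) := Ioo_mem_nhds (by linarith) hε
  have h1 := hasDerivAt_integral_inv_pow (m := S.μ) (w := fun _ => 1) contMDiff_const
    (jointSmoothAt_apply S.smoothForm_eta hζ (mem_of_mem_nhds hI))
    (fun p => hasDerivAt_apply (α := S.eta) hv p) (by
      filter_upwards [hI] with t ht
      exact ⟨(contMDiff_eta (hpos t ht).1).continuous, eta_pos (hpos t ht)⟩) (n + 1)
  have h2 : HasDerivAt (fun t => ∫ p, 1 * (S.eta p (ζ t p))⁻¹ ^ (n + 1) ∂S.μ) 0 0 := by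
    refine (hasDerivAt_const (0 : ℝ) (S.coneVolume S.xi)).congr_of_eventuallyEq ?_
    filter_upwards [hI] with t ht
    rw [← hvol t ht, coneVolume_eq (hpos t ht)]
    simp only [one_mul]
  have h3 := h1.unique h2
  simp only [h0, eta_xi, one_mul, inv_one, one_pow, mul_one, integral_const_mul] at h3
  have h4 : -((n + 1 : ℕ) : ℝ) ≠ 0 := neg_ne_zero.2 (Nat.cast_ne_zero.2 n.succ_ne_zero)
  exact (mul_eq_zero.1 h3).resolve_left h4

/-- Fields with mean value zero are velocities of volume preserving paths. -/
theorem exists_path_of_integral_eq_zero {X : M → E n} (hX : X ∈ S.cr)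
    (h0 : ∫ p, S.eta p (X p) ∂S.μ = 0) : ∃ (ε : ℝ) (ζ : ℝ → M → E n),
      0 < ε ∧ ζ 0 = S.xi ∧ SmoothFamily (n := n) ε ζ ∧ (∀ t ∈ Ioo (-ε) ε, ζ t ∈ S.crPos) ∧
        HasVelocity (n := n) ζ X ∧ ∀ t ∈ Ioo (-ε) ε, S.coneVolume (ζ t) = S.coneVolume S.xi := by
  set f : M → ℝ := fun p => S.eta p (X p) with hf
  have hfs : ContMDiff (I n) 𝓘(ℝ, ℝ) ∞ f := contMDiff_eta hX
  have h1s : ContMDiff (I n) 𝓘(ℝ, ℝ) ∞ fun _ : M => (1 : ℝ) := contMDiff_const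
  have hE := eventually_forall_pos continuous_const hfs.continuous fun _ : M => one_pos (α := ℝ)
  obtain ⟨ε, hε, hεf⟩ := Metric.eventually_nhds_iff.1 hE
  have hεI : ∀ t ∈ Ioo (-ε) ε, ∀ p, 0 < 1 + t * f p := fun t ht => hεf (by
    rw [Real.dist_eq, sub_zero, abs_lt]; exact ht)
  have h0I : (0 : ℝ) ∈ Ioo (-ε) ε := ⟨by linarith, hε⟩
  set V : ℝ → ℝ := fun t => ∫ p, 1 * (1 + t * f p)⁻¹ ^ (n + 1) ∂S.μ with hV
  -- Scaling a field by c multiplies its volume by c^(-(n+1)), so c = (V t / V 0)^(1/(n+1)) brings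
  -- the volume of ξ + tX back to that of ξ. The velocity at 0 stays X because c'(0) = 0.
  obtain ⟨c, hcs, hc0, hcd, hcpos, hcV⟩ : ∃ c : ℝ → ℝ, ContDiffOn ℝ ∞ c (Ioo (-ε) ε) ∧ c 0 = 1 ∧
      HasDerivAt c 0 0 ∧ (∀ t ∈ Ioo (-ε) ε, 0 < c t) ∧
        ∀ t ∈ Ioo (-ε) ε, (c t)⁻¹ ^ (n + 1) * V t = V 0 := by
    -- On the empty manifold V vanishes and the quotient is useless; the constant 1 serves instead.
    rcases isEmpty_or_nonempty M with hM | hM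
    · refine ⟨fun _ => 1, contDiffOn_const, rfl, hasDerivAt_const _ _, fun _ _ => one_pos, fun t _ => ?_⟩
      simp [hV, Measure.eq_zero_of_isEmpty]
    have hVpos : ∀ t ∈ Ioo (-ε) ε, 0 < V t := fun t ht => by
      have hcont : Continuous fun p => 1 * (1 + t * f p)⁻¹ ^ (n + 1) :=
        continuous_const.mul (((continuous_const.add (continuous_const.mul hfs.continuous)).inv₀
          fun p => (hεI t ht p).ne').pow _)
      refine hcont.integral_pos_of_hasCompactSupport_nonneg_nonzero
        (HasCompactSupport.of_compactSpace _) (fun p => ?_) (x := Classical.arbitrary M) ?_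
      · have := hεI t ht p; positivity
      · have := hεI t ht (Classical.arbitrary M); positivity
    have hVs : ContDiffOn ℝ ∞ V (Ioo (-ε) ε) := contDiffOn_infty.2 fun N =>
      contDiffOn_integral_affine_inv_pow h1s hfs isOpen_Ioo hεI N (n + 1) _ h1s
    -- The derivative is -(n+1)∫η(X). This is where the mean value zero of η(X) is used.
    have hVd : HasDerivAt V 0 0 := by
      have := hasDerivAt_integral_affine_inv_pow (m := S.μ) h1s h1s hfs hE (n + 1)
      refine this.congr_deriv ?_
      simp only [zero_mul, add_zero, inv_one, one_pow, mul_one, one_mul, integral_const_mul]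
      rw [h0, mul_zero]
    have hV0 := (hVpos 0 h0I).ne'
    refine ⟨fun t => (V t / V 0) ^ ((n + 1 : ℕ) : ℝ)⁻¹, ?_, ?_, ?_, ?_, ?_⟩
    · exact (hVs.div_const _).rpow_const_of_ne fun t ht => (div_pos (hVpos t ht) (hVpos 0 h0I)).ne'
    · beta_reduce
      rw [div_self hV0, Real.one_rpow]
    · have h5 := (hVd.div_const (V 0)).rpow_const (p := ((n + 1 : ℕ) : ℝ)⁻¹)
        (Or.inl (div_ne_zero hV0 hV0))
      simpa using h5
    · exact fun t ht => Real.rpow_pos_of_pos (div_pos (hVpos t ht) (hVpos 0 h0I)) _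
    · intro t ht
      rw [inv_pow, Real.rpow_inv_natCast_pow (div_pos (hVpos t ht) (hVpos 0 h0I)).le n.succ_ne_zero,
        inv_div, div_mul_cancel₀ _ (hVpos t ht).ne']
  have hmem : ∀ t ∈ Ioo (-ε) ε, (fun p => c t • (S.xi p + t • X p)) ∈ S.crPos := fun t ht =>
    smul_mem_crPos (xi_add_mem_crPos hX (hεI t ht)) (hcpos t ht)
  have hvol : ∀ t ∈ Ioo (-ε) ε, S.coneVolume (fun p => c t • (S.xi p + t • X p)) = V 0 := by
    intro t ht
    rw [coneVolume_eq (hmem t ht), ← hcV t ht, hV, ← integral_const_mul]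
    refine integral_congr_ae (Eventually.of_forall fun p => ?_)
    simp only [map_add, map_smul, smul_eq_mul, eta_xi, mul_inv, mul_pow, one_mul, hf]
  have hz0 : (fun p => c 0 • (S.xi p + (0 : ℝ) • X p)) = S.xi := by
    funext p; rw [hc0, zero_smul, add_zero, one_smul]
  refine ⟨ε, fun t p => c t • (S.xi p + t • X p), hε, hz0, ?_, hmem, fun p => ?_, fun t ht => ?_⟩
  · rintro ⟨t, p⟩ hp
    have hsnd : ContMDiffWithinAt (𝓘(ℝ, ℝ).prod (I n)) (I n) ∞ (Prod.snd : ℝ × M → M)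
        (Ioo (-ε) ε ×ˢ univ) (t, p) := contMDiffWithinAt_snd
    have hfst : ContMDiffWithinAt (𝓘(ℝ, ℝ).prod (I n)) 𝓘(ℝ, ℝ) ∞ (Prod.fst : ℝ × M → ℝ)
        (Ioo (-ε) ε ×ˢ univ) (t, p) := contMDiffWithinAt_fst
    have hsrc := mem_extChartAt_source (I := I n) p
    have hrep : ∀ W : M → E n, SmoothField (n := n) W →
        ContMDiffWithinAt (𝓘(ℝ, ℝ).prod (I n)) 𝓘(ℝ, E n) ∞ (fun q : ℝ × M => coframe p q.2 (W q.2))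
          (Ioo (-ε) ε ×ˢ univ) (t, p) := fun W hW =>
      (contMDiffWithinAt_vector_iff (v := fun q : ℝ × M => W q.2) p hsnd hsrc).1
        ((ContMDiff.comp hW contMDiff_snd).contMDiffAt.contMDiffWithinAt)
    refine (contMDiffWithinAt_vector_iff (v := fun q : ℝ × M => c q.1 • (S.xi q.2 + q.1 • X q.2))
      p hsnd hsrc).2 ?_
    simp only [map_smul, map_add]
    have hcM : ContMDiffWithinAt (𝓘(ℝ, ℝ).prod (I n)) 𝓘(ℝ, ℝ) ∞ (fun q : ℝ × M => c q.1)
        (Ioo (-ε) ε ×ˢ univ) (t, p) :=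
      (hcs.contDiffAt (isOpen_Ioo.mem_nhds hp.1)).contMDiffAt.comp_contMDiffWithinAt (t, p) hfst
    exact hcM.smul ((hrep _ S.smoothField_xi).add (hfst.smul (hrep _ (S.mem_cr_iff.1 hX).1)))
  · have h6 : HasDerivAt (fun t : ℝ => S.xi p + t • X p) (X p) 0 := by
      simpa using ((hasDerivAt_id (0 : ℝ)).smul_const (X p)).const_add (S.xi p)
    have h7 := hcd.smul h6
    rw [hc0, one_smul, zero_smul, add_zero] at h7
    exact h7
  · have h8 := hvol 0 h0I
    rw [hz0] at h8
    rw [h8]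
    exact hvol t ht

end SasakianStructure

/-! ### Families of forms in coordinates; solving B(Z, ·) = l. -/

section FormFamilies

variable {n : ℕ}

theorem contDiffAt_formB_family {A : ℝ × E n → E n →L[ℝ] ℝ} {q₀ : ℝ × E n}
    (h : ContDiffAt ℝ ∞ A q₀) (v w : E n) :
    ContDiffAt ℝ ∞ (fun q : ℝ × E n => formB (fun y => A (q.1, y)) q.2 v w) q₀ := by
  have hd : ∀ v w, ContDiffAt ℝ ∞ (fun q : ℝ × E n => fderiv ℝ A q (0, v) w) q₀ := fun v w =>
    ((contDiffAt_fderiv h).clm_apply contDiffAt_const).clm_apply contDiffAt_const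
  refine (((hd v w).sub (hd w v)).add ((h.clm_apply (contDiffAt_const (c := v))).mul
    (h.clm_apply (contDiffAt_const (c := w))))).congr_of_eventuallyEq ?_
  filter_upwards [eventually_differentiableAt h] with q hq
  rw [formB_apply, extD, fderiv_slice hq, fderiv_slice hq]

theorem formB'_congr (a : E n → E n →L[ℝ] ℝ) {c c' : E n → E n →L[ℝ] ℝ} {z : E n}
    (h : c =ᶠ[𝓝 z] c') : formB' a c z = formB' a c' z := by
  ext v w
  simp only [formB'_apply, extD, h.fderiv_eq, h.eq_of_nhds]

theorem hasDerivAt_formB_family {A : ℝ × E n → E n →L[ℝ] ℝ} {t : ℝ} {z : E n}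
    (h : ContDiffAt ℝ ∞ A (t, z)) (v w : E n) :
    HasDerivAt (fun s => formB (fun y => A (s, y)) z v w)
      (formB' (fun y => A (t, y)) (fun y => timeDeriv A (t, y)) z v w) t := by
  have h1 : ∀ v w, HasDerivAt (fun s => fderiv ℝ (fun y => A (s, y)) z v w)
      (fderiv ℝ (fun y => timeDeriv A (t, y)) z v w) t := fun v w =>
    ((hasDerivAt_fderiv_family h v).clm_apply (hasDerivAt_const t w)).congr_deriv (by simp)
  have h2 : ∀ v, HasDerivAt (fun s => A (s, z) v) (timeDeriv A (t, z) v) t := fun v =>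
    ((hasDerivAt_timeDeriv (h.differentiableAt (by simp))).clm_apply
      (hasDerivAt_const t v)).congr_deriv (by simp)
  exact ((h1 v w).fun_sub (h1 w v)).fun_add ((h2 v).fun_mul (h2 w))

/-- The vector `Z` with `B (Z, ·) = l`. -/
def bsolve (B : LinearMap.BilinForm ℝ (E n)) (l : E n →L[ℝ] ℝ) : E n :=
  WithLp.toLp 2 (Matrix.vecMul (fun j => l (stdBasis n j)) (bmat B)⁻¹)

theorem bsolve_spec {B : LinearMap.BilinForm ℝ (E n)} (hB : bdet B ≠ 0) (l : E n →L[ℝ] ℝ) (w : E n) :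
    B (bsolve B l) w = l w := by
  have hu : IsUnit (bmat B).det := isUnit_iff_ne_zero.2 hB
  have h1 : B (bsolve B l) = (l : E n →ₗ[ℝ] ℝ) := by
    refine (stdBasis n).ext fun j => ?_
    have h2 : Matrix.vecMul (bsolve B l : Fin (2 * n + 1) → ℝ) (bmat B) = fun j => l (stdBasis n j) := by
      change Matrix.vecMul (Matrix.vecMul (fun j => l (stdBasis n j)) (bmat B)⁻¹) (bmat B) = _
      rw [Matrix.vecMul_vecMul, Matrix.nonsing_inv_mul _ hu, Matrix.vecMul_one]
    have h3 := congrFun h2 j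
    refine Eq.trans ?_ h3
    conv_lhs => rw [← sum_smul_stdBasis (bsolve B l)]
    simp only [Matrix.vecMul, dotProduct, bmat_apply, map_sum, map_smul, LinearMap.sum_apply,
      LinearMap.smul_apply, smul_eq_mul]
  exact DFunLike.congr_fun h1 w

theorem eq_of_forall_bilin {B : LinearMap.BilinForm ℝ (E n)} (hB : bdet B ≠ 0) {v v' : E n}
    (h : ∀ w, B v w = B v' w) : v = v' := by
  have hu : IsUnit (bmat B).det := isUnit_iff_ne_zero.2 hB
  have h0 : ∀ v : E n, Matrix.vecMul (v : Fin (2 * n + 1) → ℝ) (bmat B) = fun j => B v (stdBasis n j) := by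
    intro v
    funext j
    conv_rhs => rw [← sum_smul_stdBasis v]
    simp only [Matrix.vecMul, dotProduct, bmat_apply, map_sum, map_smul, LinearMap.sum_apply,
      LinearMap.smul_apply, smul_eq_mul]
  have h1 : Matrix.vecMul (v : Fin (2 * n + 1) → ℝ) (bmat B) = Matrix.vecMul v' (bmat B) := by
    rw [h0, h0]; funext j; exact h _
  have h2 := congrArg (fun u => Matrix.vecMul u (bmat B)⁻¹) h1
  simp only [Matrix.vecMul_vecMul, Matrix.mul_nonsing_inv _ hu, Matrix.vecMul_one] at h2
  ext i
  exact congrFun h2 i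

theorem contDiffAt_bsolve {F : Type*} [NormedAddCommGroup F] [NormedSpace ℝ F]
    {B : F → LinearMap.BilinForm ℝ (E n)} {l : F → E n →L[ℝ] ℝ} {q : F}
    (hB : ∀ v w, ContDiffAt ℝ ∞ (fun y => B y v w) q) (hl : ContDiffAt ℝ ∞ l q)
    (h0 : bdet (B q) ≠ 0) : ContDiffAt ℝ ∞ (fun y => bsolve (B y) (l y)) q := by
  rw [contDiffAt_euclidean]
  intro i
  change ContDiffAt ℝ ∞ (fun y => ∑ j, l y (stdBasis n j) * (bmat (B y))⁻¹ j i) q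
  refine ContDiffAt.sum fun j _ => (hl.clm_apply contDiffAt_const).mul (contDiffAt_inv (A := fun y => bmat (B y)) ?_ h0 j i)
  intro i j
  simp only [bmat_apply]
  exact hB _ _

/-- A change of frame acts on both forms by congruence, hence on the product of the inverse of one
with the other by conjugation. The logarithmic derivative of the density is thus a function on `M`.
-/
theorem trace_inv_mul_comp {B C : LinearMap.BilinForm ℝ (E n)} {L : E n →ₗ[ℝ] E n}
    (hL : LinearMap.det L ≠ 0) :
    ((bmat (B.comp L L))⁻¹ * bmat (C.comp L L)).trace = ((bmat B)⁻¹ * bmat C).trace := by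
  set T := LinearMap.toMatrix (stdBasis n) (stdBasis n) L with hT
  have hTu : IsUnit T.det := by rw [hT, LinearMap.det_toMatrix]; exact isUnit_iff_ne_zero.2 hL
  have hTtu : IsUnit T.transpose.det := by rwa [Matrix.det_transpose]
  have h1 : ∀ D : LinearMap.BilinForm ℝ (E n), bmat (D.comp L L) = T.transpose * bmat D * T := fun D =>
    LinearMap.BilinForm.toMatrix_comp (stdBasis n) (stdBasis n) D L L
  rw [h1, h1, Matrix.mul_inv_rev, Matrix.mul_inv_rev, Matrix.mul_assoc, Matrix.trace_mul_comm]
  simp only [Matrix.mul_assoc]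
  rw [Matrix.mul_nonsing_inv _ hTu, Matrix.mul_one, Matrix.nonsing_inv_mul_cancel_left _ _ hTtu]

end FormFamilies

/-! ### First variation of the density and of the volume; the divergence principle. -/

section Variation

variable {n : ℕ} {M : Type*} [TopologicalSpace M] [ChartedSpace (E n) M]

/-- The bilinear form `dγ + γ ⊗ α + α ⊗ γ` at a point. -/
def contactB' (α γ : M → E n →L[ℝ] ℝ) (p : M) : LinearMap.BilinForm ℝ (E n) :=
  formB' (formRep p α) (formRep p γ) (extChartAt (I n) p p)

/-- The logarithmic derivative of the determinant of `dα + α ⊗ α` in the direction `γ`. -/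
def contactTrace (α γ : M → E n →L[ℝ] ℝ) (p : M) : ℝ :=
  ((bmat (contactB α p))⁻¹ * bmat (contactB' α γ p)).trace

/-- The family of 1-forms `α t` is jointly smooth near `{t₀} × M`. -/
def JointSmoothForm (α : ℝ → M → E n →L[ℝ] ℝ) (t₀ : ℝ) : Prop :=
  ∀ x : M, ContDiffAt ℝ ∞ (fun q : ℝ × E n => formRep x (α q.1) q.2) (t₀, extChartAt (I n) x x)

theorem formRep_hasDerivAt {α : ℝ → M → E n →L[ℝ] ℝ} {α' : M → E n →L[ℝ] ℝ} {t₀ : ℝ}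
    (hd : ∀ p, HasDerivAt (fun t => α t p) (α' p) t₀) (x : M) (z : E n) :
    HasDerivAt (fun t => formRep x (α t) z) (formRep x α' z) t₀ := by
  have := (hd ((extChartAt (I n) x).symm z)).clm_comp (hasDerivAt_const t₀ (frame x z))
  exact this.congr_deriv (by rw [ContinuousLinearMap.comp_zero, add_zero]; rfl)

/-- Jacobi's formula at the centre of the preferred chart. The exterior derivative of the pointwise
velocity `α'` is the time derivative of the exterior derivative because mixed partials commute. -/
theorem hasDerivAt_contactDensity {α : ℝ → M → E n →L[ℝ] ℝ} {α' : M → E n →L[ℝ] ℝ} {t₀ : ℝ}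
    (hα : JointSmoothForm α t₀) (hd : ∀ p, HasDerivAt (fun t => α t p) (α' p) t₀) {p : M}
    (h0 : bdet (contactB (α t₀) p) ≠ 0) :
    HasDerivAt (fun t => contactDensity (α t) p)
      (contactDensity (α t₀) p * (contactTrace (α t₀) α' p / 2)) t₀ := by
  set A : ℝ × E n → E n →L[ℝ] ℝ := fun q => formRep p (α q.1) q.2 with hA
  have h1 : (fun y => timeDeriv A (t₀, y)) =ᶠ[𝓝 (extChartAt (I n) p p)] formRep p α' := by
    have hc : ContinuousAt (fun z : E n => (t₀, z)) (extChartAt (I n) p p) := by fun_prop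
    filter_upwards [hc.eventually (eventually_differentiableAt (hα p))] with z hz
    exact (hasDerivAt_timeDeriv hz).unique (formRep_hasDerivAt hd p z)
  have h2 : ∀ i j, HasDerivAt (fun t => bmat (contactB (α t) p) i j)
      (bmat (contactB' (α t₀) α' p) i j) t₀ := by
    intro i j
    have := hasDerivAt_formB_family (hα p) (stdBasis n i) (stdBasis n j)
    rw [formB'_congr _ h1] at this
    simp only [bmat_apply]
    exact this
  exact hasDerivAt_sqrt_abs (hasDerivAt_det h2 h0) h0

variable [IsManifold (I n) ∞ M]

/-- Quotients are the right objects: the frame determinant hidden in each density cancels, leaving a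
function whose smoothness can be read off in any one chart. -/
theorem jointSmoothAt_contactDensity_div {α : ℝ → M → E n →L[ℝ] ℝ} {β : M → E n →L[ℝ] ℝ} {t₀ : ℝ}
    (hα : JointSmoothForm α t₀) (hs : ∀ᶠ t in 𝓝 t₀, SmoothForm (α t))
    (h0 : ∀ p, bdet (contactB (α t₀) p) ≠ 0) (hβ : SmoothForm β)
    (hβ0 : ∀ p, bdet (contactB β p) ≠ 0) :
    JointSmoothAt n (fun t p => contactDensity (α t) p / contactDensity β p) t₀ := by
  intro x
  have hx := ext_mem_target (n := n) x
  have h1 : ContDiffAt ℝ ∞ (fun q : ℝ × E n => √|bdet (formB (formRep x (α q.1)) q.2)|)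
      (t₀, extChartAt (I n) x x) := by
    refine contDiffAt_sqrt_abs (contDiffAt_det fun i j => ?_)
      (bdet_formB_formRep_ne_zero hs.self_of_nhds h0 hx)
    simp only [bmat_apply]
    exact contDiffAt_formB_family (hα x) _ _
  have h2 : ContDiffAt ℝ ∞ (fun q : ℝ × E n => √|bdet (formB (formRep x β) q.2)|)
      (t₀, extChartAt (I n) x x) :=
    ContDiffAt.comp (g := fun z => √|bdet (formB (formRep x β) z)|) (f := Prod.snd)
      (t₀, extChartAt (I n) x x) (contDiffAt_sqrt_abs (contDiffAt_bdet_formB (hβ x _ hx))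
        (bdet_formB_formRep_ne_zero hβ hβ0 hx)) contDiffAt_snd
  have h3 : √|bdet (formB (formRep x β) (extChartAt (I n) x x))| ≠ 0 :=
    (Real.sqrt_pos.2 (abs_pos.2 (bdet_formB_formRep_ne_zero hβ hβ0 hx))).ne'
  refine (h1.div h2 h3).congr_of_eventuallyEq ?_
  have e1 : ∀ᶠ q : ℝ × E n in 𝓝 (t₀, extChartAt (I n) x x), q.2 ∈ (extChartAt (I n) x).target :=
    continuousAt_snd.eventually (target_mem_nhds hx)
  have e2 : ∀ᶠ q : ℝ × E n in 𝓝 (t₀, extChartAt (I n) x x), SmoothForm (α q.1) :=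
    hs.prod_inl_nhds _
  filter_upwards [e1, e2] with q hq hqs
  rw [Pi.div_apply, ← chartDensity_contactDensity hqs hq, ← chartDensity_contactDensity hβ hq,
    chartDensity, chartDensity, mul_div_mul_left _ _ (abs_pos.2 (frame_det_ne_zero hq)).ne']

omit [IsManifold (I n) ∞ M] in
theorem JointSmoothAt.eventually_pos [CompactSpace M] {F : ℝ → M → ℝ} {t₀ : ℝ}
    (h : JointSmoothAt n F t₀) (h0 : ∀ p, 0 < F t₀ p) : ∀ᶠ t in 𝓝 t₀, ∀ p, 0 < F t p := by
  have h1 := isCompact_univ.eventually_forall_of_forall_eventually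
    (P := fun (t : ℝ) (p : M) => 0 < F t p) (x₀ := t₀) fun x _ => by
      have hc : ContinuousAt (fun q : ℝ × M => (q.1, extChartAt (I n) x q.2)) (t₀, x) :=
        continuousAt_fst.prodMk ((continuousAt_extChartAt x).comp (x := (t₀, x)) continuousAt_snd)
      have h2 := (h x).continuousAt.eventually_const_lt (u := 0) (by simpa only [symm_ext] using h0 x)
      have h3 : ∀ᶠ q : ℝ × M in 𝓝 (t₀, x), q.2 ∈ (extChartAt (I n) x).source :=
        continuousAt_snd.eventually (extChartAt_source_mem_nhds x)
      filter_upwards [hc.eventually h2, h3] with q hq hqs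
      simpa only [(extChartAt (I n) x).left_inv hqs] using hq
  simpa using h1

theorem contactB'_apply {α γ : M → E n →L[ℝ] ℝ} (hγ : SmoothForm γ) (p : M) (v w : E n) :
    contactB' α γ p v w = extDeriv₁ γ p v w + (γ p v * α p w + α p v * γ p w) := by
  rw [contactB', formB'_apply, extDeriv₁_eq (hγ.differentiableAt (ext_mem_target p)), formRep_self,
    formRep_self]

theorem contactTrace_rep {α γ : M → E n →L[ℝ] ℝ} (hα : SmoothForm α) (hγ : SmoothForm γ)
    {x : M} {z : E n} (hz : z ∈ (extChartAt (I n) x).target) :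
    contactTrace α γ ((extChartAt (I n) x).symm z) =
      ((bmat (formB (formRep x α) z))⁻¹ * bmat (formB' (formRep x α) (formRep x γ) z)).trace := by
  have h1 : formB (formRep x α) z = (contactB α ((extChartAt (I n) x).symm z)).comp
      (frame x z : E n →ₗ[ℝ] E n) (frame x z : E n →ₗ[ℝ] E n) := by
    ext v w; exact formB_formRep hα hz v w
  have h2 : formB' (formRep x α) (formRep x γ) z = (contactB' α γ ((extChartAt (I n) x).symm z)).comp
      (frame x z : E n →ₗ[ℝ] E n) (frame x z : E n →ₗ[ℝ] E n) := by
    ext v w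
    refine Eq.trans ?_ (contactB'_apply hγ _ (frame x z v) (frame x z w)).symm
    rw [extDeriv₁_frame hz (hγ.differentiableAt hz), formB'_apply]
    rfl
  rw [h1, h2, trace_inv_mul_comp (frame_det_ne_zero hz)]
  rfl

theorem contMDiff_contactTrace {α γ : M → E n →L[ℝ] ℝ} (hα : SmoothForm α) (hγ : SmoothForm γ)
    (h0 : ∀ p, bdet (contactB α p) ≠ 0) : ContMDiff (I n) 𝓘(ℝ, ℝ) ∞ (contactTrace α γ) := by
  intro x
  have hx := ext_mem_target (n := n) x
  refine contMDiffAt_of_rep (ContDiffAt.congr_of_eventuallyEq (f := fun z =>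
    ((bmat (formB (formRep x α) z))⁻¹ * bmat (formB' (formRep x α) (formRep x γ) z)).trace) ?_ ?_)
  · simp only [Matrix.trace, Matrix.diag_apply, Matrix.mul_apply]
    refine ContDiffAt.sum fun i _ => ContDiffAt.sum fun j _ => (contDiffAt_inv
      (A := fun z => bmat (formB (formRep x α) z)) (fun k l => ?_) (bdet_formB_formRep_ne_zero hα h0 hx) i j).mul ?_
    · simp only [bmat_apply]
      exact contDiffAt_formB (hα x _ hx) _ _
    · simp only [bmat_apply, formB'_apply]
      have c1 := hα x _ hx
      have c2 := hγ x _ hx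
      exact (contDiffAt_extD c2 _ _).add (((c2.clm_apply contDiffAt_const).mul
        (c1.clm_apply contDiffAt_const)).add ((c1.clm_apply contDiffAt_const).mul
          (c2.clm_apply contDiffAt_const)))
  · filter_upwards [target_mem_nhds hx] with z hz using contactTrace_rep hα hγ hz

/-- The smooth vector field `Z` with `(dα + α ⊗ α) (Z, ·) = γ`. -/
theorem exists_contact_dual {α γ : M → E n →L[ℝ] ℝ} (hα : SmoothForm α) (hγ : SmoothForm γ)
    (h0 : ∀ p, bdet (contactB α p) ≠ 0) :
    ∃ Z : M → E n, SmoothField (n := n) Z ∧ ∀ p w, contactB α p (Z p) w = γ p w := by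
  refine ⟨fun p => bsolve (contactB α p) (γ p), smoothField_of_rep fun x => ?_,
    fun p w => bsolve_spec (h0 p) _ w⟩
  have hx := ext_mem_target (n := n) x
  refine (contDiffAt_bsolve (contDiffAt_formB (hα x _ hx)) (hγ x _ hx)
    (bdet_formB_formRep_ne_zero hα h0 hx)).congr_of_eventuallyEq ?_
  filter_upwards [target_mem_nhds hx] with z hz
  -- The solution is characterized by the form alone, so the pointwise solution, read in the chart
  -- at `x`, is the solution of the coordinate problem, which depends smoothly on the point.
  refine eq_of_forall_bilin (bdet_formB_formRep_ne_zero hα h0 hz) fun w => ?_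
  rw [bsolve_spec (bdet_formB_formRep_ne_zero hα h0 hz), formB_formRep hα hz]
  refine (congrArg (fun u => contactB α ((extChartAt (I n) x).symm z) u (frame x z w))
    (frame_fieldRep hz _)).trans ?_
  exact bsolve_spec (h0 _) _ _

/-- The divergence of `Z` with respect to the density of `α`, if `ι_Z dα = γ` and `α(Z)` is
constant. -/
theorem divE_contactDensity {α γ : M → E n →L[ℝ] ℝ} {Z : M → E n} {k : ℝ} (hα : SmoothForm α)
    (hγ : SmoothForm γ) (h0 : ∀ p, bdet (contactB α p) ≠ 0) (hZ : SmoothField (n := n) Z)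
    (hd : ∀ (p : M) (w : E n), extDeriv₁ α p (Z p) w = γ p w) (hk : ∀ p, α p (Z p) = k) {x : M} {z : E n}
    (hz : z ∈ (extChartAt (I n) x).target) :
    divE (fun y => chartDensity (contactDensity α) x y • fieldRep x Z y) z =
      chartDensity (contactDensity α) x z *
        (contactTrace α γ ((extChartAt (I n) x).symm z) / 2) := by
  have e1 : (fun y => chartDensity (contactDensity α) x y • fieldRep x Z y) =ᶠ[𝓝 z]
      fun y => √|bdet (formB (formRep x α) y)| • fieldRep x Z y := by
    filter_upwards [target_mem_nhds hz] with y hy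
    rw [chartDensity_contactDensity hα hy]
  rw [divE_congr e1, contactTrace_rep hα hγ hz, chartDensity_contactDensity hα hz]
  refine divE_density (k := k) (hα x z hz) (differentiableAt_fieldRep hZ hz)
    (hγ.differentiableAt hz) ?_ ?_ (bdet_formB_formRep_ne_zero hα h0 hz)
  · filter_upwards [target_mem_nhds hz] with y hy w
    rw [← extDeriv₁_frame hy (hα.differentiableAt hy)]
    refine Eq.trans ?_ (congrArg (fun u : E n => extDeriv₁ α ((extChartAt (I n) x).symm y) u
      (frame x y w)) (frame_fieldRep hy Z)).symm
    exact (hd _ _).symm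
  · filter_upwards [target_mem_nhds hz] with y hy
    rw [formRep_fieldRep hy, hk]

variable [CompactSpace M] [T2Space M] [MeasurableSpace M] [BorelSpace M]

theorem integral_contactTrace_eq_zero {α γ : M → E n →L[ℝ] ℝ} {Z : M → E n} {k : ℝ}
    (hα : SmoothForm α) (hγ : SmoothForm γ) (h0 : ∀ p, bdet (contactB α p) ≠ 0)
    (hZ : SmoothField (n := n) Z)
    (hd : ∀ (p : M) (w : E n), extDeriv₁ α p (Z p) w = γ p w) (hk : ∀ p, α p (Z p) = k) :
    ∫ p, contactTrace α γ p / 2 ∂(densityMeasure n (contactDensity α)) = 0 :=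
  integral_divergence (fun _ _ hz => contDiffAt_chartDensity hα h0 hz) (contactDensity_nonneg α)
    (fun _ _ hz => contDiffAt_fieldRep hZ hz)
    ((contMDiff_contactTrace hα hγ h0).continuous.div_const 2)
    fun _ _ hz => (divE_contactDensity hα hγ h0 hZ hd hk hz).symm

omit [T2Space M] in
/-- The first variation of the volume of a family of contact forms. -/
theorem hasDerivAt_volume {α : ℝ → M → E n →L[ℝ] ℝ} {α' : M → E n →L[ℝ] ℝ} {t₀ : ℝ}
    (hα : JointSmoothForm α t₀) (hs : ∀ᶠ t in 𝓝 t₀, SmoothForm (α t))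
    (hd : ∀ p, HasDerivAt (fun t => α t p) (α' p) t₀)
    (h0 : ∀ p, bdet (contactB (α t₀) p) ≠ 0) :
    HasDerivAt (fun t => (densityMeasure n (contactDensity (α t))).real univ)
      (∫ p, contactTrace (α t₀) α' p / 2 ∂(densityMeasure n (contactDensity (α t₀)))) t₀ := by
  have hβ := hs.self_of_nhds
  have hβc : ∀ x : M, ContinuousOn (chartDensity (contactDensity (α t₀)) x) (extChartAt (I n) x).target :=
    continuousOn_chartDensity hβ h0
  have := isFiniteMeasure_densityMeasure hβc
  have hJ := jointSmoothAt_contactDensity_div hα hs h0 hβ h0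
  have hpos : ∀ p, 0 < contactDensity (α t₀) p := fun p => contactDensity_pos (h0 p)
  -- Nondegeneracy is open: the quotient of densities equals 1 at `t₀`, stays positive nearby by
  -- compactness, and would vanish where the determinant does.
  have hne : ∀ᶠ t in 𝓝 t₀, ∀ p, bdet (contactB (α t) p) ≠ 0 := by
    filter_upwards [hJ.eventually_pos fun p => div_pos (hpos p) (hpos p)] with t ht p hp
    have := ht p
    simp [contactDensity, hp] at this
  have hcont : ∀ᶠ t in 𝓝 t₀, Continuous fun p => contactDensity (α t) p / contactDensity (α t₀) p := by
    filter_upwards [hne, hs] with t ht hts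
    have hc : JointSmoothForm (fun _ => α t) t₀ := fun x =>
      ContDiffAt.comp (g := formRep x (α t)) (f := Prod.snd) (t₀, extChartAt (I n) x x)
        (hts x _ (ext_mem_target x)) contDiffAt_snd
    exact (jointSmoothAt_contactDensity_div hc (Eventually.of_forall fun _ => hts) ht hβ h0).contMDiff.continuous
  have h1 := hJ.hasDerivAt_integral (m := densityMeasure n (contactDensity (α t₀)))
    (fun p => (hasDerivAt_contactDensity hα hd (h0 p)).div_const _) hcont
  refine (h1.congr_of_eventuallyEq ?_).congr_deriv ?_
  · filter_upwards [hcont] with t ht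
    have e : contactDensity (α t) = fun p => contactDensity (α t₀) p *
        (contactDensity (α t) p / contactDensity (α t₀) p) := by
      funext p; rw [mul_div_cancel₀ _ (hpos p).ne']
    rw [e, densityMeasure_mul hβc (contactDensity_nonneg _) ht.measurable, real_univ_withDensity ht
      fun p => div_nonneg (contactDensity_nonneg _ p) (contactDensity_nonneg _ p), ← e]
  · refine integral_congr_ae (Eventually.of_forall fun p => ?_)
    beta_reduce
    rw [mul_div_cancel_left₀ _ (hpos p).ne']

end Variation

/-! ### Segments of contact forms with a common Reeb field. -/

section Combinations

variable {n : ℕ} {M : Type*} [TopologicalSpace M] [ChartedSpace (E n) M] [IsManifold (I n) ∞ M]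

omit [IsManifold (I n) ∞ M] in
theorem formRep_add_smul (α β : M → E n →L[ℝ] ℝ) (s : ℝ) (x : M) :
    formRep x (fun p => α p + s • β p) = fun z => formRep x α z + s • formRep x β z := by
  funext z; simp [formRep, ContinuousLinearMap.add_comp, ContinuousLinearMap.smul_comp]

omit [IsManifold (I n) ∞ M] in
theorem smoothForm_add_smul {α β : M → E n →L[ℝ] ℝ} (hα : SmoothForm α) (hβ : SmoothForm β) (s : ℝ) :
    SmoothForm fun p => α p + s • β p := fun x z hz => by
  rw [formRep_add_smul]
  exact (hα x z hz).add ((hβ x z hz).const_smul s)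

theorem extDeriv₁_add_smul {α β : M → E n →L[ℝ] ℝ} (hα : SmoothForm α) (hβ : SmoothForm β) (s : ℝ)
    (p : M) (v w : E n) : extDeriv₁ (fun p => α p + s • β p) p v w =
      extDeriv₁ α p v w + s * extDeriv₁ β p v w := by
  have ht := ext_mem_target (n := n) p
  rw [extDeriv₁_eq ((smoothForm_add_smul hα hβ s).differentiableAt ht),
    extDeriv₁_eq (hα.differentiableAt ht), extDeriv₁_eq (hβ.differentiableAt ht), formRep_add_smul,
    extD, extD, extD, fderiv_fun_add (hα.differentiableAt ht)
      ((hβ.differentiableAt ht).fun_const_smul s), fderiv_fun_const_smul (hβ.differentiableAt ht)]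
  simp only [_root_.add_apply, _root_.smul_apply, smul_eq_mul]
  ring

omit [IsManifold (I n) ∞ M] in
theorem jointSmoothForm_add_smul {α β : M → E n →L[ℝ] ℝ} (hα : SmoothForm α) (hβ : SmoothForm β)
    (s : ℝ) : JointSmoothForm (fun s p => α p + s • β p) s := fun x => by
  have hx := ext_mem_target (n := n) x
  have h : ∀ {α : M → E n →L[ℝ] ℝ}, SmoothForm α →
      ContDiffAt ℝ ∞ (fun q : ℝ × E n => formRep x α q.2) (s, extChartAt (I n) x x) := fun hα =>
    ContDiffAt.comp (g := formRep x _) (f := Prod.snd) (s, extChartAt (I n) x x) (hα x _ hx)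
      contDiffAt_snd
  simp only [formRep_add_smul]
  exact (h hα).add (contDiffAt_fst.smul (h hβ))

/-- The volumes of two contact forms with the same Reeb field agree if the segment between them
consists of contact forms. -/
theorem volume_eq_of_segment [CompactSpace M] [T2Space M] [MeasurableSpace M] [BorelSpace M]
    {α β : M → E n →L[ℝ] ℝ} {X : M → E n} (hα : SmoothForm α) (hβ : SmoothForm β)
    (hαX : ∀ p, α p (X p) = 1) (hβX : ∀ p, β p (X p) = 0)
    (hdα : ∀ (p : M) (v : E n), extDeriv₁ α p v (X p) = 0)
    (hdβ : ∀ (p : M) (v : E n), extDeriv₁ β p v (X p) = 0)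
    (h0 : ∀ s ∈ Icc (0 : ℝ) 1, ∀ p, bdet (contactB (fun p => α p + s • β p) p) ≠ 0) :
    (densityMeasure n (contactDensity fun p => α p + β p)).real univ =
      (densityMeasure n (contactDensity α)).real univ := by
  set W : ℝ → ℝ := fun s => (densityMeasure n (contactDensity fun p => α p + s • β p)).real univ with hW
  have hd : ∀ s ∈ Icc (0 : ℝ) 1, HasDerivAt W 0 s := by
    intro s hs
    have hsm := smoothForm_add_smul hα hβ s
    have hX : ∀ p, α p (X p) + s • β p (X p) = 1 := fun p => by rw [hαX, hβX]; simp
    have h1 := hasDerivAt_volume (jointSmoothForm_add_smul hα hβ s)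
      (Eventually.of_forall fun s => smoothForm_add_smul hα hβ s) (α' := β) (fun p => by
        simpa using ((hasDerivAt_id s).smul_const (β p)).const_add (α p)) (h0 s hs)
    refine h1.congr_deriv ?_
    -- Pairing B(Z, ·) = β with X shows that the contact form of the segment annihilates Z, since
    -- β(X) = 0 and X lies in the kernel of both differentials. So ι_Z of its differential is β, and
    -- the derivative of the volume is the integral of a divergence.
    obtain ⟨Z, hZ, hZB⟩ := exists_contact_dual hsm hβ (h0 s hs)
    have hZα : ∀ p, (α p + s • β p) (Z p) = 0 := fun p => by
      have h2 := hZB p (X p)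
      rw [contactB_apply hsm, extDeriv₁_add_smul hα hβ, hdα, hdβ, hβX] at h2
      have h3 : (α p + s • β p) (X p) = 1 := hX p
      rw [h3] at h2
      linarith
    refine integral_contactTrace_eq_zero hsm hβ (h0 s hs) hZ (fun p w => ?_) hZα
    rw [← hZB p w, contactB_apply hsm, hZα]
    ring
  have h1 := (convex_Icc (0 : ℝ) 1).norm_image_sub_le_of_norm_hasDerivWithin_le (f := W)
    (f' := fun _ => 0) (C := 0) (fun s hs => (hd s hs).hasDerivWithinAt) (by simp)
    (left_mem_Icc.2 zero_le_one) (right_mem_Icc.2 zero_le_one)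
  rw [zero_mul, norm_le_zero_iff, sub_eq_zero] at h1
  simpa [hW] using h1

end Combinations

/-! ### The volume depends only on the Reeb field and the transverse structure. -/

namespace SasakianStructure

variable {n : ℕ} {M : Type*} [TopologicalSpace M] [ChartedSpace (E n) M] [IsManifold (I n) ∞ M]
  {S : SasakianStructure n M} {X : M → E n}

/-- The contact form `η / η(X)`, with arguments in the model space. -/
def coneEta (S : SasakianStructure n M) (X : M → E n) (p : M) : E n →L[ℝ] ℝ :=
  (S.eta p (X p))⁻¹ • S.eta p

/-- The tensor `Φ'` of the cone, on the model space. -/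
def conePhi (S : SasakianStructure n M) (X : M → E n) (p : M) : E n →ₗ[ℝ] E n :=
  (S.phi p : E n →ₗ[ℝ] E n) ∘ₗ (LinearMap.id - (S.coneEta X p : E n →ₗ[ℝ] ℝ).smulRight (X p))

theorem conePhi_apply (p : M) (v : E n) :
    S.conePhi X p v = S.phi p (v - S.coneEta X p v • X p) := rfl

theorem coneEta_apply (p : M) (v : E n) : S.coneEta X p v = (S.eta p (X p))⁻¹ * S.eta p v := rfl

theorem coneEta_self (hX : X ∈ S.crPos) (p : M) : S.coneEta X p (X p) = 1 :=
  inv_mul_cancel₀ (eta_pos hX p).ne'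

theorem eta_sub_coneEta (hX : X ∈ S.crPos) (p : M) (v : E n) :
    S.eta p (v - S.coneEta X p v • X p) = 0 := by
  rw [map_sub, map_smul, smul_eq_mul, coneEta_apply, mul_right_comm,
    inv_mul_cancel₀ (eta_pos hX p).ne', one_mul, sub_self]

theorem coneEta_conePhi (p : M) (v : E n) : S.coneEta X p (S.conePhi X p v) = 0 := by
  rw [coneEta_apply, conePhi_apply, eta_phi, mul_zero]

theorem conePhi_conePhi (hX : X ∈ S.crPos) (p : M) (v : E n) :
    S.conePhi X p (S.conePhi X p v) = -v + S.coneEta X p v • X p := by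
  rw [conePhi_apply, coneEta_conePhi, zero_smul, sub_zero, conePhi_apply, phi_phi,
    eta_sub_coneEta hX, zero_smul, add_zero, neg_sub, neg_add_eq_sub]

theorem smoothForm_coneEta (hX : X ∈ S.crPos) : SmoothForm (S.coneEta X) :=
  smoothForm_smul S.smoothForm_eta (contMDiff_inv_eta hX)

variable [T2Space M]

/-- A CR field X satisfies dη(X, ·) = -d(η(X)) on D, which is exactly what cancels the derivative of
the factor 1/η(X). In the direction of X itself skew symmetry suffices. -/
theorem extDeriv₁_coneEta_self (hX : X ∈ S.crPos) (p : M) (v : E n) :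
    extDeriv₁ (S.coneEta X) p v (X p) = 0 := by
  have hd : ∀ u : E n, diff (n := n) (fun q => (S.eta q (X q))⁻¹) p u =
      -(S.eta p (X p))⁻¹ ^ 2 * diff (n := n) (fun q => S.eta q (X q)) p u := fun u =>
    diff_inv (contMDiff_eta hX.1) (fun p => (eta_pos hX p).ne') p u
  have h1 : ∀ v w : E n, extDeriv₁ (S.coneEta X) p v w = (S.eta p (X p))⁻¹ * extDeriv₁ S.eta p v w +
      (diff (n := n) (fun q => (S.eta q (X q))⁻¹) p v * S.eta p w -
        diff (n := n) (fun q => (S.eta q (X q))⁻¹) p w * S.eta p v) := fun v w =>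
    extDeriv₁_smul S.smoothForm_eta (contMDiff_inv_eta hX) p v w
  have hne := (eta_pos hX p).ne'
  set u := v - S.coneEta X p v • X p with hu
  have hηu : S.eta p u = 0 := eta_sub_coneEta hX p v
  have hv : v = u + S.coneEta X p v • X p := by rw [hu]; simp
  have h2 : extDeriv₁ (S.coneEta X) p u (X p) = 0 := by
    have h3 : extDeriv₁ S.eta p u (X p) = -extDeriv₁ S.eta p (X p) u := by
      have hsm := S.smoothForm_eta.differentiableAt (ext_mem_target (n := n) p)
      rw [extDeriv₁_eq hsm, extDeriv₁_eq hsm, extD, extD]; ring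
    rw [h1, h3, S.extDeriv₁_cr hX.1 p hηu, hd, hηu]
    field_simp
    ring
  have hsm' := (smoothForm_coneEta hX).differentiableAt (ext_mem_target (n := n) p)
  rw [extDeriv₁_eq hsm'] at h2 ⊢
  rw [hv]
  simp only [extD, map_add, map_smul, _root_.add_apply, _root_.smul_apply, smul_eq_mul] at h2 ⊢
  linear_combination h2

/-- Components along X drop out because X is the Reeb field, and on D the form d(η/η(X)) is dη/η(X).
The point is positivity: for v = w the value vanishes only when v is a multiple of X. -/
theorem extDeriv₁_coneEta_conePhi (hX : X ∈ S.crPos) (p : M) (v w : E n) :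
    extDeriv₁ (S.coneEta X) p v (S.conePhi X p w) = (S.eta p (X p))⁻¹ *
      S.gB p (v - S.coneEta X p v • X p) (w - S.coneEta X p w • X p) := by
  have h1 : ∀ v w : E n, extDeriv₁ (S.coneEta X) p v w = (S.eta p (X p))⁻¹ * extDeriv₁ S.eta p v w +
      (diff (n := n) (fun q => (S.eta q (X q))⁻¹) p v * S.eta p w -
        diff (n := n) (fun q => (S.eta q (X q))⁻¹) p w * S.eta p v) := fun v w =>
    extDeriv₁_smul S.smoothForm_eta (contMDiff_inv_eta hX) p v w
  have hsm' := (smoothForm_coneEta hX).differentiableAt (ext_mem_target (n := n) p)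
  have h2 : extDeriv₁ (S.coneEta X) p v (S.conePhi X p w) =
      extDeriv₁ (S.coneEta X) p (v - S.coneEta X p v • X p) (S.conePhi X p w) := by
    have h3 := extDeriv₁_coneEta_self hX p (S.conePhi X p w)
    rw [extDeriv₁_eq hsm'] at h3 ⊢
    rw [extDeriv₁_eq hsm']
    simp only [extD, map_sub, map_smul, _root_.sub_apply, _root_.smul_apply, smul_eq_mul] at h3 ⊢
    linear_combination (-S.coneEta X p v) * h3
  rw [h2, h1, conePhi_apply, extDeriv₁_eta_phi, eta_phi, eta_sub_coneEta hX, eta_sub_coneEta hX]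
  ring

theorem contactB_coneEta_self (hX : X ∈ S.crPos) (p : M) (v : E n) :
    contactB (S.coneEta X) p v (X p) = S.coneEta X p v := by
  rw [contactB_apply (smoothForm_coneEta hX), extDeriv₁_coneEta_self hX, coneEta_self hX]; ring

/-- The determinants of the cone metric and of its contact form. -/
theorem sqrt_bdet_coneMetric (hX : X ∈ S.crPos) : ∃ G : M → LinearMap.BilinForm ℝ (E n),
    (∀ p v w, S.coneMetric X p v w = G p v w) ∧
      ∀ p, √(bdet (G p)) = contactDensity (S.coneEta X) p := by
  obtain ⟨G, hG, hd⟩ := exists_coneMetric hX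
  refine ⟨G, hG, fun p => ?_⟩
  have hpos : 0 < bdet (G p) := by
    rw [hd]
    exact mul_pos (pow_pos (inv_pos.2 (eta_pos hX p)) _) (S.bdet_gB_pos p)
  have h1 : |bdet (G p)| = |bdet (contactB (S.coneEta X) p)| := by
    refine abs_bdet_of_almost_contact (P := S.conePhi X p) (η := (S.coneEta X p : E n →ₗ[ℝ] ℝ))
      (coneEta_self hX p) (conePhi_conePhi hX p) (coneEta_conePhi p) (contactB_coneEta_self hX p)
      fun v w => ?_
    have h2 : contactB (S.coneEta X) p v (S.conePhi X p w) =
        extDeriv₁ (S.coneEta X) p v (S.conePhi X p w) := by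
      rw [contactB_apply (smoothForm_coneEta hX), coneEta_conePhi, mul_zero, add_zero]
    refine (hG p v w).symm.trans ?_
    change extDeriv₁ (S.coneEta X) p v (S.conePhi X p w) + S.coneEta X p v * S.coneEta X p w = _
    rw [← h2]; rfl
  rw [contactDensity, ← h1, abs_of_pos hpos]

theorem riemannianMeasure_coneMetric_eq [MeasurableSpace M] [BorelSpace M] (hX : X ∈ S.crPos) :
    riemannianMeasure (S.coneMetric X) = densityMeasure n (contactDensity (S.coneEta X)) := by
  obtain ⟨G, hG, hd⟩ := sqrt_bdet_coneMetric hX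
  have h1 : S.coneMetric X = fun p v w => G p v w := by funext p v w; exact hG p v w
  rw [h1]
  refine (riemannianMeasure_eq G).trans ?_
  congr 1
  funext p
  exact hd p

/-- The segment between the contact form of the cone and that of a Sasakian structure with the same
transverse complex structure consists of contact forms. -/
theorem bdet_contactB_segment_ne_zero {S' : SasakianStructure n M} (hX : S'.xi ∈ S.crPos)
    (hJ : S.SameTransverse S') {s : ℝ} (hs : s ∈ Icc (0 : ℝ) 1) (p : M) :
    bdet (contactB (fun p => S.coneEta S'.xi p + s • (S'.eta p + (-1 : ℝ) • S.coneEta S'.xi p)) p) ≠ 0 := by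
  have hc := smoothForm_coneEta hX
  have hdiff := smoothForm_add_smul S'.smoothForm_eta hc (-1)
  have hsm := smoothForm_add_smul hc hdiff s
  set η := S.coneEta S'.xi with hη
  set X := S'.xi with hXdef
  have hd : ∀ v w : E n, extDeriv₁ (fun p => η p + s • (S'.eta p + (-1 : ℝ) • η p)) p v w =
      (1 - s) * extDeriv₁ η p v w + s * extDeriv₁ S'.eta p v w := by
    intro v w
    rw [extDeriv₁_add_smul hc hdiff, extDeriv₁_add_smul S'.smoothForm_eta hc]
    ring
  have hXs : (η p + s • (S'.eta p + (-1 : ℝ) • η p)) (X p) = 1 := by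
    have h1 : η p (X p) + s * (S'.eta p (X p) + (-1) * η p (X p)) = 1 := by
      rw [hη, coneEta_self hX, S'.eta_xi]; ring
    exact h1
  -- Test a kernel vector on X to see that the contact form kills it, then on its image under
  -- `conePhi`. The latter gives a vanishing convex combination of two nonnegative numbers.
  refine bdet_ne_zero fun v hv => ?_
  have hηv : (η p + s • (S'.eta p + (-1 : ℝ) • η p)) v = 0 := by
    have h1 := hv (X p)
    rw [contactB_apply hsm, hd, hη, extDeriv₁_coneEta_self hX, S'.extDeriv₁_eta_xi, ← hη, hXs] at h1
    linarith
  have h2 : (1 - s) * extDeriv₁ η p v (S.conePhi X p v) +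
      s * extDeriv₁ S'.eta p v (S.conePhi X p v) = 0 := by
    have h1 := hv (S.conePhi X p v)
    rw [contactB_apply hsm, hd, hηv] at h1
    linarith
  have hA : extDeriv₁ η p v (S.conePhi X p v) = (S.eta p (X p))⁻¹ *
      S.gB p (v - S.coneEta X p v • X p) (v - S.coneEta X p v • X p) :=
    extDeriv₁_coneEta_conePhi hX p v v
  -- The two (1,1) tensors differ by a multiple of the common Reeb field, which the differential of
  -- the contact form does not see. This is how the common transverse complex structure enters.
  have hB : extDeriv₁ S'.eta p v (S.conePhi X p v) = S'.gB p (S'.phi p v) (S'.phi p v) := by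
    obtain ⟨c, hc⟩ := hJ p v
    have hc' : S'.phi p v = S.conePhi X p v + c • X p := hc
    have e : S.conePhi X p v = S'.phi p v - c • X p := by rw [hc']; simp
    rw [e, S'.extDeriv₁_eta, map_sub, map_smul, hXdef, S'.gB_xi, S'.eta_phi, smul_zero, sub_zero]
  have hgn : ∀ (T : SasakianStructure n M) (u : E n), 0 ≤ T.gB p u u := fun T u => by
    rcases eq_or_ne u 0 with rfl | hu
    · simp
    · exact (T.gB_pos p u hu).le
  have hg0 : ∀ (T : SasakianStructure n M) (u : E n), T.gB p u u = 0 → u = 0 := fun T u h => by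
    by_contra hu
    exact (T.gB_pos p u hu).ne' h
  have hf := inv_pos.2 (eta_pos hX p)
  have hA0 : 0 ≤ extDeriv₁ η p v (S.conePhi X p v) := hA ▸ mul_nonneg hf.le (hgn S _)
  have hB0 : 0 ≤ extDeriv₁ S'.eta p v (S.conePhi X p v) := hB ▸ hgn S' _
  -- For s < 1 the first summand must vanish; at s = 1 its weight is zero and the second one is
  -- used. Either way v is a multiple of X, on which the contact form takes the value c, hence c =
  -- 0.
  have hcases : ∃ c : ℝ, v = c • X p := by
    rcases hs.2.eq_or_lt with rfl | hs1
    · have h3 : extDeriv₁ S'.eta p v (S.conePhi X p v) = 0 := by linarith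
      rw [hB] at h3
      have h4 := S'.phi_phi p v
      rw [hg0 S' _ h3, map_zero] at h4
      exact ⟨S'.eta p v, by rw [eq_comm, neg_add_eq_zero] at h4; exact h4⟩
    · have h3 : extDeriv₁ η p v (S.conePhi X p v) = 0 := by
        have h5 := mul_nonneg hs.1 hB0
        have h6 : 0 < 1 - s := by linarith
        have h7 : (1 - s) * extDeriv₁ η p v (S.conePhi X p v) ≤ 0 := by linarith
        exact le_antisymm (nonpos_of_mul_nonpos_right h7 h6) hA0
      rw [hA] at h3
      exact ⟨_, sub_eq_zero.1 (hg0 S _ ((mul_eq_zero.1 h3).resolve_left hf.ne'))⟩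
  obtain ⟨c, rfl⟩ := hcases
  rw [map_smul, hXs, smul_eq_mul, mul_one] at hηv
  rw [hηv, zero_smul]

variable [CompactSpace M] [MeasurableSpace M] [BorelSpace M]

/-- The volume only depends on the Reeb field and the transverse complex structure. -/
theorem volume_eq_coneVolume {S' : SasakianStructure n M} (hX : S'.xi ∈ S.crPos)
    (hJ : S.SameTransverse S') : S'.μ.real univ = S.coneVolume S'.xi := by
  have hc := smoothForm_coneEta hX
  have hdiff := smoothForm_add_smul S'.smoothForm_eta hc (-1)
  have h1 := volume_eq_of_segment (X := S'.xi) hc hdiff (coneEta_self hX)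
    (fun p => by
      change S'.eta p (S'.xi p) + (-1) * S.coneEta S'.xi p (S'.xi p) = 0
      rw [S'.eta_xi, coneEta_self hX]; ring)
    (extDeriv₁_coneEta_self hX)
    (fun p v => by
      rw [extDeriv₁_add_smul S'.smoothForm_eta hc, S'.extDeriv₁_eta_xi, extDeriv₁_coneEta_self hX]
      ring)
    fun s hs p => bdet_contactB_segment_ne_zero hX hJ hs p
  have e : (fun p => S.coneEta S'.xi p + (S'.eta p + (-1 : ℝ) • S.coneEta S'.xi p)) = S'.eta := by
    funext p; ext v
    change S.coneEta S'.xi p v + (S'.eta p v + -1 * S.coneEta S'.xi p v) = S'.eta p v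
    ring
  rw [e] at h1
  rw [S'.μ_eq, h1]
  change _ = (riemannianMeasure (S.coneMetric S'.xi)).real univ
  rw [riemannianMeasure_coneMetric_eq hX]

end SasakianStructure

/-! ### Jacobi identity, differentials of functions, and forms preserved by a field. -/

section Brackets

variable {n : ℕ} {M : Type*} [TopologicalSpace M] [ChartedSpace (E n) M] [IsManifold (I n) ∞ M]

theorem smoothField_bracket {V W : M → E n} (hV : SmoothField (n := n) V)
    (hW : SmoothField (n := n) W) : SmoothField (n := n) (bracket V W) := by
  have e : (fun p => VectorField.mlieBracket (I n) V W p) = bracket V W := by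
    funext p; exact mlieBracket_eq_bracket V W p
  rw [← e]
  have : IsManifold (I n) (((⊤ : ℕ∞) : WithTop ℕ∞) + 1) M := by
    have h : ((⊤ : ℕ∞) : WithTop ℕ∞) + 1 = ∞ := rfl
    rw [h]; infer_instance
  have : IsManifold (I n) (minSmoothness ℝ 2) M := by
    rw [minSmoothness_of_isRCLikeNormedField]; infer_instance
  refine ContDiff.mlieBracket_vectorField (m := ⊤) (n := ⊤) hV hW ?_
  rw [minSmoothness_of_isRCLikeNormedField]
  rfl

theorem bracket_jacobi [T2Space M] {U V W : M → E n} (hU : SmoothField (n := n) U)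
    (hV : SmoothField (n := n) V) (hW : SmoothField (n := n) W) (p : M) :
    bracket U (bracket V W) p = bracket (bracket U V) W p + bracket V (bracket U W) p := by
  have hm : minSmoothness ℝ 2 ≤ (∞ : WithTop ℕ∞) := by
    rw [minSmoothness_of_isRCLikeNormedField]; exact ENat.LEInfty.out
  have : IsManifold (I n) (minSmoothness ℝ 3) M := by
    rw [minSmoothness_of_isRCLikeNormedField]; infer_instance
  have h := VectorField.leibniz_identity_mlieBracket_apply (I := I n) (x := p) ((hU p).of_le hm)
    ((hV p).of_le hm) ((hW p).of_le hm)
  have e : ∀ V W : M → E n, (fun p => VectorField.mlieBracket (I n) V W p) = bracket V W :=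
    fun V W => by funext p; exact mlieBracket_eq_bracket V W p
  have e' : ∀ V W : M → E n, VectorField.mlieBracket (I n) V W = bracket V W := e
  rw [e' V W, e' U V, e' U W, e' U, e' (bracket U V), e' V] at h
  exact h

/-- The differential of a function, as a 1-form. -/
def diffForm (f : M → ℝ) (p : M) : E n →L[ℝ] ℝ :=
  mfderiv (I n) 𝓘(ℝ, ℝ) f p

omit [IsManifold (I n) ∞ M] in
theorem diffForm_apply (f : M → ℝ) (p : M) (v : E n) : diffForm f p v = diff (n := n) f p v := rfl

theorem formRep_diffForm {f : M → ℝ} (hf : ContMDiff (I n) 𝓘(ℝ, ℝ) ∞ f) {x : M} {z : E n}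
    (hz : z ∈ (extChartAt (I n) x).target) :
    formRep x (diffForm f) z = fderiv ℝ (fun q => f ((extChartAt (I n) x).symm q)) z := by
  ext v
  exact diff_frame hz (mdifferentiable_of_contMDiff hf _) v

theorem formRep_diffForm_eventuallyEq {f : M → ℝ} (hf : ContMDiff (I n) 𝓘(ℝ, ℝ) ∞ f) {x : M} {z : E n}
    (hz : z ∈ (extChartAt (I n) x).target) :
    formRep x (diffForm f) =ᶠ[𝓝 z] fderiv ℝ (fun q => f ((extChartAt (I n) x).symm q)) := by
  filter_upwards [target_mem_nhds hz] with y hy using formRep_diffForm hf hy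

theorem smoothForm_diffForm {f : M → ℝ} (hf : ContMDiff (I n) 𝓘(ℝ, ℝ) ∞ f) :
    SmoothForm (n := n) (diffForm f) := fun _ _ hz =>
  (contDiffAt_fderiv (contDiffAt_rep hf hz)).congr_of_eventuallyEq (formRep_diffForm_eventuallyEq hf hz)

theorem extDeriv₁_diffForm {f : M → ℝ} (hf : ContMDiff (I n) 𝓘(ℝ, ℝ) ∞ f) (p : M) (v w : E n) :
    extDeriv₁ (diffForm f) p v w = 0 := by
  have ht := ext_mem_target (n := n) p
  rw [extDeriv₁_eq ((smoothForm_diffForm hf).differentiableAt ht), extD,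
    (formRep_diffForm_eventuallyEq hf ht).fderiv_eq, sub_eq_zero]
  exact ((contDiffAt_rep hf ht).isSymmSndFDerivAt
    (by rw [minSmoothness_of_isRCLikeNormedField]; exact ENat.LEInfty.out)).eq _ _

theorem contMDiff_diff_field {f : M → ℝ} (hf : ContMDiff (I n) 𝓘(ℝ, ℝ) ∞ f) {V : M → E n}
    (hV : SmoothField (n := n) V) : ContMDiff (I n) 𝓘(ℝ, ℝ) ∞ fun p => diff (n := n) f p (V p) :=
  contMDiff_diff hf fun x => contDiffAt_fieldRep hV (ext_mem_target x)

/-- `[V, W] f = V (W f) - W (V f)`. -/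
theorem diff_bracket {f : M → ℝ} (hf : ContMDiff (I n) 𝓘(ℝ, ℝ) ∞ f) {V W : M → E n}
    (hV : SmoothField (n := n) V) (hW : SmoothField (n := n) W) (p : M) :
    diff (n := n) f p (bracket V W p) = diff (n := n) (fun q => diff (n := n) f q (W q)) p (V p) -
      diff (n := n) (fun q => diff (n := n) f q (V q)) p (W p) := by
  have h := extDeriv₁_bracket (smoothForm_diffForm hf) hV hW p
  rw [extDeriv₁_diffForm hf] at h
  simp only [diffForm_apply] at h
  linarith

/-- A field that preserves a 1-form preserves its exterior derivative. -/
theorem diff_extDeriv₁_of_preserves [T2Space M] {α : M → E n →L[ℝ] ℝ} {X V W : M → E n}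
    (hα : SmoothForm α) (hX : SmoothField (n := n) X) (hV : SmoothField (n := n) V)
    (hW : SmoothField (n := n) W)
    (hL : ∀ Y : M → E n, SmoothField (n := n) Y → ∀ p,
      α p (bracket X Y p) = diff (n := n) (fun q => α q (Y q)) p (X p)) (p : M) :
    diff (n := n) (fun q => extDeriv₁ α q (V q) (W q)) p (X p) =
      extDeriv₁ α p (bracket X V p) (W p) + extDeriv₁ α p (V p) (bracket X W p) := by
  have hVW := smoothField_bracket hV hW
  have hXV := smoothField_bracket hX hV
  have hXW := smoothField_bracket hX hW
  have sV := contMDiff_apply hα hV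
  have sW := contMDiff_apply hα hW
  have d1 := contMDiff_diff_field sW hV
  have d2 := contMDiff_diff_field sV hW
  have d3 := contMDiff_apply hα hVW
  have e : (fun q => extDeriv₁ α q (V q) (W q)) = fun q => diff (n := n) (fun q => α q (W q)) q (V q) -
      diff (n := n) (fun q => α q (V q)) q (W q) - α q (bracket V W q) := by
    funext q; exact extDeriv₁_bracket hα hV hW q
  have e2 : diff (n := n) (fun q => extDeriv₁ α q (V q) (W q)) p (X p) =
      diff (n := n) (fun q => diff (n := n) (fun q => α q (W q)) q (V q)) p (X p) -
      diff (n := n) (fun q => diff (n := n) (fun q => α q (V q)) q (W q)) p (X p) -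
      diff (n := n) (fun q => α q (bracket V W q)) p (X p) := by
    rw [e]
    have hz := ext_mem_target (n := n) p
    rw [diff_eq_fderiv (mdifferentiable_of_contMDiff ((d1.sub d2).sub d3) p),
      diff_eq_fderiv (mdifferentiable_of_contMDiff d1 p),
      diff_eq_fderiv (mdifferentiable_of_contMDiff d2 p),
      diff_eq_fderiv (mdifferentiable_of_contMDiff d3 p),
      fderiv_fun_sub (((contDiffAt_rep d1 hz).sub (contDiffAt_rep d2 hz)).differentiableAt (by simp))
        ((contDiffAt_rep d3 hz).differentiableAt (by simp)),
      fderiv_fun_sub ((contDiffAt_rep d1 hz).differentiableAt (by simp))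
        ((contDiffAt_rep d2 hz).differentiableAt (by simp))]
    rfl
  have hXVa : (fun q => α q (bracket X V q)) = fun q => diff (n := n) (fun q => α q (V q)) q (X q) :=
    funext (hL V hV)
  have hXWa : (fun q => α q (bracket X W q)) = fun q => diff (n := n) (fun q => α q (W q)) q (X q) :=
    funext (hL W hW)
  -- With dα(V, W) expanded by Cartan's formula, the function terms are handled by the commutator
  -- rule for [X, V] and [X, W], and the term α[V, W] by the Jacobi identity.
  have hJ : α p (bracket X (bracket V W) p) =
      α p (bracket (bracket X V) W p) + α p (bracket V (bracket X W) p) := by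
    rw [bracket_jacobi hX hV hW, map_add]
  rw [hL _ hVW] at hJ
  rw [e2, extDeriv₁_bracket hα hXV hW, extDeriv₁_bracket hα hV hXW, hXVa, hXWa,
    diff_bracket sW hX hV, diff_bracket sV hX hW]
  linarith

end Brackets

/-! ### Integration by parts against the trace. -/

section IntegrationByParts

variable {n : ℕ} {M : Type*} [TopologicalSpace M] [ChartedSpace (E n) M] [IsManifold (I n) ∞ M]
  [T2Space M] [CompactSpace M] [MeasurableSpace M] [BorelSpace M]

/-- Integration by parts along a field with `ι_Z dα = γ` and `α(Z)` constant. -/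
theorem integral_mul_contactTrace {α γ : M → E n →L[ℝ] ℝ} {Z : M → E n} {k : ℝ} {u : M → ℝ}
    (hα : SmoothForm α) (hγ : SmoothForm γ) (h0 : ∀ p, bdet (contactB α p) ≠ 0)
    (hZ : SmoothField (n := n) Z)
    (hd : ∀ (p : M) (w : E n), extDeriv₁ α p (Z p) w = γ p w) (hk : ∀ p, α p (Z p) = k)
    (hu : ContMDiff (I n) 𝓘(ℝ, ℝ) ∞ u) :
    ∫ p, (u p * (contactTrace α γ p / 2) + diff (n := n) u p (Z p))
      ∂(densityMeasure n (contactDensity α)) = 0 := by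
  -- The divergence theorem for `u Z`, whose divergence is u div Z + Z u.
  refine integral_divergence (Y := fun p => u p • Z p)
    (fun _ _ hz => contDiffAt_chartDensity hα h0 hz) (contactDensity_nonneg α)
    (fun _ _ hz => contDiffAt_fieldRep (smoothField_smul hu hZ) hz)
    ((hu.continuous.mul ((contMDiff_contactTrace hα hγ h0).continuous.div_const 2)).add
      (contMDiff_diff_field hu hZ).continuous) fun x z hz => ?_
  have e : (fun y => chartDensity (contactDensity α) x y • fieldRep x (fun p => u p • Z p) y) =
      fun y => u ((extChartAt (I n) x).symm y) • (chartDensity (contactDensity α) x y • fieldRep x Z y) := by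
    funext y
    rw [smul_comm]
    congr 1
    exact map_smul (coframe x _) _ _
  have e3 := divE_smul (β := fun y => u ((extChartAt (I n) x).symm y))
    (Z := fun y => chartDensity (contactDensity α) x y • fieldRep x Z y)
    ((contDiffAt_rep hu hz).differentiableAt (by simp))
    (((contDiffAt_chartDensity hα h0 hz).smul (contDiffAt_fieldRep hZ hz)).differentiableAt (by simp))
  have e4 := diff_field hu Z hz
  rw [e, e3, divE_contactDensity hα hγ h0 hZ hd hk hz, map_smul, smul_eq_mul, ← e4]
  ring

end IntegrationByParts

/-! ### Gradient and basic Laplacian. -/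

namespace SasakianStructure

variable {n : ℕ} {M : Type*} [TopologicalSpace M] [ChartedSpace (E n) M] [IsManifold (I n) ∞ M]
  {S : SasakianStructure n M} {f : M → ℝ}

/-- The 1-form `-df ∘ Φ`. -/
def dcForm (S : SasakianStructure n M) (f : M → ℝ) (p : M) : E n →L[ℝ] ℝ :=
  -(diffForm f p).comp (S.phi p)

theorem dcForm_apply (p : M) (v : E n) : S.dcForm f p v = -diff (n := n) f p (S.phi p v) := rfl

theorem smoothForm_dcForm (hf : ContMDiff (I n) 𝓘(ℝ, ℝ) ∞ f) : SmoothForm (S.dcForm f) := by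
  intro x z hz
  have h : formRep x (S.dcForm f) =ᶠ[𝓝 z] fun y => -(formRep x (diffForm f) y).comp (endoRep x S.phi y) := by
    filter_upwards [target_mem_nhds hz] with y hy
    ext v
    have h1 := frame_coframe hy (S.phi ((extChartAt (I n) x).symm y) (frame x y v))
    have h2 : diffForm f ((extChartAt (I n) x).symm y) (S.phi ((extChartAt (I n) x).symm y) (frame x y v)) =
        diffForm f ((extChartAt (I n) x).symm y) (frame x y (coframe x ((extChartAt (I n) x).symm y)
          (S.phi ((extChartAt (I n) x).symm y) (frame x y v)))) := by rw [h1]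
    exact congrArg Neg.neg h2
  exact (((smoothForm_diffForm hf x z hz).clm_comp (contDiffAt_endoRep S.smooth_Φ hz)).neg).congr_of_eventuallyEq h

/-- The gradient of a basic function is the field `Z` with `ι_Z dη = dᶜ f` and `η(Z) = 0`. -/
theorem exists_gradient (hf : IsBasic (n := n) S.xi f) : ∃ Z : M → E n, SmoothField (n := n) Z ∧
    (∀ p, S.eta p (Z p) = 0) ∧ (∀ (p : M) (w : E n), extDeriv₁ S.eta p (Z p) w = S.dcForm f p w) ∧
      ∀ (p : M) (v : E n), S.gB p (Z p) v = diff (n := n) f p v := by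
  obtain ⟨Z, hZ, hB⟩ := exists_contact_dual S.smoothForm_eta (smoothForm_dcForm (S := S) hf.1)
    S.bdet_contactB_ne_zero
  -- Pairing the defining equation with ξ yields η(Z) on one side and -df(Φξ) = 0 on the other.
  have hη : ∀ p, S.eta p (Z p) = 0 := fun p => by
    rw [← contactB_xi, hB, dcForm_apply, phi_xi, ← diffForm_apply, map_zero, neg_zero]
  have hd : ∀ (p : M) (w : E n), extDeriv₁ S.eta p (Z p) w = S.dcForm f p w := fun p w => by
    rw [← hB, contactB_apply S.smoothForm_eta, hη]; ring
  refine ⟨Z, hZ, hη, hd, fun p v => ?_⟩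
  -- As η(Z) = 0, this reads dη(Z, Φv) = g(Z, v), while -df(Φ²v) = df(v) because f is constant along
  -- ξ. So Z is the metric gradient.
  have h1 := S.extDeriv₁_eta_phi p (Z p) v
  have h2 : diff (n := n) f p (S.phi p (S.phi p v)) = -diff (n := n) f p v := by
    have h3 : diffForm f p (S.xi p) = 0 := hf.2 p
    rw [← diffForm_apply, phi_phi, map_add, map_neg, map_smul, h3, smul_zero, add_zero, diffForm_apply]
  rw [hd, hη, dcForm_apply, h2] at h1
  linarith

/-- The basic Laplacian as a divergence. -/
def basicLaplacian (S : SasakianStructure n M) (f : M → ℝ) (p : M) : ℝ :=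
  -(contactTrace S.eta (S.dcForm f) p / 2)

theorem contMDiff_basicLaplacian (hf : ContMDiff (I n) 𝓘(ℝ, ℝ) ∞ f) :
    ContMDiff (I n) 𝓘(ℝ, ℝ) ∞ (S.basicLaplacian f) := by
  have h := contMDiff_contactTrace S.smoothForm_eta (smoothForm_dcForm (S := S) hf) S.bdet_contactB_ne_zero
  have e : S.basicLaplacian f = fun p => (-(1 / 2) : ℝ) * contactTrace S.eta (S.dcForm f) p := by
    funext p; rw [basicLaplacian]; ring
  rw [e]
  exact contMDiff_const.mul h

/-- The Reeb field preserves the contact form. -/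
theorem eta_bracket_xi {Y : M → E n} (hY : SmoothField (n := n) Y) (p : M) :
    S.eta p (bracket S.xi Y p) = diff (n := n) (fun q => S.eta q (Y q)) p (S.xi p) := by
  rw [S.bracket_eta S.smoothField_xi hY, extDeriv₁_xi_eta]
  simp only [eta_xi, diff_const, sub_zero]

theorem _root_.Sasaki.diff_mul {u v : M → ℝ} (hu : ContMDiff (I n) 𝓘(ℝ, ℝ) ∞ u)
    (hv : ContMDiff (I n) 𝓘(ℝ, ℝ) ∞ v) (p : M) (w : E n) :
    diff (n := n) (fun q => u q * v q) p w = u p * diff (n := n) v p w + v p * diff (n := n) u p w := by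
  have hz := ext_mem_target (n := n) p
  have huv : ContMDiff (I n) 𝓘(ℝ, ℝ) ∞ fun q => u q * v q := hu.mul hv
  rw [diff_eq_fderiv (mdifferentiable_of_contMDiff huv p),
    diff_eq_fderiv (mdifferentiable_of_contMDiff hu p),
    diff_eq_fderiv (mdifferentiable_of_contMDiff hv p),
    fderiv_fun_mul ((contDiffAt_rep hu hz).differentiableAt (by simp))
      ((contDiffAt_rep hv hz).differentiableAt (by simp))]
  simp only [_root_.add_apply, _root_.smul_apply, smul_eq_mul, symm_ext]

variable [T2Space M]

/-- The Reeb field commutes with the gradient of a basic function. -/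
theorem bracket_xi_gradient (hf : IsBasic (n := n) S.xi f) {Z : M → E n}
    (hZ : SmoothField (n := n) Z) (hη : ∀ p, S.eta p (Z p) = 0)
    (hd : ∀ (p : M) (w : E n), extDeriv₁ S.eta p (Z p) w = S.dcForm f p w) (p : M) :
    bracket S.xi Z p = 0 := by
  -- The Reeb flow preserves η, Φ and f, hence dη and dᶜf, hence the field determined by them. The
  -- infinitesimal version is checked by pairing the bracket with arbitrary vectors.
  refine eq_of_forall_bilin (S.bdet_contactB_ne_zero p) fun w => ?_
  obtain ⟨Y, hY, rfl⟩ := exists_smoothField p w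
  have h1 : S.eta p (bracket S.xi Z p) = 0 := by
    rw [eta_bracket_xi hZ]; simp only [hη, diff_const]
  have h2 := diff_extDeriv₁_of_preserves S.smoothForm_eta S.smoothField_xi hZ hY
    (fun Y hY p => eta_bracket_xi hY p) p
  have hΦY := S.smoothField_phi hY
  have e : (fun q => extDeriv₁ S.eta q (Z q) (Y q)) = fun q => (-1) * diff (n := n) f q (S.phi q (Y q)) := by
    funext q
    have := hd q (Y q)
    rw [dcForm_apply] at this
    rw [this]; ring
  have h3 : diff (n := n) (fun q => extDeriv₁ S.eta q (Z q) (Y q)) p (S.xi p) =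
      -diff (n := n) (fun q => diff (n := n) f q (S.phi q (Y q))) p (S.xi p) := by
    have h := diff_mul (contMDiff_const (c := (-1 : ℝ))) (contMDiff_diff_field hf.1 hΦY) p (S.xi p)
    rw [diff_const, mul_zero, add_zero, neg_one_mul] at h
    rw [e, h]
  have h4 : extDeriv₁ S.eta p (Z p) (bracket S.xi Y p) =
      -diff (n := n) (fun q => diff (n := n) f q (S.phi q (Y q))) p (S.xi p) := by
    have h5 := diff_bracket hf.1 S.smoothField_xi hΦY p
    have h6 : (fun q => diff (n := n) f q (S.xi q)) = fun _ => 0 := funext hf.2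
    rw [h6, diff_const, sub_zero, S.bracket_xi_phi hY] at h5
    rw [hd, dcForm_apply, h5]
  rw [h3, h4] at h2
  rw [contactB_apply S.smoothForm_eta, h1, map_zero]
  have h7 : extDeriv₁ S.eta p (bracket S.xi Z p) (Y p) = 0 := by linarith
  rw [h7]
  simp

variable [CompactSpace M] [MeasurableSpace M] [BorelSpace M]

/-- The test function is an arbitrary smooth one, not only a basic one. This generality is what
allows the proof that the Laplacian is basic. -/
theorem integral_basicLaplacian_mul (hf : ContMDiff (I n) 𝓘(ℝ, ℝ) ∞ f) {Z : M → E n}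
    (hZ : SmoothField (n := n) Z) (hη : ∀ p, S.eta p (Z p) = 0)
    (hd : ∀ (p : M) (w : E n), extDeriv₁ S.eta p (Z p) w = S.dcForm f p w) {u : M → ℝ}
    (hu : ContMDiff (I n) 𝓘(ℝ, ℝ) ∞ u) :
    ∫ p, S.basicLaplacian f p * u p ∂S.μ = ∫ p, diff (n := n) u p (Z p) ∂S.μ := by
  have h := integral_mul_contactTrace S.smoothForm_eta (smoothForm_dcForm (S := S) hf)
    S.bdet_contactB_ne_zero hZ hd hη hu
  rw [← μ_eq] at h
  have i1 := integrable_of_continuous (m := S.μ)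
    ((contMDiff_basicLaplacian (S := S) hf).continuous.mul hu.continuous)
  have i2 := integrable_of_continuous (m := S.μ) (contMDiff_diff_field hu hZ).continuous
  have e : (fun p => u p * (contactTrace S.eta (S.dcForm f) p / 2) + diff (n := n) u p (Z p)) =
      fun p => diff (n := n) u p (Z p) - S.basicLaplacian f p * u p := by
    funext p; rw [basicLaplacian]; ring
  rw [e] at h
  have h2 := (integral_sub i2 i1).symm.trans h
  exact (sub_eq_zero.1 h2).symm

/-- The Reeb field is divergence free. -/
theorem integral_diff_xi {u : M → ℝ} (hu : ContMDiff (I n) 𝓘(ℝ, ℝ) ∞ u) :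
    ∫ p, diff (n := n) u p (S.xi p) ∂S.μ = 0 := by
  have h0 : SmoothForm (n := n) (fun _ : M => (0 : E n →L[ℝ] ℝ)) := fun x z _ => by
    have e : formRep x (fun _ : M => (0 : E n →L[ℝ] ℝ)) = fun _ => 0 := by
      funext z; simp [formRep]
    rw [e]; exact contDiffAt_const
  have hd : ∀ (p : M) (w : E n), extDeriv₁ S.eta p (S.xi p) w = (0 : E n →L[ℝ] ℝ) w := fun p w =>
    S.extDeriv₁_xi_eta p w
  -- Here γ = 0 and the constant is η(ξ) = 1.
  have h := integral_mul_contactTrace S.smoothForm_eta h0 S.bdet_contactB_ne_zero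
    S.smoothField_xi hd S.eta_xi hu
  have e : ∀ p, contactTrace S.eta (fun _ => 0) p = 0 := fun p => by
    have hC : contactB' S.eta (fun _ => 0) p = 0 := by
      ext v w
      have e : formRep p (fun _ : M => (0 : E n →L[ℝ] ℝ)) = fun _ => 0 := by
        funext z; simp [formRep]
      rw [contactB', formB'_apply, e]
      simp [extD]
    have hm : bmat (0 : LinearMap.BilinForm ℝ (E n)) = 0 := by
      ext i j; simp [bmat_apply]
    rw [contactTrace, hC, hm]; simp
  rw [← μ_eq] at h
  simpa only [e, zero_div, mul_zero, zero_add] using h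

/-- Let k be the derivative of the Laplacian along ξ; the aim is ∫k² = 0. Integrating by parts along
ξ turns ∫k² into minus the integral of the Laplacian against ξk, and that integral is ∫Z(ξk) =
∫ξ(Zk) = 0 because ξ and the gradient Z commute and ξ is divergence free. -/
theorem isBasic_basicLaplacian (hf : IsBasic (n := n) S.xi f) :
    IsBasic (n := n) S.xi (S.basicLaplacian f) := by
  have hh := contMDiff_basicLaplacian (S := S) hf.1
  refine ⟨hh, ?_⟩
  obtain ⟨Z, hZ, hη, hd, -⟩ := exists_gradient hf
  set k : M → ℝ := fun p => diff (n := n) (S.basicLaplacian f) p (S.xi p) with hkdef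
  have hk : ContMDiff (I n) 𝓘(ℝ, ℝ) ∞ k := contMDiff_diff_field hh S.smoothField_xi
  have hξk : ContMDiff (I n) 𝓘(ℝ, ℝ) ∞ fun p => diff (n := n) k p (S.xi p) :=
    contMDiff_diff_field hk S.smoothField_xi
  have h1 : ∫ p, S.basicLaplacian f p * diff (n := n) k p (S.xi p) ∂S.μ = 0 := by
    rw [integral_basicLaplacian_mul hf.1 hZ hη hd hξk, ← integral_diff_xi (S := S) (contMDiff_diff_field hk hZ)]
    refine integral_congr_ae (Eventually.of_forall fun p => ?_)
    have h2 := diff_bracket hk S.smoothField_xi hZ p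
    rw [bracket_xi_gradient hf hZ hη hd, ← diffForm_apply, map_zero] at h2
    beta_reduce
    linarith
  have h3 : ∫ p, k p * k p ∂S.μ = 0 := by
    have h4 := integral_diff_xi (S := S) (u := fun p => S.basicLaplacian f p * k p) (hh.mul hk)
    have h6 := fun p => diff_mul hh hk p (S.xi p)
    rw [integral_congr_ae (Eventually.of_forall h6)] at h4
    have h7 := (integral_add (μ := S.μ) (integrable_of_continuous (hh.continuous.mul hξk.continuous))
      (integrable_of_continuous (hk.continuous.mul hk.continuous))).symm.trans h4
    have h8 : (∫ p, S.basicLaplacian f p * diff (n := n) k p (S.xi p) ∂S.μ) + ∫ p, k p * k p ∂S.μ = 0 := h7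
    rwa [h1, zero_add] at h8
  by_contra! hne
  obtain ⟨p, hp⟩ := hne
  have hc : Continuous fun p => k p * k p := hk.continuous.mul hk.continuous
  exact (hc.integral_pos_of_hasCompactSupport_nonneg_nonzero (μ := S.μ)
    (HasCompactSupport.of_compactSpace _) (fun p => mul_self_nonneg _) (x := p)
    (mul_self_ne_zero.2 hp)).ne' h3

theorem isBasicLaplacian_basicLaplacian (hf : IsBasic (n := n) S.xi f) :
    S.IsBasicLaplacian f (S.basicLaplacian f) := by
  refine ⟨isBasic_basicLaplacian hf, ?_⟩
  obtain ⟨Z, hZ, hη, hd, hg⟩ := exists_gradient hf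
  exact ⟨Z, hg, fun u hu => integral_basicLaplacian_mul hf.1 hZ hη hd hu.1⟩

theorem integral_basicLaplacian (hf : IsBasic (n := n) S.xi f) : ∫ p, S.basicLaplacian f p ∂S.μ = 0 := by
  obtain ⟨Z, hZ, hη, hd, -⟩ := exists_gradient hf
  have h := integral_basicLaplacian_mul hf.1 hZ hη hd (contMDiff_const (c := (1 : ℝ)))
  simpa only [mul_one, diff_const, integral_zero] using h

end SasakianStructure

/-! ### First variation along a path of Sasakian structures. -/

namespace SasakianStructure

variable {n : ℕ} {M : Type*} [TopologicalSpace M] [ChartedSpace (E n) M] [IsManifold (I n) ∞ M]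

theorem eta_of_isDeformation {S S' : SasakianStructure n M} {φ : M → ℝ} (h : S.IsDeformation S' φ)
    (p : M) (v : E n) : S'.eta p v = S.eta p v / S.eta p (S'.xi p) - 1 / 2 *
      diff (n := n) φ p (S.phi p (v - ((S.eta p (S'.xi p))⁻¹ * S.eta p v) • S'.xi p)) := by
  have h1 : S'.eta p v = S.eta p v / S.eta p (S'.xi p) + 1 / 2 *
      -diff (n := n) φ p (S.phi p (v - ((S.eta p (S'.xi p))⁻¹ * S.eta p v) • S'.xi p)) := h.2.2 p v
  rw [h1]; ring

/-- The trace of `f η + γ / 2` with respect to the contact form. -/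
theorem contactTrace_smul_add {S : SasakianStructure n M} {f : M → ℝ} {γ : M → E n →L[ℝ] ℝ}
    (hf : ContMDiff (I n) 𝓘(ℝ, ℝ) ∞ f) (hγ : SmoothForm γ) (p : M) :
    contactTrace S.eta (fun p => f p • S.eta p + (1 / 2 : ℝ) • γ p) p =
      2 * (n + 1) * f p + 1 / 2 * contactTrace S.eta γ p := by
  have hfη := smoothForm_smul S.smoothForm_eta hf
  refine trace_first_variation (η := S.eta p) (δ := diffForm f p) (X := S.xi p)
    (S.bdet_contactB_ne_zero p) (S.contactB_xi p) (S.contactB_xi_left p) (S.eta_xi p) fun v w => ?_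
  rw [contactB'_apply (smoothForm_add_smul hfη hγ _), contactB'_apply hγ,
    contactB_apply S.smoothForm_eta, extDeriv₁_add_smul hfη hγ, extDeriv₁_smul S.smoothForm_eta hf]
  simp only [_root_.add_apply, _root_.smul_apply, smul_eq_mul, diffForm_apply]
  ring

section Path

variable {ε : ℝ} {S : ℝ → SasakianStructure n M} {φ : ℝ → M → ℝ}

/-- Smoothness in time is given for the Reeb fields and potentials only. For the contact forms it is
read off from their formula in terms of these and the fixed tensors at t = 0. -/
theorem jointSmoothForm_eta (hξ : SmoothFamily (n := n) ε fun t => (S t).xi)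
    (hφ : ContMDiffOn (𝓘(ℝ, ℝ).prod (I n)) 𝓘(ℝ, ℝ) ∞ (fun p : ℝ × M => φ p.1 p.2)
      (Ioo (-ε) ε ×ˢ univ))
    (hdef : ∀ t ∈ Ioo (-ε) ε, (S 0).IsDeformation (S t) (φ t)) {t : ℝ} (ht : t ∈ Ioo (-ε) ε) :
    JointSmoothForm (fun t => (S t).eta) t := by
  intro x
  have hx := ext_mem_target (n := n) x
  rw [contDiffAt_clm_apply_iff]
  intro e
  set A : ℝ × E n → E n →L[ℝ] ℝ := fun q => formRep x (S 0).eta q.2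
  set X : ℝ × E n → E n := fun q => fieldRep x (S q.1).xi q.2
  set Q : ℝ × E n → E n →L[ℝ] E n := fun q => endoRep x (S 0).phi q.2
  set F : ℝ × E n → ℝ := fun q => φ q.1 ((extChartAt (I n) x).symm q.2)
  have hA : ContDiffAt ℝ ∞ A (t, extChartAt (I n) x x) :=
    ContDiffAt.comp (g := formRep x (S 0).eta) (f := Prod.snd) (t, extChartAt (I n) x x)
      ((S 0).smoothForm_eta x _ hx) contDiffAt_snd
  have hQ : ContDiffAt ℝ ∞ Q (t, extChartAt (I n) x x) :=
    ContDiffAt.comp (g := endoRep x (S 0).phi) (f := Prod.snd) (t, extChartAt (I n) x x)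
      (contDiffAt_endoRep (S 0).smooth_Φ hx) contDiffAt_snd
  have hX : ContDiffAt ℝ ∞ X (t, extChartAt (I n) x x) := contDiffAt_fieldRep_family hξ ht hx
  have hF : ContDiffAt ℝ ∞ F (t, extChartAt (I n) x x) := contDiffAt_rep_family hφ ht hx
  have hAX := hA.clm_apply hX
  have hAe := hA.clm_apply (contDiffAt_const (c := e))
  have hne : A (t, extChartAt (I n) x x) (X (t, extChartAt (I n) x x)) ≠ 0 := by
    have h1 : A (t, extChartAt (I n) x x) (X (t, extChartAt (I n) x x)) = _ :=
      formRep_fieldRep hx (S 0).eta (S t).xi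
    rw [h1]
    exact (eta_pos (hdef t ht).1 _).ne'
  have h2 := ((hAe.div hAX hne).sub ((contDiffAt_const (c := (1 / 2 : ℝ))).mul
    ((contDiffAt_fderiv hF).clm_apply ((contDiffAt_const (c := (0 : ℝ))).prodMk (hQ.clm_apply
      ((contDiffAt_const (c := e)).sub (((hAX.inv hne).mul hAe).smul hX)))))))
  refine h2.congr_of_eventuallyEq ?_
  have e1 : ∀ᶠ q : ℝ × E n in 𝓝 (t, extChartAt (I n) x x), q.2 ∈ (extChartAt (I n) x).target :=
    continuousAt_snd.eventually (target_mem_nhds hx)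
  have e2 : ∀ᶠ q : ℝ × E n in 𝓝 (t, extChartAt (I n) x x), q.1 ∈ Ioo (-ε) ε :=
    continuousAt_fst.eventually (isOpen_Ioo.mem_nhds ht)
  filter_upwards [e1, e2, eventually_differentiableAt hF] with q hq hqt hqF
  have h3 : A q (X q) = (S 0).eta ((extChartAt (I n) x).symm q.2) ((S q.1).xi ((extChartAt (I n) x).symm q.2)) :=
    formRep_fieldRep hq (S 0).eta (S q.1).xi
  have h4 : frame x q.2 (X q) = (S q.1).xi ((extChartAt (I n) x).symm q.2) := frame_fieldRep hq _
  have h5 : ∀ u : E n, (S 0).phi ((extChartAt (I n) x).symm q.2) (frame x q.2 u) = frame x q.2 (Q q u) :=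
    fun u => (frame_coframe hq _).symm
  have h6 := eta_of_isDeformation (hdef q.1 hqt) ((extChartAt (I n) x).symm q.2) (frame x q.2 e)
  have h7 := diff_frame hq (mdifferentiable_of_contMDiff (hdef q.1 hqt).2.1.1 _)
    (Q q (e - ((A q (X q))⁻¹ * A q e) • X q))
  have h8 : fderiv ℝ F q (0, Q q (e - ((A q (X q))⁻¹ * A q e) • X q)) =
      fderiv ℝ (fun y => φ q.1 ((extChartAt (I n) x).symm y)) q.2
        (Q q (e - ((A q (X q))⁻¹ * A q e) • X q)) := (fderiv_slice hqF _).symm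
  have h9 : frame x q.2 e - ((A q (X q))⁻¹ * A q e) • (S q.1).xi ((extChartAt (I n) x).symm q.2) =
      frame x q.2 (e - ((A q (X q))⁻¹ * A q e) • X q) := by
    rw [map_sub, map_smul, h4]
  have h10 : (S 0).eta ((extChartAt (I n) x).symm q.2) (frame x q.2 e) = A q e := rfl
  rw [← h3, h10, h9, h5] at h6
  refine h6.trans ?_
  change _ = A q e / A q (X q) - 1 / 2 * fderiv ℝ F q (0, Q q (e - ((A q (X q))⁻¹ * A q e) • X q))
  rw [h8]
  exact congrArg (fun r : ℝ => A q e / A q (X q) - 1 / 2 * r) h7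

/-- The velocity of the contact forms. -/
theorem hasDerivAt_eta (hε : 0 < ε) {ξ' : M → E n} {φ' : M → ℝ}
    (hξ : SmoothFamily (n := n) ε fun t => (S t).xi)
    (hφ : ContMDiffOn (𝓘(ℝ, ℝ).prod (I n)) 𝓘(ℝ, ℝ) ∞ (fun p : ℝ × M => φ p.1 p.2)
      (Ioo (-ε) ε ×ˢ univ))
    (hdef : ∀ t ∈ Ioo (-ε) ε, (S 0).IsDeformation (S t) (φ t))
    (hv : HasVelocity (n := n) (fun t => (S t).xi) ξ')
    (hφ' : ∀ p, HasDerivAt (fun t => φ t p) (φ' p) 0) (p : M) :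
    HasDerivAt (fun t => (S t).eta p)
      (-(S 0).eta p (ξ' p) • (S 0).eta p + (1 / 2 : ℝ) • (S 0).dcForm φ' p) 0 ∧
      diff (n := n) φ' p ((S 0).xi p) = 0 := by
  have hI : Ioo (-ε) ε ∈ 𝓝 (0 : ℝ) := Ioo_mem_nhds (by linarith) hε
  have h0 := mem_of_mem_nhds hI
  have hx := ext_mem_target (n := n) p
  set F : ℝ × E n → ℝ := fun q => φ q.1 ((extChartAt (I n) p).symm q.2) with hFdef
  set z := extChartAt (I n) p p with hz
  have hF : ContDiffAt ℝ ∞ F (0, z) := contDiffAt_rep_family hφ h0 hx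
  set G : ℝ → E n →L[ℝ] ℝ := fun t => (fderiv ℝ F (t, z)).comp (ContinuousLinearMap.inr ℝ ℝ (E n)) with hG
  have hφs : ContMDiff (I n) 𝓘(ℝ, ℝ) ∞ φ' :=
    JointSmoothAt.contMDiff_deriv (t₀ := 0) (fun x => contDiffAt_rep_family hφ h0 (ext_mem_target x)) hφ'
  have hcont : ContinuousAt (fun t : ℝ => (t, z)) 0 := by fun_prop
  have hGd : ∀ᶠ t in 𝓝 (0 : ℝ), ∀ v : E n, diff (n := n) (φ t) p v = G t v := by
    filter_upwards [hcont.eventually (eventually_differentiableAt hF), hI] with t ht htI v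
    rw [diff_eq_fderiv (mdifferentiable_of_contMDiff (hdef t htI).2.1.1 p)]
    exact fderiv_slice ht v
  -- The derivative exists as an operator by joint smoothness; it is then identified on each vector
  -- by exchanging time and space derivatives.
  have hG' : HasDerivAt G (diffForm φ' p) 0 := by
    have h1 := (hasDerivAt_timeDeriv ((contDiffAt_fderiv hF).differentiableAt (by simp))).clm_comp
      (hasDerivAt_const (0 : ℝ) (ContinuousLinearMap.inr ℝ ℝ (E n)))
    refine h1.congr_deriv ?_
    ext w
    have h2 : HasDerivAt (fun t => G t w) (diff (n := n) φ' p w) 0 := by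
      have h3 := hasDerivAt_fderiv_family hF w
      have h4 : (fun y => timeDeriv F (0, y)) =ᶠ[𝓝 z] fun y => φ' ((extChartAt (I n) p).symm y) := by
        have hc : ContinuousAt (fun y : E n => ((0 : ℝ), y)) z := by fun_prop
        filter_upwards [hc.eventually (eventually_differentiableAt hF)] with y hy
        exact timeDeriv_eq hφ' hy
      rw [h4.fderiv_eq, ← diff_eq_fderiv (mdifferentiable_of_contMDiff hφs p)] at h3
      refine h3.congr_of_eventuallyEq ?_
      filter_upwards [hcont.eventually (eventually_differentiableAt hF)] with t ht
      exact (fderiv_slice ht w).symm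
    have h5 := h1.clm_apply (hasDerivAt_const (0 : ℝ) w)
    rw [map_zero, add_zero] at h5
    exact h5.unique h2
  -- At t = 0 the deformation formula compares η with itself, so dφ₀ ∘ Φ = 0; together with ξφ₀ = 0
  -- this gives dφ₀ = 0. Hence the motion of the transverse complex structure does not contribute to
  -- first order.
  have hG0 : ∀ v, G 0 v = 0 := by
    have h1 := hGd.self_of_nhds
    have h2 : ∀ v, G 0 ((S 0).phi p v) = 0 := fun v => by
      have h3 := eta_of_isDeformation (hdef 0 h0) p v
      rw [eta_xi, h1, map_sub, map_smul, phi_xi, smul_zero, sub_zero, div_one] at h3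
      linarith
    have h4 : G 0 ((S 0).xi p) = 0 := by rw [← h1]; exact (hdef 0 h0).2.1.2 p
    intro v
    have h5 := congrArg (G 0) ((S 0).phi_phi p v)
    rw [h2, map_add, map_neg, map_smul, h4, smul_zero, add_zero] at h5
    linarith
  have hG0' : G 0 = 0 := by ext v; exact hG0 v
  have hxi : HasDerivAt (fun t => (S t).xi p) (ξ' p) 0 := hv p
  have hηξ : HasDerivAt (fun t => (S 0).eta p ((S t).xi p)) ((S 0).eta p (ξ' p)) 0 :=
    ((S 0).eta p).hasFDerivAt.comp_hasDerivAt 0 hxi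
  have hηξ1 : (S 0).eta p ((S 0).xi p) = 1 := (S 0).eta_xi p
  have hinv : HasDerivAt (fun t => ((S 0).eta p ((S t).xi p))⁻¹) (-(S 0).eta p (ξ' p)) 0 := by
    have := hηξ.fun_inv (by rw [hηξ1]; exact one_ne_zero)
    rw [hηξ1] at this
    simpa using this
  constructor
  -- Joint smoothness supplies the derivative of the operators, and evaluation on vectors computes
  -- it.
  · have hJ := jointSmoothForm_eta hξ hφ hdef h0 p
    have h1 := hasDerivAt_timeDeriv (hJ.differentiableAt (by simp))
    simp only [formRep_self] at h1
    refine h1.congr_deriv ?_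
    ext v
    have h2 := h1.clm_apply (hasDerivAt_const (0 : ℝ) v)
    rw [map_zero, add_zero] at h2
    have hu : HasDerivAt (fun t => (S 0).phi p (v - (((S 0).eta p ((S t).xi p))⁻¹ * (S 0).eta p v) • (S t).xi p))
        ((S 0).phi p (-(((S 0).eta p ((S 0).xi p))⁻¹ * (S 0).eta p v) • ξ' p +
          (-(-(S 0).eta p (ξ' p) * (S 0).eta p v)) • (S 0).xi p)) 0 := by
      refine ((S 0).phi p).hasFDerivAt.comp_hasDerivAt 0 ?_
      refine (((hinv.mul_const _).fun_smul hxi).const_sub v).congr_deriv ?_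
      rw [neg_add, neg_smul, neg_smul]
    have h3 : HasDerivAt (fun t => (S t).eta p v)
        (-(S 0).eta p (ξ' p) * (S 0).eta p v - 1 / 2 * diffForm φ' p ((S 0).phi p v)) 0 := by
      have h4 := (hinv.mul_const ((S 0).eta p v)).fun_sub ((hG'.clm_apply hu).const_mul (1 / 2 : ℝ))
      rw [hG0', zero_apply, add_zero, hηξ1, map_sub, map_smul, phi_xi, smul_zero, sub_zero] at h4
      refine h4.congr_of_eventuallyEq ?_
      filter_upwards [hGd, hI] with t ht htI
      rw [eta_of_isDeformation (hdef t htI) p v, ht, div_eq_inv_mul]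
    refine (h2.unique h3).trans ?_
    change _ = -(S 0).eta p (ξ' p) * (S 0).eta p v + 1 / 2 * -diffForm φ' p ((S 0).phi p v)
    ring
  -- Differentiating dφ_t(ξ_t) = 0 leaves dφ̇(ξ) = 0, since dφ₀ = 0 removes the other term.
  · have h1 := hG'.clm_apply hxi
    rw [hG0', zero_apply, add_zero] at h1
    refine h1.unique ((hasDerivAt_const (0 : ℝ) (0 : ℝ)).congr_of_eventuallyEq ?_)
    filter_upwards [hGd, hI] with t ht htI
    rw [← ht]
    exact (hdef t htI).2.1.2 p

variable [T2Space M] [CompactSpace M] [MeasurableSpace M] [BorelSpace M]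

/-- The first variation of the volume element along a path of Sasakian structures. -/
theorem exists_density (hε : 0 < ε) {ξ' : M → E n} {φ' : M → ℝ}
    (hξ : SmoothFamily (n := n) ε fun t => (S t).xi)
    (hφ : ContMDiffOn (𝓘(ℝ, ℝ).prod (I n)) 𝓘(ℝ, ℝ) ∞ (fun p : ℝ × M => φ p.1 p.2)
      (Ioo (-ε) ε ×ˢ univ))
    (hdef : ∀ t ∈ Ioo (-ε) ε, (S 0).IsDeformation (S t) (φ t))
    (hv : HasVelocity (n := n) (fun t => (S t).xi) ξ')
    (hφ' : ∀ p, HasDerivAt (fun t => φ t p) (φ' p) 0) :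
    (∃ (ρ : ℝ → M → ℝ) (h : M → ℝ), (S 0).IsBasicLaplacian φ' h ∧
      (∀ t, ContMDiff (I n) 𝓘(ℝ, ℝ) ∞ (ρ t) ∧ (∀ p, 0 < ρ t p) ∧
        (S t).μ = (S 0).μ.withDensity fun p => ENNReal.ofReal (ρ t p)) ∧
      ∃ C δ : ℝ, 0 < δ ∧ ∀ t : ℝ, |t| < δ → ∀ p : M,
        |ρ t p - (1 - t * ((n + 1) * (S 0).eta p (ξ' p) + 1 / 2 * h p))| ≤ C * t ^ 2) ∧
    HasDerivAt (fun t => (S t).μ.real univ)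
      (-((n : ℝ) + 1) * ∫ p, (S 0).eta p (ξ' p) ∂(S 0).μ) 0 := by
  have hI : Ioo (-ε) ε ∈ 𝓝 (0 : ℝ) := Ioo_mem_nhds (by linarith) hε
  have h0 := mem_of_mem_nhds hI
  have hφs : ContMDiff (I n) 𝓘(ℝ, ℝ) ∞ φ' :=
    JointSmoothAt.contMDiff_deriv (t₀ := 0) (fun x => contDiffAt_rep_family hφ h0 (ext_mem_target x)) hφ'
  have hfs : ContMDiff (I n) 𝓘(ℝ, ℝ) ∞ fun p => (S 0).eta p (ξ' p) :=
    (jointSmoothAt_apply (S 0).smoothForm_eta hξ h0).contMDiff_deriv fun p =>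
      hasDerivAt_apply (α := (S 0).eta) hv p
  have hb : IsBasic (n := n) (S 0).xi φ' := ⟨hφs, fun p => (hasDerivAt_eta hε hξ hφ hdef hv hφ' p).2⟩
  have hne := fun t => (S t).bdet_contactB_ne_zero
  have hpos := fun t => (S t).contactDensity_eta_pos
  set ρ : ℝ → M → ℝ := fun t p => contactDensity (S t).eta p / contactDensity (S 0).eta p with hρ
  have hJ : JointSmoothAt n ρ 0 := jointSmoothAt_contactDensity_div (jointSmoothForm_eta hξ hφ hdef h0)
    (Eventually.of_forall fun t => (S t).smoothForm_eta) (hne 0) (S 0).smoothForm_eta (hne 0)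
  have hρs : ∀ t, ContMDiff (I n) 𝓘(ℝ, ℝ) ∞ (ρ t) := fun t =>
    (jointSmoothAt_contactDensity_div (t₀ := 0) (α := fun _ => (S t).eta) (fun x =>
      ContDiffAt.comp (g := formRep x (S t).eta) (f := Prod.snd) (0, extChartAt (I n) x x)
        ((S t).smoothForm_eta x _ (ext_mem_target x)) contDiffAt_snd)
      (Eventually.of_forall fun _ => (S t).smoothForm_eta) (hne t) (S 0).smoothForm_eta (hne 0)).contMDiff
  have hμ : ∀ t, (S t).μ = (S 0).μ.withDensity fun p => ENNReal.ofReal (ρ t p) := fun t => by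
    rw [← densityMeasure_eta_mul _ (hρs t).continuous.measurable, μ_eq]
    congr 1
    funext p
    rw [hρ, mul_div_cancel₀ _ (hpos 0 p).ne']
  have hρd : ∀ p, HasDerivAt (fun t => ρ t p)
      (-(((n : ℝ) + 1) * (S 0).eta p (ξ' p) + 1 / 2 * (S 0).basicLaplacian φ' p)) 0 := fun p => by
    have h1 := (hasDerivAt_contactDensity (jointSmoothForm_eta hξ hφ hdef h0)
      (α' := fun p => -(S 0).eta p (ξ' p) • (S 0).eta p + (1 / 2 : ℝ) • (S 0).dcForm φ' p)
      (fun p => (hasDerivAt_eta hε hξ hφ hdef hv hφ' p).1) (hne 0 p)).div_const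
        (contactDensity (S 0).eta p)
    have hns : ContMDiff (I n) 𝓘(ℝ, ℝ) ∞ fun p => -(S 0).eta p (ξ' p) := hfs.neg
    rw [mul_div_cancel_left₀ _ (hpos 0 p).ne', contactTrace_smul_add hns (smoothForm_dcForm hφs)] at h1
    refine h1.congr_deriv ?_
    rw [basicLaplacian]
    ring
  have hρ0 : ∀ p, ρ 0 p = 1 := fun p => div_self (hpos 0 p).ne'
  refine ⟨⟨ρ, (S 0).basicLaplacian φ', isBasicLaplacian_basicLaplacian hb,
    fun t => ⟨hρs t, fun p => div_pos (hpos t p) (hpos 0 p), hμ t⟩, ?_⟩, ?_⟩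
  -- The density ratio is 1 at t = 0, so its uniform Taylor expansion there is the asserted one.
  · obtain ⟨C, δ, hδ, hT⟩ := hJ.taylor hρd
    refine ⟨C, δ, hδ, fun t ht p => ?_⟩
    have h1 := hT t (by rwa [sub_zero]) p
    rw [sub_zero, hρ0] at h1
    refine (congrArg abs ?_).trans_le h1
    ring
  · have h1 := hJ.hasDerivAt_integral (m := (S 0).μ) hρd (Eventually.of_forall fun t => (hρs t).continuous)
    have h2 : (fun t => (S t).μ.real univ) = fun t => ∫ p, ρ t p ∂(S 0).μ := by
      funext t
      rw [hμ t, real_univ_withDensity (hρs t).continuous fun p =>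
        (div_pos (hpos t p) (hpos 0 p)).le]
    rw [h2]
    refine h1.congr_deriv ?_
    -- The Laplacian term integrates to zero, leaving only the mean of η(ξ̇).
    rw [integral_neg, integral_add
      ((integrable_of_continuous hfs.continuous).const_mul _)
      ((integrable_of_continuous (contMDiff_basicLaplacian hφs).continuous).const_mul _),
      integral_const_mul, integral_const_mul, integral_basicLaplacian hb]
    ring

end Path

end SasakianStructure

end Sasaki

end

theorem proposition4p1 (n : ℕ) {M : Type*} [TopologicalSpace M] [T2Space M] [CompactSpace M]
    [ChartedSpace (Sasaki.E n) M] [IsManifold (Sasaki.I n) ∞ M]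
    [MeasurableSpace M] [BorelSpace M] (S₀ : Sasaki.SasakianStructure n M) :
    -- first order variation along a path of Sasakian structures that starts at `S₀`
    (∀ (ε : ℝ) (S : ℝ → Sasaki.SasakianStructure n M) (φ : ℝ → M → ℝ)
        (ξ' : Π x : M, TangentSpace (Sasaki.I n) x) (φ' : M → ℝ),
      0 < ε → S 0 = S₀ →
      Sasaki.SasakianStructure.SmoothFamily ε (fun t => (S t).ξ) →
      ContMDiffOn (𝓘(ℝ, ℝ).prod (Sasaki.I n)) 𝓘(ℝ, ℝ) ∞
        (fun p : ℝ × M => φ p.1 p.2) (Ioo (-ε) ε ×ˢ univ) →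
      (∀ t ∈ Ioo (-ε) ε, S₀.IsDeformation (S t) (φ t)) →
      Sasaki.SasakianStructure.HasVelocity (fun t => (S t).ξ) ξ' →
      (∀ x, HasDerivAt (fun t => φ t x) (φ' x) 0) →
      -- the volume elements
      (∃ (ρ : ℝ → M → ℝ) (h : M → ℝ),
        S₀.IsBasicLaplacian φ' h ∧
        (∀ t ∈ Ioo (-ε) ε, ContMDiff (Sasaki.I n) 𝓘(ℝ, ℝ) ∞ (ρ t) ∧ (∀ x, 0 < ρ t x) ∧
          (S t).μ = S₀.μ.withDensity (fun x => ENNReal.ofReal (ρ t x))) ∧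
        ∃ C δ : ℝ, 0 < δ ∧ ∀ t : ℝ, |t| < δ → ∀ x : M,
          |ρ t x - (1 - t * ((n + 1) * S₀.η x (ξ' x) + (1 / 2) * h x))| ≤ C * t ^ 2) ∧
      -- the volume of `M`
      (∀ t ∈ Ioo (-ε) ε, (S t).μ univ < ⊤) ∧
      HasDerivAt (fun t => (S t).μ.real univ)
        (-((n : ℝ) + 1) * ∫ x, S₀.η x (ξ' x) ∂S₀.μ) 0 ∧
      -- preservation of the volume
      (HasDerivAt (fun t => (S t).μ.real univ) 0 0 ↔
        ∀ c : ℝ, ∫ x, S₀.η x (ξ' x) * c ∂S₀.μ = 0) ∧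
      ((∫ x, S₀.g.inner x (S₀.ξ x) (ξ' x) ∂S₀.μ = 0) ↔
        ∀ c : ℝ, ∫ x, S₀.η x (ξ' x) * c ∂S₀.μ = 0)) ∧
    -- `coneVolume` is the volume of every Sasakian structure over a given point of the cone
    (∀ (S : Sasaki.SasakianStructure n M) (φ : M → ℝ),
      S₀.IsDeformation S φ → S₀.SameTransverse S → S.μ.real univ = S₀.coneVolume S.ξ) ∧
    -- the velocities of volume preserving paths in the cone
    (∀ X ∈ S₀.cr,
      (∃ (ε : ℝ) (ζ : ℝ → Π x : M, TangentSpace (Sasaki.I n) x),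
        0 < ε ∧ ζ 0 = S₀.ξ ∧ Sasaki.SasakianStructure.SmoothFamily ε ζ ∧
        (∀ t ∈ Ioo (-ε) ε, ζ t ∈ S₀.crPos) ∧
        Sasaki.SasakianStructure.HasVelocity ζ X ∧
        ∀ t ∈ Ioo (-ε) ε, S₀.coneVolume (ζ t) = S₀.coneVolume S₀.ξ) ↔
      ∀ c : ℝ, ∫ x, S₀.η x (X x) * c ∂S₀.μ = 0) ∧
    -- the Hessian of the volume functional
    (∀ X ∈ S₀.cr, ∀ Y ∈ S₀.cr, ∃ D : ℝ → ℝ,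
      (∀ᶠ s in 𝓝 (0 : ℝ),
        HasDerivAt (fun t : ℝ => S₀.coneVolume (S₀.ξ + s • X + t • Y)) (D s) 0) ∧
      HasDerivAt D (((n : ℝ) + 1) * (n + 2) * ∫ x, S₀.η x (X x) * S₀.η x (Y x) ∂S₀.μ) 0) ∧
    -- convexity
    ConvexOn ℝ S₀.crPos S₀.coneVolume := by
  -- Orthogonality to all constants is orthogonality to the constant 1.
  have hc : ∀ f : M → ℝ, (∀ c : ℝ, ∫ x, f x * c ∂S₀.μ = 0) ↔ ∫ x, f x ∂S₀.μ = 0 := fun f =>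
    ⟨fun h => by simpa using h 1, fun h c => by rw [integral_mul_const, h, zero_mul]⟩
  refine ⟨?_, ?_, ?_, ?_, Sasaki.SasakianStructure.convexOn_coneVolume S₀⟩
  · intro ε S φ ξ' φ' hε h0 hξ hφ hdef hv hφ'
    subst h0
    obtain ⟨⟨ρ, h, hL, hρ, hT⟩, hV⟩ :=
      Sasaki.SasakianStructure.exists_density hε hξ hφ hdef hv hφ'
    have hn : -((n : ℝ) + 1) ≠ 0 := neg_ne_zero.2 n.cast_add_one_ne_zero
    refine ⟨⟨ρ, h, hL, fun t _ => hρ t, hT⟩, fun t _ => measure_lt_top _ _, hV, ?_, ?_⟩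
    · rw [hc]
      refine ⟨fun h1 => (mul_eq_zero.1 (hV.unique h1)).resolve_left hn, fun h1 => ?_⟩
      refine hV.congr_deriv ?_
      exact mul_eq_zero_of_right _ h1
    · rw [hc]
      -- The contact form is metrically dual to the Reeb field, so the two integrals in question
      -- coincide.
      have e : ∀ x, (S 0).g.inner x ((S 0).ξ x) (ξ' x) = (S 0).η x (ξ' x) := fun x =>
        ((S 0).gB_symm x ((S 0).xi x) (ξ' x)).trans ((S 0).gB_xi x (ξ' x))
      rw [integral_congr_ae (Eventually.of_forall e)]
  · exact fun S φ h hJ => Sasaki.SasakianStructure.volume_eq_coneVolume h.1 hJ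
  · intro X hX
    rw [hc]
    constructor
    · rintro ⟨ε, ζ, hε, h0, hζ, hpos, hv, hvol⟩
      exact Sasaki.SasakianStructure.integral_eta_eq_zero_of_path hε h0 hζ hpos hv hvol
    · exact fun h => Sasaki.SasakianStructure.exists_path_of_integral_eq_zero hX h
  · exact fun X hX Y hY => Sasaki.SasakianStructure.hessian_coneVolume hX hY
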